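/- **Setting.** Let $n\ge 1$ objects have sizes $s_1,\dots,s_n>0$ and let a cache have capacity $B\ge 0$. For each object $i$ let $0<T_{i,1}<T_{i,2}<\cdots\to\infty$ be its random request epochs, put $T_{i,0}:=0$ and $X_{i,k}:=T_{i,k}-T_{i,k-1}$. Assume that each process is regular, i.e. the conditional law of $X_{i,k}$ given $T_{i,1},\dots,T_{i,k-1}$ is almost surely absolutely continuous. Let $\mathcal H_{i,t}$ be the history of the epochs of object $i$ that are $<t$, $\mathcal H_t=\bigvee_i\mathcal H_{i,t}$, and let $T_{i,k_i(t)}$ be the first epoch of object $i$ that is $\ge t$. Assume that for all $t>0$ and all $t_1,\dots,t_n\ge t$, $$\mathbb P\big(T_{i,k_i(t)}\ge t_i\ \ \forall i\,\big|\,\mathcal H_t\big)=\prod_{i=1}^n\mathbb P\big(T_{i,k_i(t)}\ge t_i\,\big|\,\mathcal H_{i,t}\big)\quad\text{a.s.}$$ The hazard rate of object $i$ at a time $t$ with $T_{i,k-1}<t\le T_{i,k}$ is $$\lambda^*_i(t)=\frac{\frac{d}{dt}\,\mathbb P(X_{i,k}<t-T_{i,k-1}\mid T_{i,1},\dots,T_{i,k-1})}{\mathbb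 P(X_{i,k}>t-T_{i,k-1}\mid T_{i,1},\dots,T_{i,k-1})},$$ where $T_{i,k-1}$ is treated as a constant under the conditioning. Let $T_1<T_2<\cdots$ be the superposition of all requests and $R_k$ the object requested at $T_k$. An *indivisible-caching policy* $\pi\in\Pi_{IC}$ is a measurable deterministic map which sends a time $t$ and the record of the requests made before $t$ (epochs and objects) to a set of objects of total size at most $B$. Let $B^\pi_k$ be its value at $T_k$, $H^\pi_k=\mathbf 1(R_k\in B^\pi_k)$ and $N^\pi_K=\sum_{k=1}^K H^\pi_k$. When it exists, the hit probability $h^\pi$ is the constant with $N^\pi_K/K\to h^\pi$ a.s. The rule *HR-VC* lists the objects at time $T_k$ so that $\lambda^*_{i_1}(T_k)/s_{i_1}\ge\cdots\ge\lambda^*_{i_n}(T_k)/s_{i_n}$ (ties broken arbitrarily, possibly at random) and caches $i_1,\dots,i_a$, where $a$ is the largest index with $s_{i_1}+\cdots+s_{i_a}\le B$. If $a<n$, it also caches $i_{a+1}$ with probability $(B-s_{i_1}-\cdots-s_{i_a})/s_{i_{a+1}}$, the randomization being independent of the request processes. No other object is cached. Let $H^{HR\text{-}VC}_k$ indicate that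 $R_k$ is cached at $T_k$, and $N^{HR\text{-}VC}_K=\sum_{k=1}^KH^{HR\text{-}VC}_k$. **Claim 1.** For all $\pi\in\Pi_{IC}$ and all $K\ge 0$, $\ \mathbb E[N^{HR\text{-}VC}_K]\ \ge\ \mathbb E[N^\pi_K]$. Moreover, whenever $h^\pi$ exists, $h^\pi=\lim_K\mathbb E[N^\pi_K]/K\le\liminf_K\mathbb E[N^{HR\text{-}VC}_K]/K$. **Claim 2.** Suppose instead that the requests for object $i$ form a two-sided point process $\cdots<T_{i,-1}<T_{i,0}\le 0<T_{i,1}<\cdots$ with $T_{i,k}\to\pm\infty$ as $k\to\pm\infty$, that these processes are mutually independent, that each is stationary and ergodic under time shifts with finite intensity, and that the epochs $T_{i,k}$, $k\ge 1$, form regular processes in the above sense. All quantities above are formed from the epochs $T_{i,k}$, $k\ge1$ (in the definition of $X_{i,1}$ and $\lambda_i^*$ the epoch $T_{i,0}$ is replaced by $0$). Then the limit $$h^{HR\text{-}VC}=\lim_{K\to\infty}\frac1K\sum_{k=1}^{K}\mathbb E[H^{HR\text{-}VC}_k]=\lim_{K\to\infty}\frac{\mathbb E[N^{HR\text{-}VC}_K]}{K}$$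 exists, and for every $\pi\in\Pi_{IC}$ for which $h^\pi$ exists, $$h^\pi=\lim_{K\to\infty}\frac{\mathbb E[N^\pi_K]}{K}\ \le\ h^{HR\text{-}VC}.$$ -/

import Mathlib

open MeasureTheory ProbabilityTheory Set Filter Topology


noncomputable section

namespace Caching

variable {Ω : Type*} {n : ℕ}

/-! ### Request processes

`T i k ω` is the epoch of the `(k+1)`-st request for object `i` (so `T i 0` is the first one). -/

/-- The number of requests for object `i` made in `[0, t)`. -/
def reqCount (T : Fin n → ℕ → Ω → ℝ) (i : Fin n) (t : ℝ) (ω : Ω) : ℕ :=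
  sInf {k | t ≤ T i k ω}

/-- The first request for object `i` that is not in the history before `t`. -/
def nextRequest (T : Fin n → ℕ → Ω → ℝ) (i : Fin n) (t : ℝ) (ω : Ω) : ℝ :=
  T i (reqCount T i t ω) ω

/-- The epoch preceding `T i k`, with the convention that it is `0` for the first request. -/
def prevEpoch (T : Fin n → ℕ → Ω → ℝ) (i : Fin n) : ℕ → Ω → ℝ
  | 0, _ => 0
  | k + 1, ω => T i k ω

/-- The inter-request times of object `i`; the first one is the first epoch itself. -/
def interRequest (T : Fin n → ℕ → Ω → ℝ) (i : Fin n) (k : ℕ) (ω : Ω) : ℝ :=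
  T i k ω - prevEpoch T i k ω

/-- The first `k` request epochs of object `i`. -/
def pastEpochs (T : Fin n → ℕ → Ω → ℝ) (i : Fin n) (k : ℕ) (ω : Ω) : Fin k → ℝ :=
  fun j => T i j ω

/-- The sigma-algebra of the history of object `i` strictly before time `t`: it is generated by the
events `T i k < r` with `r ≤ t`. -/
@[reducible]
def objHistory (T : Fin n → ℕ → Ω → ℝ) (i : Fin n) (t : ℝ) : MeasurableSpace Ω :=
  ⨆ k : ℕ, MeasurableSpace.comap (fun ω => min (T i k ω) t) inferInstance

/-- The history of all objects strictly before time `t`. -/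
@[reducible]
def history (T : Fin n → ℕ → Ω → ℝ) (t : ℝ) : MeasurableSpace Ω :=
  ⨆ i : Fin n, objHistory T i t

section Model

variable [MeasurableSpace Ω]

/-- The conditional law of the `(k+1)`-st inter-request time of object `i` given the first `k`
epochs of that object. -/
def condLaw (P : Measure Ω) [IsFiniteMeasure P] (T : Fin n → ℕ → Ω → ℝ) (i : Fin n) (k : ℕ) :
    Kernel (Fin k → ℝ) ℝ :=
  condDistrib (interRequest T i k) (pastEpochs T i k) P

/-- The hazard rate (conditional intensity) of object `i` at time `t`, given its own history
strictly before `t`: the `t`-derivative of the conditional distribution function of the current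
inter-request time, divided by its conditional survival probability. -/
def hazardRate (P : Measure Ω) [IsFiniteMeasure P] (T : Fin n → ℕ → Ω → ℝ) (i : Fin n) (t : ℝ)
    (ω : Ω) : ℝ :=
  let k := reqCount T i t ω
  let a := prevEpoch T i k ω
  let κ := condLaw P T i k (pastEpochs T i k ω)
  deriv (fun r => κ.real (Iio (r - a))) t / κ.real (Ioi (t - a))

/-- The request epochs of every object form a regular point process on `(0, ∞)`: they are positive,
strictly increasing, locally finite, and every inter-request time has a conditional
density given the previous epochs. -/
structure IsRegularRequests (P : Measure Ω) [IsFiniteMeasure P] (T : Fin n → ℕ → Ω → ℝ) :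
    Prop where
  measurable : ∀ i k, Measurable (T i k)
  points : ∀ i, ∀ᵐ ω ∂P, 0 < T i 0 ω ∧ StrictMono (fun k => T i k ω) ∧
    Tendsto (fun k => T i k ω) atTop atTop
  density : ∀ i k, ∀ᵐ x ∂(P.map (pastEpochs T i k)), condLaw P T i k x ≪ volume

/-- At every time `t`, given the history before `t`, the next requests of the different objects are
independent, and each depends only on the history of its own object. -/
def CondIndepRequests (P : Measure Ω) (T : Fin n → ℕ → Ω → ℝ) : Prop :=
  ∀ t : ℝ, 0 < t → ∀ r : Fin n → ℝ, (∀ i, t ≤ r i) →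
    P⟦{ω | ∀ i, r i ≤ nextRequest T i t ω} | history T t⟧
      =ᵐ[P] fun ω => ∏ i, (P⟦{ω' | r i ≤ nextRequest T i t ω'} | objHistory T i t⟧) ω

end Model

/-! ### Superposition of the request processes -/

section Superposition

variable [NeZero n]

theorem minimizers_nonempty (a : Fin n → ℝ) :
    (Finset.univ.filter fun i => ∀ j, a i ≤ a j).Nonempty := by
  obtain ⟨i, -, hi⟩ := Finset.exists_min_image (Finset.univ : Finset (Fin n)) a
    ⟨0, Finset.mem_univ _⟩
  exact ⟨i, by simpa using fun j => hi j (Finset.mem_univ j)⟩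

/-- The (least) index at which a finite family of reals is minimal. -/
def argmin (a : Fin n → ℝ) : Fin n :=
  (Finset.univ.filter fun i => ∀ j, a i ≤ a j).min' (minimizers_nonempty a)

/-- The numbers of requests for the individual objects among the first `k` requests overall. -/
def counts (T : Fin n → ℕ → Ω → ℝ) : ℕ → Ω → Fin n → ℕ
  | 0, _ => 0
  | k + 1, ω =>
      let c := counts T k ω
      let i := argmin fun j => T j (c j) ω
      Function.update c i (c i + 1)

/-- The object asked for by the `(k+1)`-st request overall. -/
def requested (T : Fin n → ℕ → Ω → ℝ) (k : ℕ) (ω : Ω) : Fin n :=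
  argmin fun j => T j (counts T k ω j) ω

/-- The epoch of the `(k+1)`-st request overall. -/
def epoch (T : Fin n → ℕ → Ω → ℝ) (k : ℕ) (ω : Ω) : ℝ :=
  T (requested T k ω) (counts T k ω (requested T k ω)) ω

/-- The first `k` requests overall: their epochs and the requested objects. -/
def record (T : Fin n → ℕ → Ω → ℝ) (k : ℕ) (ω : Ω) : Fin k → ℝ × Fin n :=
  fun j => (epoch T j ω, requested T j ω)

end Superposition

/-! ### Caching policies for indivisible objects of sizes `s i`, with cache capacity `B` -/

/-- A non-anticipative deterministic policy for indivisible objects: a measurable map that sends the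
current time `t` and the record of the `m` requests made before `t` to the set of cached objects,
whose total size is at most `B`. -/
structure ICPolicy (s : Fin n → ℝ) (B : ℝ) where
  cache : (m : ℕ) → ℝ → (Fin m → ℝ × Fin n) → Finset (Fin n)
  measurable : ∀ m i, MeasurableSet {p : ℝ × (Fin m → ℝ × Fin n) | i ∈ cache m p.1 p.2}
  capacity : ∀ m t h, ∑ i ∈ cache m t h, s i ≤ B

section Hits

variable [NeZero n] {s : Fin n → ℝ} {B : ℝ}

open Classical in
/-- `1` if the object of the `(k+1)`-st request is in the cache just before it, `0` otherwise. -/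
def hit (T : Fin n → ℕ → Ω → ℝ) (π : ICPolicy s B) (k : ℕ) (ω : Ω) : ℝ :=
  if requested T k ω ∈ π.cache k (epoch T k ω) (record T k ω) then 1 else 0

/-- The number of hits among the first `K` requests. -/
def numHits (T : Fin n → ℕ → Ω → ℝ) (π : ICPolicy s B) (K : ℕ) (ω : Ω) : ℝ :=
  ∑ k ∈ Finset.range K, hit T π k ω

/-- `h` is the hit probability of `π`: the almost sure limit of the fraction of hits. -/
def HasHitProbability [MeasurableSpace Ω] (P : Measure Ω) (T : Fin n → ℕ → Ω → ℝ)
    (π : ICPolicy s B) (h : ℝ) : Prop :=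
  ∀ᵐ ω ∂P, Tendsto (fun K : ℕ => numHits T π K ω / K) atTop (𝓝 h)

end Hits

/-! ### The rule HR-VC -/

/-- A way of listing the objects in decreasing order of given ratios. Ties may be broken at random,
through the first argument. -/
structure DecreasingOrder (n : ℕ) where
  perm : unitInterval → (Fin n → ℝ) → Equiv.Perm (Fin n)
  antitone : ∀ (v : unitInterval) (r : Fin n → ℝ), Antitone fun j => r (perm v r j)
  measurable : ∀ ρ, MeasurableSet {p : unitInterval × (Fin n → ℝ) | perm p.1 p.2 = ρ}

/-- The total size of the objects listed before position `m`. -/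
def sizeBefore (s : Fin n → ℝ) (ρ : Equiv.Perm (Fin n)) (m : Fin n) : ℝ :=
  ∑ j ∈ Finset.Iio m, s (ρ j)

/-- Greedy filling in the order `ρ`, with a number `u` drawn uniformly from `[0, 1]`: an object is
cached if it fits together with all objects listed before it; the first object that does not fit is
cached if `u` is below the fraction of it for which there is room; no later object is cached. -/
def GreedyCached (s : Fin n → ℝ) (B : ℝ) (ρ : Equiv.Perm (Fin n)) (u : ℝ) (i : Fin n) : Prop :=
  let w := sizeBefore s ρ (ρ.symm i)
  w + s i ≤ B ∨ (w ≤ B ∧ B < w + s i ∧ u < (B - w) / s i)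

/-- The random numbers used by HR-VC: for each request one number that breaks ties and one
that decides about the first object that does not fit. -/
abbrev Seeds : Type := ℕ → unitInterval × unitInterval

section HRVC

variable [MeasurableSpace Ω] [NeZero n]

/-- The request model `P`, enlarged by independent uniform random numbers. -/
def withSeeds (P : Measure Ω) : Measure (Ω × Seeds) :=
  P.prod (Measure.infinitePi fun _ : ℕ => (volume : Measure (unitInterval × unitInterval)))

open Classical in
/-- `1` if under HR-VC the `(k+1)`-st request is a hit, `0` otherwise. -/
def hrvcHit (P : Measure Ω) [IsFiniteMeasure P] (T : Fin n → ℕ → Ω → ℝ) (s : Fin n → ℝ) (B : ℝ)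
    (ord : DecreasingOrder n) (k : ℕ) (z : Ω × Seeds) : ℝ :=
  let ratio : Fin n → ℝ := fun i => hazardRate P T i (epoch T k z.1) z.1 / s i
  if GreedyCached s B (ord.perm (z.2 k).1 ratio) (z.2 k).2 (requested T k z.1) then 1 else 0

/-- The number of hits of HR-VC among the first `K` requests. -/
def hrvcNumHits (P : Measure Ω) [IsFiniteMeasure P] (T : Fin n → ℕ → Ω → ℝ) (s : Fin n → ℝ) (B : ℝ)
    (ord : DecreasingOrder n) (K : ℕ) (z : Ω × Seeds) : ℝ :=
  ∑ k ∈ Finset.range K, hrvcHit P T s B ord k z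

end HRVC

/-! ### Stationary and ergodic request processes

Here the epochs are indexed by `ℤ`, and `T i 0 ≤ 0 < T i 1`. -/

/-- The configuration `x`, seen from time `t`: the points `x k - t`, renumbered so
that the point with index `0` is the last one in `(-∞, 0]`. -/
def timeShift (t : ℝ) (x : ℤ → ℝ) : ℤ → ℝ :=
  fun k => x (k + sSup {j : ℤ | x j ≤ t}) - t

/-- The requests made after time `0`. -/
def positivePart (T : Fin n → ℤ → Ω → ℝ) : Fin n → ℕ → Ω → ℝ :=
  fun i k => T i (k + 1)

/-- Mutually independent point processes, each of them stationary and ergodic with finite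
intensity, whose requests after time `0` form regular point processes. -/
structure IsStationaryErgodic [MeasurableSpace Ω] (P : Measure Ω) [IsFiniteMeasure P]
    (T : Fin n → ℤ → Ω → ℝ) : Prop where
  measurable : ∀ i k, Measurable (T i k)
  points : ∀ i, ∀ᵐ ω ∂P, T i 0 ω ≤ 0 ∧ 0 < T i 1 ω ∧ StrictMono (fun k => T i k ω) ∧
    Tendsto (fun k => T i k ω) atTop atTop ∧ Tendsto (fun k => T i k ω) atBot atBot
  indep : iIndepFun (fun i ω k => T i k ω) P
  stationary : ∀ i t,
    P.map (fun ω => timeShift t (fun k => T i k ω)) = P.map (fun ω k => T i k ω)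
  ergodic : ∀ i (A : Set (ℤ → ℝ)), MeasurableSet A →
    (∀ t, timeShift t ⁻¹' A =ᵐ[P.map (fun ω k => T i k ω)] A) →
    P {ω | (fun k => T i k ω) ∈ A} = 0 ∨ P {ω | (fun k => T i k ω) ∈ A} = 1
  finite_intensity : ∀ i, ∑' k : ℤ, P {ω | T i k ω ∈ Ioc (0 : ℝ) 1} ≠ ⊤
  regular : IsRegularRequests P (positivePart T)

end Caching

end

/-!
Hits are counted with the help of the compensators of the request processes. The current
inter-request time of an object has, given the past of that object, a density whose hazard rate is
the rate at which requests occur, so a sum of predictable weights over the requests of object `i`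
has the same expectation as the integral over time of the weights times the hazard rate of object
`i`. Conditional independence of the next requests makes this true also for weights that depend on
the past of all objects (`CondIndepRequests.lintegral_tsum_epoch`), and it excludes simultaneous
requests of different objects (`CondIndepRequests.ae_no_ties`).

The expected number of hits of a rule is therefore the expected time integral of the sum, over the
objects, of hazard rate times caching probability. At every instant this sum is the objective of
a fractional knapsack problem, which the greedy rule HR-VC solves
(`sum_mul_le_sum_mul_hrFrac`). Hence HR-VC maximizes the expected number of hits, with any
predictable weights, among all predictable rules that respect the capacity on average, and among
them the policies for indivisible objects (`CondIndepRequests.lintegral_policy_le_hrvc`). The weight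
"exactly `k` requests were made before" gives the comparison request by request. The hit
probability of a policy is the limit of its expected fraction of hits by dominated convergence.

In the stationary case, HR-VC is compared with the rule that follows it up to time `m` and then
restarts it without memory. As the requests after time `m` have the same joint law as those after
time `0`, the expected number of hits in `(0, m]` is superadditive in `m`
(`IsStationaryErgodic.hrvcHitsUpTo_superadditive`), and by Fekete's lemma it grows linearly. By the
mean ergodic theorem, the number of requests of each object in `(0, m]`, divided by `m`, converges
in `L¹` to the intensity (`tendsto_lintegral_pointCount`). So the first `K` requests can be replaced
by the requests up to time `K / Λ`, where `Λ` is the total intensity, at the cost of an error of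
smaller order than `K`, and the mean number of HR-VC hits per request converges
(`IsStationaryErgodic.exists_tendsto_hrvc`).
-/

noncomputable section

namespace Caching

section

/-! ### Measurability and integrals of hazard rates -/

/-- A pointwise measurable family of continuous functions is measurable for the Borel σ-algebra of
the compact-open topology: a condition on a compact set is one on a countable dense subset of it. -/
theorem measurable_continuousMap_of_eval {α : Type*} [MeasurableSpace α] {F : α → C(ℝ, ℝ)}
    (hF : ∀ x, Measurable fun p => F p x) : Measurable[_, borel C(ℝ, ℝ)] F := by
  rw [borel_eq_generateFrom_of_subbasis ContinuousMap.compactOpen_eq]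
  refine measurable_generateFrom ?_
  rintro _ ⟨K, hK, U, hU, rfl⟩
  obtain ⟨D, hDK, hDc, hD⟩ := hK.isSeparable.exists_countable_dense_subset
  have key : F ⁻¹' {f | MapsTo (⇑f) K U} =
      ⋃ m : ℕ, ⋂ x ∈ D, {p | F p x ∉ Metric.thickening (1 / ((m : ℝ) + 1)) Uᶜ} := by
    ext p
    simp only [mem_preimage, mem_ofPred_eq, mem_iUnion, mem_iInter]
    constructor
    · intro h
      have hdisj : Disjoint (F p '' K) Uᶜ :=
        disjoint_compl_right_iff_subset.2 h.image_subset
      obtain ⟨δ, hδ, hd⟩ := hdisj.exists_thickenings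
        (hK.image (F p).continuous) (IsOpen.isClosed_compl (by exact hU))
      obtain ⟨m, hm⟩ := exists_nat_one_div_lt hδ
      refine ⟨m, fun x hx hmem => ?_⟩
      exact hd.le_bot ⟨Metric.self_subset_thickening hδ _ (mem_image_of_mem _ (hDK hx)),
        Metric.thickening_mono hm.le _ hmem⟩
    · rintro ⟨m, hm⟩ x hx
      have hcl : IsClosed {y | F p y ∉ Metric.thickening (1 / ((m : ℝ) + 1)) Uᶜ} :=
        (Metric.isOpen_thickening.preimage (F p).continuous).isClosed_compl
      have hx' : x ∈ {y | F p y ∉ Metric.thickening (1 / ((m : ℝ) + 1)) Uᶜ} :=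
        closure_minimal (fun y hy => hm y hy) hcl (hD hx)
      by_contra hxU
      exact hx' (Metric.self_subset_thickening (by positivity) _ hxU)
  rw [key]
  refine MeasurableSet.iUnion fun m => MeasurableSet.biInter hDc fun x _ => ?_
  exact (hF x) (Metric.isOpen_thickening.measurableSet.compl)

/-- The distribution function of a probability measure without atoms, as a continuous map. -/
def cdfMap (μ : Measure ℝ) [IsProbabilityMeasure μ] [NullSingletonClass μ] : C(ℝ, ℝ) where
  toFun x := μ.real (Iio x)
  continuous_toFun := by
    have h : (fun x => μ.real (Iio x)) = fun x => cdf μ x := by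
      ext x
      rw [cdf_eq_real]
      exact measureReal_congr Iio_ae_eq_Iic
    rw [h, continuous_iff_continuousAt]
    intro x
    refine continuousAt_iff_continuous_left'_right'.2 ⟨?_, ?_⟩
    · have h1 : (cdf μ).measure {x} = 0 := by rw [measure_cdf]; simp
      rw [StieltjesFunction.measure_singleton, ENNReal.ofReal_eq_zero] at h1
      have h2 : Function.leftLim (cdf μ) x ≤ cdf μ x := (monotone_cdf μ).leftLim_le le_rfl
      have h3 : Function.leftLim (cdf μ) x = cdf μ x := by linarith
      exact ((monotone_cdf μ).continuousWithinAt_Iio_iff_leftLim_eq).2 h3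
    · exact ((cdf μ).right_continuous x).mono Ioi_subset_Ici_self

/-- By Lebesgue differentiation, the derivative of the distribution function of an absolutely
continuous law is a density of the law. -/
theorem lintegral_deriv_cdf {μ : Measure ℝ} [IsProbabilityMeasure μ] (hμ : μ ≪ volume)
    (S : Set ℝ) :
    ∫⁻ x in S, ENNReal.ofReal (deriv (fun r => μ.real (Iio r)) x) = μ S := by
  have : NullSingletonClass μ := ⟨fun x => hμ (measure_singleton x)⟩
  have h : (fun x => μ.real (Iio x)) = fun x => cdf μ x := by
    ext x
    rw [cdf_eq_real]
    exact measureReal_congr Iio_ae_eq_Iic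
  rw [h]
  have hd : ∀ᵐ x : ℝ, ENNReal.ofReal (deriv (fun x => cdf μ x) x) = μ.rnDeriv volume x := by
    filter_upwards [(cdf μ).ae_hasDerivAt, μ.rnDeriv_lt_top volume] with x hx hx'
    rw [hx.deriv, measure_cdf, ENNReal.ofReal_toReal hx'.ne]
  rw [lintegral_congr_ae (ae_restrict_of_ae hd), Measure.setLIntegral_rnDeriv hμ]

theorem deriv_cdf_nonneg {μ : Measure ℝ} [IsProbabilityMeasure μ] (x : ℝ) :
    0 ≤ deriv (fun r => μ.real (Iio r)) x :=
  Monotone.deriv_nonneg fun _ _ hab => measureReal_mono (Iio_subset_Iio hab)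

theorem deriv_cdf_eq_zero {μ : Measure ℝ} [IsProbabilityMeasure μ] {x : ℝ} (hx : μ (Ici x) = 0) :
    deriv (fun r => μ.real (Iio r)) x = 0 := by
  refine IsLocalMax.deriv_eq_zero (Eventually.of_forall fun y => ?_)
  have h1 : μ.real (Iio x) = 1 := by
    have h := measureReal_add_measureReal_compl (μ := μ) (measurableSet_Iio (a := x))
    rw [compl_Iio, measureReal_def (s := Ici x), hx] at h
    simpa using h
  simp only
  rw [h1]
  exact measureReal_le_one

/-- The hazard rate of a law on `ℝ` that is shifted by `a`. -/
def lawHazard (μ : Measure ℝ) (a r : ℝ) : ℝ :=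
  deriv (fun r => μ.real (Iio (r - a))) r / μ.real (Ioi (r - a))

/-- The defining property of the hazard rate: hazard rate times survival function is the density. -/
theorem lintegral_lawHazard_mul {μ : Measure ℝ} [IsProbabilityMeasure μ] (hμ : μ ≪ volume)
    (a t : ℝ) :
    ∫⁻ r in Ici t, ENNReal.ofReal (lawHazard μ a r) * μ (Ici (r - a)) = μ (Ici (t - a)) := by
  have : NullSingletonClass μ := ⟨fun x => hμ (measure_singleton x)⟩
  have h1 : ∀ r, ENNReal.ofReal (lawHazard μ a r) * μ (Ici (r - a)) =
      ENNReal.ofReal (deriv (fun r => μ.real (Iio r)) (r - a)) := by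
    intro r
    unfold lawHazard
    rw [deriv_comp_sub_const (f := fun r => μ.real (Iio r)),
      measureReal_congr (Ioi_ae_eq_Ici (μ := μ) (a := r - a))]
    rcases eq_or_ne (μ (Ici (r - a))) 0 with h0 | h0
    · rw [h0, deriv_cdf_eq_zero h0]; simp
    · have hpos : 0 < μ.real (Ici (r - a)) := ENNReal.toReal_pos h0 (measure_ne_top _ _)
      rw [ENNReal.ofReal_div_of_pos hpos, ofReal_measureReal,
        ENNReal.div_mul_cancel h0 (measure_ne_top _ _)]
  simp_rw [h1]
  have h2 := (measurePreserving_sub_right volume a).setLIntegral_comp_preimage_emb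
    (measurableEmbedding_subRight a)
    (fun x => ENNReal.ofReal (deriv (fun r => μ.real (Iio r)) x)) (Ici (t - a))
  have h3 : (fun x => x - a) ⁻¹' (Ici (t - a)) = Ici t := by ext; simp
  rw [h3] at h2
  rw [h2, lintegral_deriv_cdf hμ]

/-- A jointly measurable version of the hazard rates of the laws of a kernel. Differentiation is
made measurable in the parameter by viewing distribution functions as points of `C(ℝ, ℝ)`. -/
theorem exists_measurable_lawHazard {α : Type*} [MeasurableSpace α] (κ : Kernel α ℝ)
    [IsMarkovKernel κ] (ν : Measure α) (hκ : ∀ᵐ p ∂ν, κ p ≪ volume) (a : α → ℝ)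
    (ha : Measurable a) :
    ∃ (G : Set α) (h : α × ℝ → ℝ), MeasurableSet G ∧ (∀ᵐ p ∂ν, p ∈ G) ∧ (∀ p ∈ G, κ p ≪ volume) ∧
      Measurable h ∧ (∀ x, 0 ≤ h x) ∧ ∀ p ∈ G, ∀ r, h (p, r) = lawHazard (κ p) (a p) r := by
  classical
  set G : Set α := (toMeasurable ν {p | ¬ κ p ≪ volume})ᶜ with hG
  have hGm : MeasurableSet G := (measurableSet_toMeasurable _ _).compl
  have hGae : ∀ᵐ p ∂ν, p ∈ G := by
    rw [ae_iff]
    simp only [hG, mem_compl_iff, not_not]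
    change ν (toMeasurable ν _) = 0
    rw [measure_toMeasurable]
    exact ae_iff.1 hκ
  have hGac : ∀ p ∈ G, κ p ≪ volume := fun p hp => by
    by_contra hc
    exact hp (subset_toMeasurable _ _ hc)
  have hGna : ∀ p ∈ G, NullSingletonClass (κ p) := fun p hp =>
    ⟨fun x => hGac p hp (measure_singleton x)⟩
  let F : α → C(ℝ, ℝ) := fun p =>
    if hp : p ∈ G then (haveI := hGna p hp; cdfMap (κ p)) else 0
  have hF : ∀ x, Measurable fun p => F p x := by
    intro x
    have : (fun p => F p x) = G.indicator fun p => (κ p).real (Iio x) := by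
      ext p
      by_cases hp : p ∈ G
      · simp [F, hp, cdfMap]
      · simp [F, hp]
    rw [this]
    exact ((κ.measurable_coe measurableSet_Iio).ennreal_toReal).indicator hGm
  borelize C(ℝ, ℝ)
  have hFm : Measurable F := measurable_continuousMap_of_eval hF
  have hD : Measurable fun q : C(ℝ, ℝ) × ℝ => deriv (fun x => q.1 x) q.2 :=
    measurable_deriv_with_param (f := fun (g : C(ℝ, ℝ)) x => g x) (by fun_prop)
  have hsurv : Measurable fun q : α × ℝ => (κ q.1).real (Ioi (q.2 - a q.1)) := by
    refine Measurable.ennreal_toReal ?_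
    have h := Kernel.measurable_kernel_prodMk_left (κ := κ.comap (Prod.fst : α × ℝ → α)
      measurable_fst) (t := {x : (α × ℝ) × ℝ | x.1.2 - a x.1.1 < x.2})
      (measurableSet_lt (by fun_prop) (by fun_prop))
    exact h
  refine ⟨G, fun q => G.indicator (fun _ => (1 : ℝ)) q.1 *
    (deriv (fun x => F q.1 x) (q.2 - a q.1) / (κ q.1).real (Ioi (q.2 - a q.1))), hGm, hGae, hGac,
    ?_, ?_, ?_⟩
  · refine Measurable.mul ?_ (Measurable.div ?_ hsurv)
    · exact (measurable_const.indicator hGm).comp measurable_fst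
    · exact hD.comp ((hFm.comp measurable_fst).prodMk (by fun_prop))
  · rintro ⟨p, r⟩
    by_cases hp : p ∈ G
    · simp only [hp, indicator_of_mem, one_mul, F, dif_pos]
      exact div_nonneg (deriv_cdf_nonneg _) measureReal_nonneg
    · simp [hp]
  · intro p hp r
    simp only [hp, indicator_of_mem, one_mul, F, dif_pos, lawHazard]
    rw [deriv_comp_sub_const (f := fun r => (κ p).real (Iio r))]
    rfl

theorem measurable_kernel_Ici {α : Type*} [MeasurableSpace α] (κ : Kernel α ℝ)
    [IsSFiniteKernel κ] {f : α → ℝ} (hf : Measurable f) : Measurable fun p => κ p (Ici (f p)) :=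
  Kernel.measurable_kernel_prodMk_left (κ := κ) (t := {x : α × ℝ | f x.1 ≤ x.2})
    (measurableSet_le (by fun_prop) (by fun_prop))

end

section

variable {Ω : Type*} {n : ℕ}

/-! ### The compensator of the next request, seen from a fixed time -/

/-- A sequence of epochs as in a regular point process: positive, strictly increasing, and locally
finite. -/
def GoodSeq (τ : ℕ → ℝ) : Prop :=
  0 < τ 0 ∧ StrictMono τ ∧ Tendsto τ atTop atTop

theorem GoodSeq.pos {τ : ℕ → ℝ} (h : GoodSeq τ) (k : ℕ) : 0 < τ k :=
  h.1.trans_le (h.2.1.monotone (Nat.zero_le k))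

theorem prevEpoch_lt {T : Fin n → ℕ → Ω → ℝ} {i : Fin n} {ω : Ω}
    (h : GoodSeq fun k => T i k ω) (c : ℕ) : prevEpoch T i c ω < T i c ω := by
  cases c with
  | zero => exact h.1
  | succ c => exact h.2.1 (Nat.lt_succ_self c)

theorem lt_of_lt_reqCount {T : Fin n → ℕ → Ω → ℝ} {i : Fin n} {ω : Ω} {t : ℝ} {k : ℕ}
    (hk : k < reqCount T i t ω) : T i k ω < t :=
  not_le.1 (Nat.notMem_of_lt_sInf hk)

theorem le_reqCount_epoch {T : Fin n → ℕ → Ω → ℝ} {i : Fin n} {ω : Ω}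
    (h : GoodSeq fun k => T i k ω) (t : ℝ) : t ≤ T i (reqCount T i t ω) ω :=
  Nat.sInf_mem (s := {k | t ≤ T i k ω}) (h.2.2.eventually_ge_atTop t).exists

theorem lt_reqCount_iff {T : Fin n → ℕ → Ω → ℝ} {i : Fin n} {ω : Ω}
    (h : GoodSeq fun k => T i k ω) {t : ℝ} {k : ℕ} : k < reqCount T i t ω ↔ T i k ω < t := by
  refine ⟨lt_of_lt_reqCount, fun hk => ?_⟩
  by_contra hc
  exact absurd (le_reqCount_epoch h t) (not_le.2 ((h.2.1.monotone (not_lt.1 hc)).trans_lt hk))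

theorem reqCount_eq_iff {T : Fin n → ℕ → Ω → ℝ} {i : Fin n} {ω : Ω}
    (h : GoodSeq fun k => T i k ω) {t : ℝ} (ht : 0 < t) {c : ℕ} :
    reqCount T i t ω = c ↔ prevEpoch T i c ω < t ∧ t ≤ T i c ω := by
  have h1 : reqCount T i t ω ≤ c ↔ t ≤ T i c ω := by
    rw [← not_lt, lt_reqCount_iff h, not_lt]
  have h2 : c ≤ reqCount T i t ω ↔ prevEpoch T i c ω < t := by
    cases c with
    | zero => simpa [prevEpoch] using ht
    | succ c => exact lt_reqCount_iff h
  rw [← h1, ← h2]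
  omega

/-- The last entry of a finite sequence of epochs, or `0` if there is none. -/
def lastEpoch : (c : ℕ) → (Fin c → ℝ) → ℝ
  | 0, _ => 0
  | c + 1, p => p (Fin.last c)

theorem measurable_lastEpoch (c : ℕ) : Measurable (lastEpoch c) := by
  cases c with
  | zero => exact measurable_const
  | succ c => exact measurable_pi_apply _

theorem lastEpoch_pastEpochs (T : Fin n → ℕ → Ω → ℝ) (i : Fin n) (c : ℕ) (ω : Ω) :
    lastEpoch c (pastEpochs T i c ω) = prevEpoch T i c ω := by
  cases c <;> rfl

/-- The event that the request with index `c` is the first one for object `i` that is not before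
time `t`. -/
def pending (T : Fin n → ℕ → Ω → ℝ) (i : Fin n) (c : ℕ) (t : ℝ) : Set Ω :=
  {ω | prevEpoch T i c ω < t ∧ t ≤ T i c ω}

theorem measurable_min_objHistory (T : Fin n → ℕ → Ω → ℝ) (i : Fin n) (t : ℝ) (k : ℕ) :
    Measurable[objHistory T i t] fun ω => min (T i k ω) t :=
  Measurable.of_comap_le (le_iSup (fun k => MeasurableSpace.comap (fun ω => min (T i k ω) t)
    inferInstance) k)

theorem measurableSet_lt_objHistory (T : Fin n → ℕ → Ω → ℝ) (i : Fin n) {r t : ℝ} (hr : r ≤ t)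
    (k : ℕ) : MeasurableSet[objHistory T i t] {ω | T i k ω < r} := by
  have h : {ω | T i k ω < r} = (fun ω => min (T i k ω) t) ⁻¹' Iio r := by
    ext ω
    simp [hr.not_gt]
  rw [h]
  exact measurable_min_objHistory T i t k measurableSet_Iio

theorem measurableSet_le_objHistory (T : Fin n → ℕ → Ω → ℝ) (i : Fin n) {r t : ℝ} (hr : r ≤ t)
    (k : ℕ) : MeasurableSet[objHistory T i t] {ω | r ≤ T i k ω} := by
  have h := (measurableSet_lt_objHistory T i hr k).compl
  have h2 : {ω | T i k ω < r}ᶜ = {ω | r ≤ T i k ω} := by ext; simp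
  rwa [h2] at h

theorem measurableSet_prevEpoch_lt (T : Fin n → ℕ → Ω → ℝ) (i : Fin n) (c : ℕ) {r t : ℝ}
    (hr : r ≤ t) : MeasurableSet[objHistory T i t] {ω | prevEpoch T i c ω < r} := by
  cases c with
  | zero => exact @MeasurableSet.const _ (objHistory T i t) (0 < r)
  | succ c => exact measurableSet_lt_objHistory T i hr c

theorem measurableSet_pending (T : Fin n → ℕ → Ω → ℝ) (i : Fin n) (c : ℕ) (t : ℝ) :
    MeasurableSet[objHistory T i t] (pending T i c t) :=
  (measurableSet_prevEpoch_lt T i c le_rfl).inter (measurableSet_le_objHistory T i le_rfl c)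

theorem objHistory_eq_comap (T : Fin n → ℕ → Ω → ℝ) (i : Fin n) (t : ℝ) :
    objHistory T i t = MeasurableSpace.comap (fun ω k => min (T i k ω) t) inferInstance := by
  rw [objHistory]
  change _ = MeasurableSpace.comap _ MeasurableSpace.pi
  rw [MeasurableSpace.pi, MeasurableSpace.comap_iSup]
  simp only [MeasurableSpace.comap_comp]
  rfl

/-- The first `c` epochs of object `i`, truncated at time `t`. -/
def truncPast (T : Fin n → ℕ → Ω → ℝ) (i : Fin n) (c : ℕ) (t : ℝ) (ω : Ω) : Fin c → ℝ :=
  fun j => min (T i j ω) t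

theorem measurable_truncPast (T : Fin n → ℕ → Ω → ℝ) (i : Fin n) (c : ℕ) (t : ℝ) :
    Measurable[objHistory T i t] (truncPast T i c t) :=
  @measurable_pi_lambda _ _ _ (objHistory T i t) _ _ fun j => measurable_min_objHistory T i t j

theorem lt_of_prevEpoch_lt {i : Fin n} {c : ℕ} {t : ℝ} {ω : Ω} (h : GoodSeq fun k => T i k ω)
    (hω : prevEpoch T i c ω < t) {j : ℕ} (hj : j < c) : T i j ω < t := by
  cases c with
  | zero => omega
  | succ c => exact (h.2.1.monotone (Nat.lt_succ_iff.1 hj)).trans_lt hω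

/-- Past epochs lie before `t` when the last of them does, so the truncation at `t` keeps them. -/
theorem truncPast_eq {i : Fin n} {c : ℕ} {t : ℝ} {ω : Ω} (h : GoodSeq fun k => T i k ω)
    (hω : prevEpoch T i c ω < t) : truncPast T i c t ω = pastEpochs T i c ω := by
  ext j
  exact min_eq_left (lt_of_prevEpoch_lt h hω j.2).le

variable [MeasurableSpace Ω] {P : Measure Ω} [IsProbabilityMeasure P] {T : Fin n → ℕ → Ω → ℝ}

theorem IsRegularRequests.ae_good (hreg : IsRegularRequests P T) :
    ∀ᵐ ω ∂P, ∀ i, GoodSeq fun k => T i k ω :=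
  ae_all_iff.2 hreg.points

theorem IsRegularRequests.measurable_pastEpochs (hreg : IsRegularRequests P T) (i : Fin n)
    (c : ℕ) : Measurable (pastEpochs T i c) :=
  measurable_pi_lambda _ fun j => hreg.measurable i j

theorem IsRegularRequests.measurable_prevEpoch (hreg : IsRegularRequests P T) (i : Fin n)
    (c : ℕ) : Measurable (prevEpoch T i c) := by
  cases c with
  | zero => exact measurable_const
  | succ c => exact hreg.measurable i c

theorem IsRegularRequests.measurable_interRequest (hreg : IsRegularRequests P T) (i : Fin n)
    (c : ℕ) : Measurable (interRequest T i c) :=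
  (hreg.measurable i c).sub (hreg.measurable_prevEpoch i c)

theorem IsRegularRequests.exists_hazard (hreg : IsRegularRequests P T) (i : Fin n) (c : ℕ) :
    ∃ (G : Set (Fin c → ℝ)) (h : (Fin c → ℝ) × ℝ → ℝ), MeasurableSet G ∧
      (∀ᵐ p ∂(P.map (pastEpochs T i c)), p ∈ G) ∧ (∀ p ∈ G, condLaw P T i c p ≪ volume) ∧
      Measurable h ∧ (∀ x, 0 ≤ h x) ∧
      ∀ p ∈ G, ∀ r, h (p, r) = lawHazard (condLaw P T i c p) (lastEpoch c p) r :=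
  haveI : IsMarkovKernel (condLaw P T i c) := by unfold condLaw; infer_instance
  exists_measurable_lawHazard (condLaw P T i c) _ (hreg.density i c) _ (measurable_lastEpoch c)

/-- Histories `p` of length `c` after which the next inter-request time has a density. -/
def IsRegularRequests.goodPast (hreg : IsRegularRequests P T) (i : Fin n) (c : ℕ) :
    Set (Fin c → ℝ) :=
  (hreg.exists_hazard i c).choose

/-- A jointly measurable version of the hazard rate at a time, as a function of the past epochs. -/
def IsRegularRequests.hazardFn (hreg : IsRegularRequests P T) (i : Fin n) (c : ℕ) :
    (Fin c → ℝ) × ℝ → ℝ :=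
  (hreg.exists_hazard i c).choose_spec.choose

section HazardFn

variable (hreg : IsRegularRequests P T) (i : Fin n) (c : ℕ)

theorem IsRegularRequests.ae_goodPast : ∀ᵐ ω ∂P, pastEpochs T i c ω ∈ hreg.goodPast i c :=
  ae_of_ae_map (hreg.measurable_pastEpochs i c).aemeasurable
    (hreg.exists_hazard i c).choose_spec.choose_spec.2.1

theorem IsRegularRequests.ac_of_goodPast {p : Fin c → ℝ} (hp : p ∈ hreg.goodPast i c) :
    condLaw P T i c p ≪ volume :=
  (hreg.exists_hazard i c).choose_spec.choose_spec.2.2.1 p hp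

theorem IsRegularRequests.measurable_hazardFn : Measurable (hreg.hazardFn i c) :=
  (hreg.exists_hazard i c).choose_spec.choose_spec.2.2.2.1

theorem IsRegularRequests.hazardFn_nonneg (x : (Fin c → ℝ) × ℝ) : 0 ≤ hreg.hazardFn i c x :=
  (hreg.exists_hazard i c).choose_spec.choose_spec.2.2.2.2.1 x

theorem IsRegularRequests.hazardFn_eq {p : Fin c → ℝ} (hp : p ∈ hreg.goodPast i c) (r : ℝ) :
    hreg.hazardFn i c (p, r) = lawHazard (condLaw P T i c p) (lastEpoch c p) r :=
  (hreg.exists_hazard i c).choose_spec.choose_spec.2.2.2.2.2 p hp r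

end HazardFn

instance (i : Fin n) (c : ℕ) : IsMarkovKernel (condLaw P T i c) := by
  unfold condLaw; infer_instance

theorem IsRegularRequests.objHistory_le (hreg : IsRegularRequests P T) (i : Fin n) (t : ℝ) :
    objHistory T i t ≤ ‹MeasurableSpace Ω› :=
  iSup_le fun k => ((hreg.measurable i k).min measurable_const).comap_le

/-- The conditional law of an epoch given the past epochs, on survival sets. -/
theorem IsRegularRequests.setLIntegral_le_epoch (hreg : IsRegularRequests P T) (i : Fin n) (c : ℕ)
    (r : ℝ) {F : (Fin c → ℝ) → ENNReal} (hF : Measurable F) :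
    ∫⁻ ω in {ω | r ≤ T i c ω}, F (pastEpochs T i c ω) ∂P =
      ∫⁻ ω, F (pastEpochs T i c ω) *
        condLaw P T i c (pastEpochs T i c ω) (Ici (r - prevEpoch T i c ω)) ∂P := by
  have hp := hreg.measurable_pastEpochs i c
  have hx := hreg.measurable_interRequest i c
  have ha := measurable_lastEpoch c
  have hS : MeasurableSet {q : (Fin c → ℝ) × ℝ | r - lastEpoch c q.1 ≤ q.2} :=
    measurableSet_le (by fun_prop) (by fun_prop)
  have hFm : Measurable
      ({q : (Fin c → ℝ) × ℝ | r - lastEpoch c q.1 ≤ q.2}.indicator fun q => F q.1) :=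
    (hF.comp measurable_fst).indicator hS
  have h1 := compProd_map_condDistrib (μ := P) (mβ := inferInstance) (X := pastEpochs T i c)
    (Y := interRequest T i c)
    hx.aemeasurable
  have h2 := congrArg (fun m => ∫⁻ q, ({q : (Fin c → ℝ) × ℝ |
    r - lastEpoch c q.1 ≤ q.2}.indicator fun q => F q.1) q ∂m) h1
  rw [Measure.lintegral_compProd hFm, lintegral_map hFm (hp.prodMk hx),
    lintegral_map hFm.lintegral_kernel_prod_right' hp] at h2
  rw [← lintegral_indicator (measurableSet_le measurable_const (hreg.measurable i c))]
  convert h2.symm using 1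
  · refine lintegral_congr fun ω => ?_
    simp only [indicator, mem_ofPred_eq, lastEpoch_pastEpochs, interRequest]
    congr 1
    simp
  · refine lintegral_congr fun ω => ?_
    rw [← lastEpoch_pastEpochs]
    have : (fun x : ℝ => ({q : (Fin c → ℝ) × ℝ | r - lastEpoch c q.1 ≤ q.2}.indicator
        fun q => F q.1) (pastEpochs T i c ω, x)) =
        (Ici (r - lastEpoch c (pastEpochs T i c ω))).indicator
          fun _ => F (pastEpochs T i c ω) := by
      ext x; simp [indicator]
    rw [this, lintegral_indicator_const measurableSet_Ici]
    rfl

/-- The conditional probability that the epoch with index `c` is at least `r`, given that it is at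
least `t` and given the past epochs `p`. -/
def survival (P : Measure Ω) [IsProbabilityMeasure P] (T : Fin n → ℕ → Ω → ℝ) (i : Fin n) (c : ℕ)
    (t r : ℝ) (p : Fin c → ℝ) : ENNReal :=
  condLaw P T i c p (Ici (r - lastEpoch c p)) / condLaw P T i c p (Ici (t - lastEpoch c p))

theorem measurable_survival (i : Fin n) (c : ℕ) (t : ℝ) :
    Measurable fun x : ℝ × (Fin c → ℝ) => survival P T i c t x.1 x.2 := by
  have ha := measurable_lastEpoch c
  unfold survival
  refine Measurable.div ?_ ?_
  · exact measurable_kernel_Ici ((condLaw P T i c).comap _ measurable_snd) (by fun_prop)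
  · exact (measurable_kernel_Ici (condLaw P T i c) (f := fun p => t - lastEpoch c p)
      (by fun_prop)).comp measurable_snd

theorem survival_le_one (i : Fin n) (c : ℕ) {t r : ℝ} (hr : t ≤ r) (p : Fin c → ℝ) :
    survival P T i c t r p ≤ 1 :=
  ENNReal.div_le_of_le_mul (by
    rw [one_mul]; exact measure_mono (Ici_subset_Ici.2 (by linarith)))

/-- The conditional survival function of a pending request, given the history of the object. -/
theorem IsRegularRequests.measure_inter_pending (hreg : IsRegularRequests P T) (i : Fin n) (c : ℕ)
    {t r : ℝ} (hr : t ≤ r) {B : Set Ω}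
    (hB : MeasurableSet[objHistory T i t] B) :
    P (B ∩ pending T i c t ∩ {ω | r ≤ T i c ω}) =
      ∫⁻ ω in B ∩ pending T i c t, survival P T i c t r (truncPast T i c t ω) ∂P := by
  rw [objHistory_eq_comap] at hB
  obtain ⟨S, hS, rfl⟩ := hB
  have hp := hreg.measurable_pastEpochs i c
  have ha := measurable_lastEpoch c
  let φ : (Fin c → ℝ) → ℕ → ℝ := fun p k => if hk : k < c then p ⟨k, hk⟩ else t
  have hφ : Measurable φ := by
    refine measurable_pi_lambda _ fun k => ?_
    by_cases hk : k < c
    · simpa [φ, hk] using measurable_pi_apply _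
    · simp [φ, hk]
  let S' : Set (Fin c → ℝ) := {p | φ p ∈ S ∧ lastEpoch c p < t}
  have hS' : MeasurableSet S' := (hφ hS).inter (measurableSet_lt ha measurable_const)
  have hset : ((fun ω k => min (T i k ω) t) ⁻¹' S ∩ pending T i c t : Set Ω) =ᵐ[P]
      (pastEpochs T i c ⁻¹' S' ∩ {ω | t ≤ T i c ω} : Set Ω) := by
    filter_upwards [hreg.ae_good] with ω hω
    have key : ω ∈ pending T i c t → φ (pastEpochs T i c ω) = fun k => min (T i k ω) t := by
      rintro ⟨h1, h2⟩
      ext k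
      by_cases hk : k < c
      · simp only [φ, hk, dif_pos, pastEpochs]
        exact (min_eq_left (lt_of_prevEpoch_lt (hω i) h1 hk).le).symm
      · simp only [φ, hk, dif_neg, not_false_eq_true]
        exact (min_eq_right (h2.trans ((hω i).2.1.monotone (not_lt.1 hk)))).symm
    apply propext
    constructor
    · rintro ⟨h1, h2⟩
      refine ⟨⟨?_, ?_⟩, h2.2⟩
      · rw [key h2]; exact h1
      · rw [lastEpoch_pastEpochs]; exact h2.1
    · rintro ⟨⟨h1, h2⟩, h3⟩
      rw [lastEpoch_pastEpochs] at h2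
      refine ⟨?_, h2, h3⟩
      have := key ⟨h2, h3⟩
      rw [this] at h1
      exact h1
  have hle : ∀ r, MeasurableSet {ω | r ≤ T i c ω} := fun r =>
    measurableSet_le measurable_const (hreg.measurable i c)
  have hsv : Measurable (survival P T i c t r) := (measurable_survival i c t).comp
    (measurable_const.prodMk measurable_id : Measurable fun p : Fin c → ℝ => (r, p))
  have e1 : P ((fun ω k => min (T i k ω) t) ⁻¹' S ∩ pending T i c t ∩ {ω | r ≤ T i c ω}) =
      ∫⁻ ω in {ω | r ≤ T i c ω}, S'.indicator 1 (pastEpochs T i c ω) ∂P := by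
    have : (fun ω => S'.indicator (1 : (Fin c → ℝ) → ENNReal) (pastEpochs T i c ω)) =
        (pastEpochs T i c ⁻¹' S').indicator 1 := rfl
    rw [this, lintegral_indicator_one (hp hS'), Measure.restrict_apply (hp hS')]
    refine measure_congr ?_
    filter_upwards [hset] with ω hω
    have hω' : (ω ∈ (fun ω k => min (T i k ω) t) ⁻¹' S ∩ pending T i c t) ↔
      (ω ∈ pastEpochs T i c ⁻¹' S' ∩ {ω | t ≤ T i c ω}) := Eq.to_iff hω
    apply propext
    change (ω ∈ _ ∩ _ ∧ r ≤ T i c ω) ↔ (ω ∈ pastEpochs T i c ⁻¹' S' ∧ r ≤ T i c ω)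
    rw [hω']
    exact ⟨fun h => ⟨h.1.1, h.2⟩, fun h => ⟨⟨h.1, hr.trans h.2⟩, h.2⟩⟩
  have e2 : ∫⁻ ω in (fun ω k => min (T i k ω) t) ⁻¹' S ∩ pending T i c t,
        survival P T i c t r (truncPast T i c t ω) ∂P =
      ∫⁻ ω in {ω | t ≤ T i c ω},
        S'.indicator (survival P T i c t r) (pastEpochs T i c ω) ∂P := by
    have : (fun ω => S'.indicator (survival P T i c t r) (pastEpochs T i c ω)) =
        (pastEpochs T i c ⁻¹' S').indicator
          fun ω => survival P T i c t r (pastEpochs T i c ω) := rfl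
    rw [this, lintegral_indicator (hp hS'), Measure.restrict_restrict (hp hS'),
      Measure.restrict_congr_set hset]
    refine setLIntegral_congr_fun_ae ((hp hS').inter (hle t)) ?_
    filter_upwards [hreg.ae_good] with ω hω hmem
    have := hmem.1.2
    rw [lastEpoch_pastEpochs] at this
    rw [truncPast_eq (hω i) this]
  rw [e1, e2, hreg.setLIntegral_le_epoch i c r (measurable_one.indicator hS'),
    hreg.setLIntegral_le_epoch i c t (hsv.indicator hS')]
  refine lintegral_congr fun ω => ?_
  by_cases hω : pastEpochs T i c ω ∈ S'
  · simp only [hω, indicator_of_mem, Pi.one_apply, one_mul, survival, lastEpoch_pastEpochs]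
    rcases eq_or_ne (condLaw P T i c (pastEpochs T i c ω) (Ici (t - prevEpoch T i c ω))) 0
      with h0 | h0
    · rw [h0, mul_zero]
      exact measure_mono_null (Ici_subset_Ici.2 (by linarith)) h0
    · rw [ENNReal.div_mul_cancel h0 (measure_ne_top _ _)]
  · simp [hω]

end

section

variable {Ω : Type*} {n : ℕ}

/-- The infimum of the empty set is `0`, so the event that the infimum is `0` also contains the
points that lie in none of the sets. -/
theorem measurable_sInf_nat {α : Type*} [MeasurableSpace α] {S : ℕ → Set α}
    (hS : ∀ k, MeasurableSet (S k)) : Measurable fun x => sInf {k | x ∈ S k} := by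
  refine measurable_to_countable' fun m => ?_
  have h : (fun x => sInf {k | x ∈ S k}) ⁻¹' {m} =
      {x | (x ∈ S m ∧ ∀ j < m, x ∉ S j) ∨ (m = 0 ∧ ∀ j, x ∉ S j)} := by
    ext x
    simp only [mem_preimage, mem_singleton_iff, mem_ofPred_eq]
    constructor
    · intro hx
      rcases Set.eq_empty_or_nonempty {k | x ∈ S k} with he | hne
      · right
        rw [he, Nat.sInf_empty] at hx
        exact ⟨hx.symm, fun j hj => by
          have : j ∈ {k | x ∈ S k} := hj
          rw [he] at this; exact this⟩
      · left
        have h1 := Nat.sInf_mem hne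
        rw [hx] at h1
        exact ⟨h1, fun j hj => Nat.notMem_of_lt_sInf (s := {k | x ∈ S k}) (by rw [hx]; exact hj)⟩
    · rintro (⟨h1, h2⟩ | ⟨rfl, h2⟩)
      · refine le_antisymm (Nat.sInf_le h1) ?_
        by_contra hlt
        exact h2 _ (not_le.1 hlt) (Nat.sInf_mem (s := {k | x ∈ S k}) ⟨m, h1⟩)
      · have : {k | x ∈ S k} = ∅ := by ext j; simpa using h2 j
        rw [this, Nat.sInf_empty]
  rw [h]
  have hlt : MeasurableSet {x | ∀ j < m, x ∉ S j} := by
    have : {x | ∀ j < m, x ∉ S j} = ⋂ j, ⋂ (_ : j < m), (S j)ᶜ := by ext; simp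
    rw [this]
    exact MeasurableSet.iInter fun j => MeasurableSet.iInter fun _ => (hS j).compl
  have hall : MeasurableSet {x | ∀ j, x ∉ S j} := by
    have : {x | ∀ j, x ∉ S j} = ⋂ j, (S j)ᶜ := by ext; simp
    rw [this]
    exact MeasurableSet.iInter fun j => (hS j).compl
  exact ((hS m).inter hlt).union ((MeasurableSet.const _).inter hall)

theorem measurable_apply_nat {α β : Type*} [MeasurableSpace α] [MeasurableSpace β] {F : ℕ → α → β}
    (hF : ∀ k, Measurable (F k)) {m : α → ℕ} (hm : Measurable m) :
    Measurable fun x => F (m x) x :=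
  (measurable_from_prod_countable_right (f := fun q : ℕ × α => F q.1 q.2) hF).comp
    (hm.prodMk measurable_id)

theorem nextRequest_of_pending {T : Fin n → ℕ → Ω → ℝ} {i : Fin n} {c : ℕ} {t : ℝ}
    (ht : 0 < t) {ω : Ω}
    (h : GoodSeq fun k => T i k ω) (hω : ω ∈ pending T i c t) :
    nextRequest T i t ω = T i c ω := by
  rw [nextRequest, (reqCount_eq_iff h ht).2 hω]

variable [MeasurableSpace Ω] {P : Measure Ω} [IsProbabilityMeasure P] {T : Fin n → ℕ → Ω → ℝ}

theorem IsRegularRequests.measurable_nextRequest (hreg : IsRegularRequests P T) (i : Fin n)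
    (t : ℝ) : Measurable (nextRequest T i t) :=
  measurable_apply_nat (hreg.measurable i)
    (measurable_sInf_nat fun k => measurableSet_le measurable_const (hreg.measurable i k))

theorem IsRegularRequests.measurableSet_le_next (hreg : IsRegularRequests P T) (i : Fin n)
    (t r : ℝ) : MeasurableSet {ω | r ≤ nextRequest T i t ω} :=
  measurableSet_le measurable_const (hreg.measurable_nextRequest i t)

theorem IsRegularRequests.measurableSet_le_epoch (hreg : IsRegularRequests P T) (i : Fin n)
    (c : ℕ) (r : ℝ) : MeasurableSet {ω | r ≤ T i c ω} :=
  measurableSet_le measurable_const (hreg.measurable i c)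

/-- On the event that epoch `c` is pending, the conditional law of the next request is the
conditional law of that epoch, restricted to survival beyond `t`. -/
theorem IsRegularRequests.condProb_next (hreg : IsRegularRequests P T) (i : Fin n) (c : ℕ)
    {t r : ℝ} (ht : 0 < t) (hr : t ≤ r) :
    ∀ᵐ ω ∂P, ω ∈ pending T i c t → (P⟦{ω' | r ≤ nextRequest T i t ω'} | objHistory T i t⟧) ω =
      (survival P T i c t r (truncPast T i c t ω)).toReal := by
  have hm := hreg.objHistory_le i t
  have hpend := measurableSet_pending T i c t
  have hsv : Measurable[objHistory T i t] fun ω => survival P T i c t r (truncPast T i c t ω) :=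
    ((measurable_survival i c t).comp (measurable_const.prodMk measurable_id :
      Measurable fun p : Fin c → ℝ => (r, p))).comp (measurable_truncPast T i c t)
  have hg : Measurable[objHistory T i t] ((pending T i c t).indicator
      fun ω => (survival P T i c t r (truncPast T i c t ω)).toReal) :=
    Measurable.indicator hsv.ennreal_toReal hpend
  have hbd : ∀ ω, survival P T i c t r (truncPast T i c t ω) ≤ 1 :=
    fun ω => survival_le_one i c hr _
  have hint : Integrable ((pending T i c t).indicator
      fun ω => (survival P T i c t r (truncPast T i c t ω)).toReal) P := by
    refine Integrable.of_bound (hg.mono hm le_rfl).aestronglyMeasurable 1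
      (Eventually.of_forall fun ω => ?_)
    rw [Real.norm_eq_abs]
    by_cases hω : ω ∈ pending T i c t
    · rw [indicator_of_mem hω, abs_of_nonneg ENNReal.toReal_nonneg]
      exact ENNReal.toReal_le_of_le_ofReal zero_le_one (by simpa using hbd ω)
    · simp [hω]
  have hE : MeasurableSet (pending T i c t ∩ {ω | r ≤ nextRequest T i t ω}) :=
    (hm _ hpend).inter (hreg.measurableSet_le_next i t r)
  have h1 : (pending T i c t).indicator
      (fun ω => (survival P T i c t r (truncPast T i c t ω)).toReal) =ᵐ[P]
      P[(pending T i c t ∩ {ω | r ≤ nextRequest T i t ω}).indicator (fun _ => (1 : ℝ))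
        | objHistory T i t] := by
    refine ae_eq_condExp_of_forall_setIntegral_eq hm ((integrable_const _).indicator hE)
      (fun s _ _ => hint.integrableOn) (fun s hs _ => ?_) hg.aestronglyMeasurable
    rw [setIntegral_indicator hE, setIntegral_const, smul_eq_mul, mul_one,
      setIntegral_indicator (hm _ hpend), integral_toReal
        (hsv.mono hm le_rfl).aemeasurable
          (Eventually.of_forall fun ω => (hbd ω).trans_lt (by simp)),
      ← hreg.measure_inter_pending i c hr hs, measureReal_def]
    congr 1
    refine measure_congr ?_
    filter_upwards [hreg.ae_good] with ω hω
    apply propext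
    change ((ω ∈ s ∧ ω ∈ pending T i c t) ∧ r ≤ T i c ω) ↔
      (ω ∈ s ∧ ω ∈ pending T i c t ∧ r ≤ nextRequest T i t ω)
    by_cases hp : ω ∈ pending T i c t
    · rw [nextRequest_of_pending ht (hω i) hp]; tauto
    · tauto
  have h2 : (pending T i c t ∩ {ω | r ≤ nextRequest T i t ω}).indicator (fun _ => (1 : ℝ)) =
      (pending T i c t).indicator ({ω | r ≤ nextRequest T i t ω}.indicator fun _ => (1 : ℝ)) := by
    rw [indicator_indicator]
  rw [h2] at h1
  have h3 := condExp_indicator (μ := P) (m := objHistory T i t)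
    ((integrable_const (1 : ℝ)).indicator (hreg.measurableSet_le_next i t r)) hpend
  filter_upwards [h1, h3] with ω e1 e2 hω
  rw [e2, indicator_of_mem hω, indicator_of_mem hω] at e1
  exact e1.symm

/-- The event `A` carries no information about the next request for object `i` after time `t` beyond
the history of that object. -/
def NextIndep (P : Measure Ω) (T : Fin n → ℕ → Ω → ℝ) (i : Fin n) (t : ℝ) (A : Set Ω) : Prop :=
  MeasurableSet A ∧ ∀ r, t ≤ r → ∀ B, MeasurableSet[objHistory T i t] B →
    P.real (A ∩ B ∩ {ω | r ≤ nextRequest T i t ω}) =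
      ∫ ω in A ∩ B, (P⟦{ω' | r ≤ nextRequest T i t ω'} | objHistory T i t⟧) ω ∂P

/-- The conditional survival function of a pending request is unchanged on an event that gives no
further information about the next request of the object. -/
theorem NextIndep.measure_inter_pending (hreg : IsRegularRequests P T) {i : Fin n} {t : ℝ}
    (ht : 0 < t) {A : Set Ω} (hA : NextIndep P T i t A) (c : ℕ) {r : ℝ} (hr : t ≤ r)
    {B : Set Ω} (hB : MeasurableSet[objHistory T i t] B) :
    P (A ∩ pending T i c t ∩ {ω | r ≤ T i c ω} ∩ B) =
      ∫⁻ ω in A ∩ pending T i c t ∩ B, survival P T i c t r (truncPast T i c t ω) ∂P := by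
  have hm := hreg.objHistory_le i t
  have hpend := measurableSet_pending T i c t
  have hsv : Measurable fun ω => survival P T i c t r (truncPast T i c t ω) :=
    ((measurable_survival i c t).comp (measurable_const.prodMk measurable_id :
      Measurable fun p : Fin c → ℝ => (r, p))).comp ((measurable_truncPast T i c t).mono hm le_rfl)
  have hbd : ∀ ω, survival P T i c t r (truncPast T i c t ω) ≤ 1 :=
    fun ω => survival_le_one i c hr _
  have h := hA.2 r hr (pending T i c t ∩ B) (hpend.inter hB)
  rw [← inter_assoc] at h
  have hmeas : MeasurableSet (A ∩ pending T i c t ∩ B) :=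
    (hA.1.inter (hm _ hpend)).inter (hm _ hB)
  have e1 : ∫ ω in A ∩ pending T i c t ∩ B,
      (P⟦{ω' | r ≤ nextRequest T i t ω'} | objHistory T i t⟧) ω ∂P =
      ∫ ω in A ∩ pending T i c t ∩ B,
        (survival P T i c t r (truncPast T i c t ω)).toReal ∂P := by
    refine setIntegral_congr_ae hmeas ?_
    filter_upwards [hreg.condProb_next i c ht hr] with ω hω hmem
    exact hω hmem.1.2
  rw [e1, integral_toReal hsv.aemeasurable
    (Eventually.of_forall fun ω => (hbd ω).trans_lt (by simp)), measureReal_def,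
    ENNReal.toReal_eq_toReal_iff' (measure_ne_top _ _) ?_] at h
  · rw [← h]
    refine measure_congr ?_
    filter_upwards [hreg.ae_good] with ω hω
    apply propext
    change (((ω ∈ A ∧ ω ∈ pending T i c t) ∧ r ≤ T i c ω) ∧ ω ∈ B) ↔
      (((ω ∈ A ∧ ω ∈ pending T i c t) ∧ ω ∈ B) ∧ r ≤ nextRequest T i t ω)
    by_cases hp : ω ∈ pending T i c t
    · rw [nextRequest_of_pending ht (hω i) hp]; tauto
    · tauto
  · refine ne_top_of_le_ne_top (b := P (A ∩ pending T i c t ∩ B)) (measure_ne_top _ _) ?_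
    refine (lintegral_mono hbd).trans ?_
    simp

theorem NextIndep.setLIntegral (hreg : IsRegularRequests P T) {i : Fin n} {t : ℝ}
    (ht : 0 < t) {A : Set Ω} (hA : NextIndep P T i t A) (c : ℕ) {r : ℝ} (hr : t ≤ r)
    {Y : Ω → ENNReal} (hY : Measurable[objHistory T i t] Y) :
    ∫⁻ ω in A ∩ pending T i c t ∩ {ω | r ≤ T i c ω}, Y ω ∂P =
      ∫⁻ ω in A ∩ pending T i c t, survival P T i c t r (truncPast T i c t ω) * Y ω ∂P := by
  have hm := hreg.objHistory_le i t
  have hsv : Measurable fun ω => survival P T i c t r (truncPast T i c t ω) :=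
    ((measurable_survival i c t).comp (measurable_const.prodMk measurable_id :
      Measurable fun p : Fin c → ℝ => (r, p))).comp ((measurable_truncPast T i c t).mono hm le_rfl)
  have hpend := hm _ (measurableSet_pending T i c t)
  have key : (P.restrict (A ∩ pending T i c t ∩ {ω | r ≤ T i c ω})).trim hm =
      ((P.restrict (A ∩ pending T i c t)).withDensity
        fun ω => survival P T i c t r (truncPast T i c t ω)).trim hm := by
    refine @Measure.ext _ (objHistory T i t) _ _ fun B hB => ?_
    rw [trim_measurableSet_eq hm hB, trim_measurableSet_eq hm hB,
      Measure.restrict_apply (hm _ hB), withDensity_apply _ (hm _ hB),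
      Measure.restrict_restrict (hm _ hB), inter_comm B, inter_comm B,
      hA.measure_inter_pending hreg ht c hr hB]
  rw [← lintegral_trim hm hY, key, lintegral_trim hm hY,
    lintegral_withDensity_eq_lintegral_mul _ hsv (hY.mono hm le_rfl)]
  rfl

/-- The integrated hazard rate up to the next request compensates the next request. -/
theorem NextIndep.measure_eq_lintegral (hreg : IsRegularRequests P T) {i : Fin n} {t : ℝ}
    (ht : 0 < t) {A : Set Ω} (hA : NextIndep P T i t A) (c : ℕ) {t₁ : ℝ} (h1 : t ≤ t₁) :
    P (A ∩ pending T i c t ∩ {ω | t₁ ≤ T i c ω}) =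
      ∫⁻ ω in A ∩ pending T i c t, (∫⁻ r in Icc t₁ (T i c ω),
        ENNReal.ofReal (hreg.hazardFn i c (pastEpochs T i c ω, r))) ∂P := by
  have hm := hreg.objHistory_le i t
  have hpend := hm _ (measurableSet_pending T i c t)
  have hAp := hA.1.inter hpend
  have htp := (measurable_truncPast T i c t).mono hm le_rfl
  have hh := hreg.measurable_hazardFn i c
  have hT := hreg.measurable i c
  -- both sides equal the expected survival probability at `t₁`
  have e0 : ∫⁻ ω in A ∩ pending T i c t, (∫⁻ r in Icc t₁ (T i c ω),
        ENNReal.ofReal (hreg.hazardFn i c (pastEpochs T i c ω, r))) ∂P =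
      ∫⁻ ω in A ∩ pending T i c t, (∫⁻ r in Ici t₁, {r | r ≤ T i c ω}.indicator
        (fun r => ENNReal.ofReal (hreg.hazardFn i c (truncPast T i c t ω, r))) r) ∂P := by
    refine setLIntegral_congr_fun_ae hAp ?_
    filter_upwards [hreg.ae_good] with ω hω hmem
    have hle : MeasurableSet {r | r ≤ T i c ω} := measurableSet_Iic
    rw [lintegral_indicator hle, Measure.restrict_restrict hle, truncPast_eq (hω i) hmem.2.1]
    congr 2
    ext r
    simp [and_comm]
  have hmeas : Measurable fun x : Ω × ℝ => {r | r ≤ T i c x.1}.indicator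
      (fun r => ENNReal.ofReal (hreg.hazardFn i c (truncPast T i c t x.1, r))) x.2 := by
    have : (fun x : Ω × ℝ => {r | r ≤ T i c x.1}.indicator
      (fun r => ENNReal.ofReal (hreg.hazardFn i c (truncPast T i c t x.1, r))) x.2) =
      {x : Ω × ℝ | x.2 ≤ T i c x.1}.indicator
        fun x => ENNReal.ofReal (hreg.hazardFn i c (truncPast T i c t x.1, x.2)) := by
      ext x; simp [indicator]
    rw [this]
    exact Measurable.indicator (by fun_prop) (measurableSet_le (by fun_prop) (by fun_prop))
  have hsvj : Measurable fun x : Ω × ℝ => survival P T i c t x.2 (truncPast T i c t x.1) :=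
    (measurable_survival i c t).comp (by fun_prop : Measurable fun x : Ω × ℝ =>
      (x.2, truncPast T i c t x.1))
  rw [e0, lintegral_lintegral_swap hmeas.aemeasurable]
  have e1 : ∀ r ∈ Ici t₁, ∫⁻ ω in A ∩ pending T i c t, {r | r ≤ T i c ω}.indicator
        (fun r => ENNReal.ofReal (hreg.hazardFn i c (truncPast T i c t ω, r))) r ∂P =
      ∫⁻ ω in A ∩ pending T i c t, survival P T i c t r (truncPast T i c t ω) *
        ENNReal.ofReal (hreg.hazardFn i c (truncPast T i c t ω, r)) ∂P := by
    intro r hr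
    rw [← hA.setLIntegral hreg ht c (h1.trans hr) (Y := fun ω =>
      ENNReal.ofReal (hreg.hazardFn i c (truncPast T i c t ω, r)))]
    · rw [inter_comm (A ∩ _), ← Measure.restrict_restrict (hreg.measurableSet_le_epoch i c r),
        ← lintegral_indicator (hreg.measurableSet_le_epoch i c r)]
      rfl
    · exact (hh.comp ((measurable_truncPast T i c t).prodMk measurable_const)).ennreal_ofReal
  rw [setLIntegral_congr_fun measurableSet_Ici e1, ← lintegral_lintegral_swap]
  · have e2 := hA.measure_inter_pending hreg ht c h1 (B := univ) MeasurableSet.univ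
    rw [inter_univ, inter_univ] at e2
    rw [e2]
    refine setLIntegral_congr_fun_ae hAp ?_
    filter_upwards [hreg.ae_good, hreg.ae_goodPast i c] with ω hω hG hmem
    rw [truncPast_eq (hω i) hmem.2.1]
    have e3 := lintegral_lawHazard_mul (hreg.ac_of_goodPast i c hG)
      (lastEpoch c (pastEpochs T i c ω)) t₁
    simp only [← hreg.hazardFn_eq i c hG] at e3
    simp only [survival]
    rw [← e3, ENNReal.div_eq_inv_mul, ← lintegral_const_mul]
    · refine lintegral_congr fun r => ?_
      rw [ENNReal.div_eq_inv_mul]; ring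
    · refine Measurable.mul (by fun_prop) ?_
      exact measurable_kernel_Ici (Kernel.const ℝ (condLaw P T i c (pastEpochs T i c ω)))
        (f := fun r => r - lastEpoch c (pastEpochs T i c ω)) (by fun_prop)
  · exact (hsvj.mul (by fun_prop)).aemeasurable

end

section

/-! ### Conditional independence and the absence of simultaneous requests -/

theorem objHistory_le_history {Ω : Type*} {n : ℕ} (T : Fin n → ℕ → Ω → ℝ) (i : Fin n) (t : ℝ) :
    objHistory T i t ≤ history T t :=
  le_iSup (fun i => objHistory T i t) i

theorem condProb_of_ae {Ω : Type*} {m m0 : MeasurableSpace Ω} {μ : Measure Ω}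
    [IsProbabilityMeasure μ]
    (hm : m ≤ m0) {s : Set Ω} (hs : ∀ᵐ ω ∂μ, ω ∈ s) : μ⟦s | m⟧ =ᵐ[μ] fun _ => 1 := by
  have h : s.indicator (fun _ => (1 : ℝ)) =ᵐ[μ] fun _ => 1 := by
    filter_upwards [hs] with ω hω using indicator_of_mem hω _
  refine (condExp_congr_ae h).trans ?_
  rw [condExp_const hm]

variable {Ω : Type*} {n : ℕ} [MeasurableSpace Ω] {P : Measure Ω} [IsProbabilityMeasure P]
  {T : Fin n → ℕ → Ω → ℝ}

theorem IsRegularRequests.history_le (hreg : IsRegularRequests P T) (t : ℝ) :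
    history T t ≤ ‹MeasurableSpace Ω› :=
  iSup_le fun i => hreg.objHistory_le i t

theorem IsRegularRequests.ae_le_next (hreg : IsRegularRequests P T) (i : Fin n) (t : ℝ) :
    ∀ᵐ ω ∂P, t ≤ nextRequest T i t ω := by
  filter_upwards [hreg.ae_good] with ω hω using le_reqCount_epoch (hω i) t

/-- In the product formula, the other objects take the bound `t`, which their next requests satisfy
almost surely. -/
theorem CondIndepRequests.condProb_single (hreg : IsRegularRequests P T)
    (hci : CondIndepRequests P T) (i : Fin n) {t r : ℝ} (ht : 0 < t) (hr : t ≤ r) :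
    P⟦{ω | r ≤ nextRequest T i t ω} | history T t⟧ =ᵐ[P]
      P⟦{ω | r ≤ nextRequest T i t ω} | objHistory T i t⟧ := by
  classical
  have h := hci t ht (Function.update (fun _ => t) i r) (fun j => by
    by_cases hj : j = i
    · subst hj; simpa using hr
    · simp [hj])
  have h1 : {ω | ∀ j, Function.update (fun _ => t) i r j ≤ nextRequest T j t ω}.indicator
      (fun _ => (1 : ℝ)) =ᵐ[P] {ω | r ≤ nextRequest T i t ω}.indicator (fun _ => (1 : ℝ)) := by
    refine indicator_ae_eq_of_ae_eq_set ?_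
    filter_upwards [ae_all_iff.2 fun j => hreg.ae_le_next j t] with ω hω
    apply propext
    change (∀ j, _) ↔ r ≤ nextRequest T i t ω
    refine ⟨fun h => by simpa using h i, fun h j => ?_⟩
    by_cases hj : j = i
    · subst hj; simpa using h
    · simpa [hj] using hω j
  have h2 : ∀ᵐ ω ∂P, ∀ j, j ≠ i →
      (P⟦{ω' | t ≤ nextRequest T j t ω'} | objHistory T j t⟧) ω = 1 :=
    ae_all_iff.2 fun j => by
      filter_upwards [condProb_of_ae (hreg.objHistory_le j t) (hreg.ae_le_next j t)] with ω hω _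
      exact hω
  filter_upwards [h, condExp_congr_ae (m := history T t) h1, h2] with ω e1 e2 e3
  rw [← e2, e1, Finset.prod_eq_single i]
  · simp
  · intro j _ hj
    simpa [hj] using e3 j hj
  · simp

/-- In the product formula, the objects other than `i` and `j` take the bound `t`, which their next
requests satisfy almost surely. -/
theorem CondIndepRequests.condProb_pair (hreg : IsRegularRequests P T)
    (hci : CondIndepRequests P T) {i j : Fin n} (hij : j ≠ i) {t r r' : ℝ} (ht : 0 < t)
    (hr : t ≤ r) (hr' : t ≤ r') :
    P⟦{ω | r ≤ nextRequest T i t ω} ∩ {ω | r' ≤ nextRequest T j t ω} | history T t⟧ =ᵐ[P]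
      fun ω => (P⟦{ω | r ≤ nextRequest T i t ω} | objHistory T i t⟧) ω *
        (P⟦{ω | r' ≤ nextRequest T j t ω} | objHistory T j t⟧) ω := by
  classical
  set v : Fin n → ℝ := Function.update (Function.update (fun _ => t) i r) j r' with hv
  have vi : v i = r := by simp [hv, hij.symm]
  have vj : v j = r' := by simp [hv]
  have vk : ∀ k, k ≠ i → k ≠ j → v k = t := fun k h1 h2 => by simp [hv, h1, h2]
  have h := hci t ht v (fun k => by
    by_cases h1 : k = i
    · rw [h1, vi]; exact hr
    · by_cases h2 : k = j
      · rw [h2, vj]; exact hr'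
      · rw [vk k h1 h2])
  have h1 : {ω | ∀ k, v k ≤ nextRequest T k t ω}.indicator
      (fun _ => (1 : ℝ)) =ᵐ[P] ({ω | r ≤ nextRequest T i t ω} ∩
        {ω | r' ≤ nextRequest T j t ω}).indicator (fun _ => (1 : ℝ)) := by
    refine indicator_ae_eq_of_ae_eq_set ?_
    filter_upwards [ae_all_iff.2 fun j => hreg.ae_le_next j t] with ω hω
    apply propext
    change (∀ k, v k ≤ nextRequest T k t ω) ↔
      r ≤ nextRequest T i t ω ∧ r' ≤ nextRequest T j t ω
    refine ⟨fun h => ⟨vi ▸ h i, vj ▸ h j⟩, fun h k => ?_⟩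
    by_cases h1 : k = i
    · rw [h1, vi]; exact h.1
    · by_cases h2 : k = j
      · rw [h2, vj]; exact h.2
      · rw [vk k h1 h2]; exact hω k
  have h2 : ∀ᵐ ω ∂P, ∀ k,
      (P⟦{ω' | t ≤ nextRequest T k t ω'} | objHistory T k t⟧) ω = 1 :=
    ae_all_iff.2 fun k => condProb_of_ae (hreg.objHistory_le k t) (hreg.ae_le_next k t)
  filter_upwards [h, condExp_congr_ae (m := history T t) h1, h2] with ω e1 e2 e3
  rw [← e2, e1, ← Finset.prod_subset (Finset.subset_univ {i, j}), Finset.prod_pair hij.symm, vi, vj]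
  intro k _ hk
  simp only [Finset.mem_insert, Finset.mem_singleton, not_or] at hk
  rw [vk k hk.1 hk.2]
  exact e3 k

/-- Given its own history, the next request of an object does not depend on the other histories. -/
theorem CondIndepRequests.nextIndep_history (hreg : IsRegularRequests P T)
    (hci : CondIndepRequests P T) (i : Fin n) {t : ℝ} (ht : 0 < t) {A : Set Ω}
    (hA : MeasurableSet[history T t] A) : NextIndep P T i t A := by
  have hm := hreg.history_le t
  refine ⟨hm _ hA, fun r hr B hB => ?_⟩
  have hAB : MeasurableSet[history T t] (A ∩ B) := hA.inter (objHistory_le_history T i t _ hB)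
  have hN := hreg.measurableSet_le_next i t r
  have e : ∫ ω in A ∩ B, (P⟦{ω' | r ≤ nextRequest T i t ω'} | objHistory T i t⟧) ω ∂P =
      ∫ ω in A ∩ B, (P⟦{ω' | r ≤ nextRequest T i t ω'} | history T t⟧) ω ∂P :=
    integral_congr_ae (ae_restrict_of_ae (hci.condProb_single hreg i ht hr).symm)
  rw [e, setIntegral_condExp hm ((integrable_const _).indicator hN) hAB,
    setIntegral_indicator hN]
  simp

/-- Given its own history, the next request of an object does not depend on the next request of
another object, jointly with all histories. -/
theorem CondIndepRequests.nextIndep_next (hreg : IsRegularRequests P T)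
    (hci : CondIndepRequests P T) {i j : Fin n} (hij : j ≠ i) {t r' : ℝ} (ht : 0 < t)
    (hr' : t ≤ r') {C : Set Ω} (hC : MeasurableSet[history T t] C) :
    NextIndep P T i t ({ω | r' ≤ nextRequest T j t ω} ∩ C) := by
  have hm := hreg.history_le t
  have hNj := hreg.measurableSet_le_next j t r'
  refine ⟨hNj.inter (hm _ hC), fun r hr B hB => ?_⟩
  have hCB : MeasurableSet[history T t] (C ∩ B) := hC.inter (objHistory_le_history T i t _ hB)
  have hNi := hreg.measurableSet_le_next i t r
  set p := P⟦{ω' | r ≤ nextRequest T i t ω'} | objHistory T i t⟧ with hp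
  have hpm : StronglyMeasurable[history T t] p :=
    stronglyMeasurable_condExp.mono (objHistory_le_history T i t)
  have hpint : Integrable p P := integrable_condExp
  have e1 : P.real ({ω | r' ≤ nextRequest T j t ω} ∩ C ∩ B ∩ {ω | r ≤ nextRequest T i t ω}) =
      ∫ ω in C ∩ B, ({ω | r ≤ nextRequest T i t ω} ∩
        {ω | r' ≤ nextRequest T j t ω}).indicator (fun _ => (1 : ℝ)) ω ∂P := by
    rw [setIntegral_indicator (hNi.inter hNj), setIntegral_const, smul_eq_mul, mul_one]
    congr 1
    ext ω
    simp only [mem_inter_iff]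
    tauto
  have e2 : ∫ ω in {ω | r' ≤ nextRequest T j t ω} ∩ C ∩ B, p ω ∂P =
      ∫ ω in C ∩ B, (p * {ω | r' ≤ nextRequest T j t ω}.indicator fun _ => (1 : ℝ)) ω ∂P := by
    have : (p * {ω | r' ≤ nextRequest T j t ω}.indicator fun _ => (1 : ℝ)) =
        {ω | r' ≤ nextRequest T j t ω}.indicator p := by
      ext ω; by_cases h : r' ≤ nextRequest T j t ω <;> simp [h]
    rw [this, setIntegral_indicator hNj]
    congr 2
    ext ω
    simp only [mem_inter_iff]
    tauto
  have hint : Integrable (p * {ω | r' ≤ nextRequest T j t ω}.indicator fun _ => (1 : ℝ)) P := by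
    have : (p * {ω | r' ≤ nextRequest T j t ω}.indicator fun _ => (1 : ℝ)) =
        {ω | r' ≤ nextRequest T j t ω}.indicator p := by
      ext ω; by_cases h : r' ≤ nextRequest T j t ω <;> simp [h]
    rw [this]
    exact hpint.indicator hNj
  rw [e1, e2, ← setIntegral_condExp hm ((integrable_const _).indicator (hNi.inter hNj)) hCB,
    ← setIntegral_condExp hm hint hCB]
  refine integral_congr_ae (ae_restrict_of_ae ?_)
  have h3 := condExp_mul_of_stronglyMeasurable_left hpm hint
    ((integrable_const (1 : ℝ)).indicator hNj)
  filter_upwards [h3, hci.condProb_pair hreg hij ht hr hr', hci.condProb_single hreg j ht hr']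
    with ω a1 a2 a3
  rw [a2, a1, Pi.mul_apply, a3]

theorem ext_of_Ici_prod {μ ν : Measure (ℝ × ℝ)} [IsFiniteMeasure μ]
    (h : ∀ a b, μ (Ici a ×ˢ Ici b) = ν (Ici a ×ˢ Ici b)) : μ = ν := by
  have hspan : IsCountablySpanning (range (Ici : ℝ → Set ℝ)) := by
    refine ⟨fun m : ℕ => Ici (-(m : ℝ)), fun m => mem_range_self _, ?_⟩
    refine eq_univ_of_forall fun x => ?_
    obtain ⟨m, hm⟩ := exists_nat_ge (-x)
    exact mem_iUnion.2 ⟨m, by simp only [mem_Ici]; linarith⟩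
  have hgen : (inferInstance : MeasurableSpace ℝ) =
      MeasurableSpace.generateFrom (range (Ici : ℝ → Set ℝ)) :=
    (BorelSpace.measurable_eq).trans (borel_eq_generateFrom_Ici ℝ)
  have hpi : IsPiSystem (range (Ici : ℝ → Set ℝ)) := isPiSystem_Ici
  refine Measure.ext_of_generateFrom_of_iUnion
    (image2 (· ×ˢ ·) (range (Ici : ℝ → Set ℝ)) (range (Ici : ℝ → Set ℝ)))
    (fun m : ℕ => Ici (-(m : ℝ)) ×ˢ Ici (-(m : ℝ))) ?_ (hpi.prod hpi) ?_
    (fun m => mem_image2_of_mem (mem_range_self _) (mem_range_self _))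
    (fun m => measure_ne_top _ _) ?_
  · exact (generateFrom_eq_prod hgen.symm hgen.symm hspan hspan).symm
  · refine eq_univ_of_forall fun x => ?_
    obtain ⟨m, hm⟩ := exists_nat_ge (max (-x.1) (-x.2))
    refine mem_iUnion.2 ⟨m, ?_, ?_⟩ <;> simp only [mem_Ici]
    · linarith [le_max_left (-x.1) (-x.2)]
    · linarith [le_max_right (-x.1) (-x.2)]
  · rintro _ ⟨_, ⟨a, rfl⟩, _, ⟨b, rfl⟩, rfl⟩
    exact h a b

/-- Two pending requests almost surely do not coincide: given the second one, the first has an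
absolutely continuous law. -/
theorem CondIndepRequests.measure_tie_pending (hreg : IsRegularRequests P T)
    (hci : CondIndepRequests P T) {i j : Fin n} (hij : j ≠ i) (c d : ℕ) {t : ℝ} (ht : 0 < t) :
    P (pending T i c t ∩ pending T j d t ∩ {ω | T i c ω = T j d ω}) = 0 := by
  set E := pending T i c t ∩ pending T j d t with hE
  have hEm : MeasurableSet E :=
    (hreg.objHistory_le i t _ (measurableSet_pending T i c t)).inter
      (hreg.objHistory_le j t _ (measurableSet_pending T j d t))
  have hTi := hreg.measurable i c
  have hTj := hreg.measurable j d
  have hh := hreg.measurable_hazardFn i c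
  have hpast := hreg.measurable_pastEpochs i c
  let f : Ω × ℝ → ENNReal := {x : Ω × ℝ | t ≤ x.2 ∧ x.2 ≤ T i c x.1}.indicator
    fun x => ENNReal.ofReal (hreg.hazardFn i c (pastEpochs T i c x.1, x.2))
  have hS : MeasurableSet {x : Ω × ℝ | t ≤ x.2 ∧ x.2 ≤ T i c x.1} :=
    (measurableSet_le measurable_const measurable_snd).inter
      (measurableSet_le measurable_snd (hTi.comp measurable_fst))
  have hf : Measurable f := Measurable.indicator (by fun_prop) hS
  let Z : Ω × ℝ → ℝ × ℝ := fun x => (x.2, T j d x.1)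
  have hZ : Measurable Z := by fun_prop
  let μ := (P.restrict E).map fun ω => (T i c ω, T j d ω)
  let ν := (((P.restrict E).prod volume).withDensity f).map Z
  have hquad : ∀ a b, μ (Ici a ×ˢ Ici b) = ν (Ici a ×ˢ Ici b) := by
    intro a b
    have hq : MeasurableSet (Ici a ×ˢ Ici b : Set (ℝ × ℝ)) :=
      measurableSet_Ici.prod measurableSet_Ici
    have hnext := hci.nextIndep_next hreg hij ht (le_max_left t b)
      (objHistory_le_history T j t _ (measurableSet_pending T j d t))
    have hkey := hnext.measure_eq_lintegral hreg ht c (le_max_left t a)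
    have hset : ({ω | max t b ≤ nextRequest T j t ω} ∩ pending T j d t ∩ pending T i c t : Set Ω)
        =ᵐ[P] ({ω | b ≤ T j d ω} ∩ E : Set Ω) := by
      filter_upwards [hreg.ae_good] with ω hω
      apply propext
      change ((max t b ≤ nextRequest T j t ω ∧ ω ∈ pending T j d t) ∧ ω ∈ pending T i c t) ↔
        (b ≤ T j d ω ∧ ω ∈ pending T i c t ∧ ω ∈ pending T j d t)
      by_cases hp : ω ∈ pending T j d t
      · have := hp.2
        rw [nextRequest_of_pending ht (hω j) hp, max_le_iff]; tauto
      · tauto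
    have e1 : μ (Ici a ×ˢ Ici b) = P ({ω | max t b ≤ nextRequest T j t ω} ∩ pending T j d t ∩
        pending T i c t ∩ {ω | max t a ≤ T i c ω}) := by
      rw [Measure.map_apply (by fun_prop) hq, Measure.restrict_apply
        ((by fun_prop : Measurable fun ω => (T i c ω, T j d ω)) hq)]
      refine measure_congr ?_
      filter_upwards [hset] with ω hω
      have hω' := Eq.to_iff hω
      apply propext
      change ((a ≤ T i c ω ∧ b ≤ T j d ω) ∧ ω ∈ E) ↔
        (ω ∈ {ω | max t b ≤ nextRequest T j t ω} ∩ pending T j d t ∩ pending T i c t ∧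
          max t a ≤ T i c ω)
      change (ω ∈ {ω | max t b ≤ nextRequest T j t ω} ∩ pending T j d t ∩ pending T i c t) ↔
        (b ≤ T j d ω ∧ ω ∈ E) at hω'
      rw [hω', max_le_iff]
      have : ω ∈ E → t ≤ T i c ω := fun h => h.1.2
      tauto
    rw [e1, hkey, Measure.restrict_congr_set hset, ← Measure.restrict_restrict
      (hreg.measurableSet_le_epoch j d b),
      ← lintegral_indicator (hreg.measurableSet_le_epoch j d b),
      Measure.map_apply hZ hq, withDensity_apply _ (hZ hq), ← lintegral_indicator (hZ hq),
      lintegral_prod _ (hf.indicator (hZ hq)).aemeasurable]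
    refine lintegral_congr fun ω => ?_
    by_cases hb : b ≤ T j d ω
    · rw [indicator_of_mem (by exact hb), ← lintegral_indicator measurableSet_Icc]
      refine lintegral_congr fun r => ?_
      simp only [indicator, f, Z, mem_preimage, mem_prod, mem_Ici, hb, and_true, mem_ofPred_eq,
        mem_Icc, max_le_iff]
      by_cases h1 : a ≤ r <;> by_cases h2 : t ≤ r <;> simp [h1, h2]
    · rw [indicator_of_notMem (by exact hb)]
      simp [indicator, Z, hb]
  have hμν : μ = ν := ext_of_Ici_prod hquad
  have hdiag : MeasurableSet {x : ℝ × ℝ | x.1 = x.2} :=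
    measurableSet_eq_fun (by fun_prop) (by fun_prop)
  have h0 : ν {x : ℝ × ℝ | x.1 = x.2} = 0 := by
    rw [Measure.map_apply hZ hdiag]
    refine withDensity_absolutelyContinuous _ _ ?_
    rw [Measure.measure_prod_null (hZ hdiag)]
    refine Eventually.of_forall fun ω => ?_
    have : Prod.mk ω ⁻¹' (Z ⁻¹' {x : ℝ × ℝ | x.1 = x.2}) = {T j d ω} := by ext r; simp [Z]
    simp only [this, Pi.zero_apply, measure_singleton]
  rw [← hμν, Measure.map_apply (by fun_prop) hdiag, Measure.restrict_apply
    ((by fun_prop : Measurable fun ω => (T i c ω, T j d ω)) hdiag), inter_comm] at h0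
  exact h0

/-- Almost surely, no two objects are requested at the same time. -/
theorem CondIndepRequests.ae_no_ties (hreg : IsRegularRequests P T)
    (hci : CondIndepRequests P T) :
    ∀ᵐ ω ∂P, ∀ i j c d, T i c ω = T j d ω → i = j := by
  rw [ae_all_iff]; intro i
  rw [ae_all_iff]; intro j
  rw [ae_all_iff]; intro c
  rw [ae_all_iff]; intro d
  rcases eq_or_ne j i with hij | hij
  · exact Eventually.of_forall fun ω _ => hij.symm
  have h0 : ∀ᵐ ω ∂P, ∀ q : ℚ, 0 < (q : ℝ) →
      ω ∉ pending T i c q ∩ pending T j d q ∩ {ω | T i c ω = T j d ω} :=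
    ae_all_iff.2 fun q => by
      by_cases hq : 0 < (q : ℝ)
      · filter_upwards [measure_eq_zero_iff_ae_notMem.1
          (hci.measure_tie_pending hreg hij c d hq)] with ω hω _ using hω
      · exact Eventually.of_forall fun ω h => absurd h hq
  filter_upwards [h0, hreg.ae_good] with ω hω hg heq
  exfalso
  have h1 := prevEpoch_lt (hg i) c
  have h2 := prevEpoch_lt (hg j) d
  obtain ⟨q, hq1, hq2⟩ := exists_rat_btwn (max_lt (max_lt h1 (heq ▸ h2)) ((hg i).pos c))
  rw [max_lt_iff, max_lt_iff] at hq1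
  exact hω q hq1.2 ⟨⟨⟨hq1.1.1, hq2.le⟩, ⟨hq1.1.2, heq ▸ hq2.le⟩⟩, heq⟩

end

section

/-! ### The compensator formula for predictable integrands -/

/-- Configurations of request epochs of all objects. -/
abbrev Conf (n : ℕ) : Type := Fin n → ℕ → ℝ

/-- The request epochs as functions of the configuration. -/
def canon (n : ℕ) : Fin n → ℕ → Conf n → ℝ := fun i k τ => τ i k

/-- The configuration of request epochs at `ω`. -/
def conf {Ω : Type*} {n : ℕ} (T : Fin n → ℕ → Ω → ℝ) (ω : Ω) : Conf n := fun i k => T i k ω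

/-- The configuration truncated at time `r`: it records exactly the history strictly before `r`. -/
def trunc {n : ℕ} (r : ℝ) (τ : Conf n) : Conf n := fun i k => min (τ i k) r

theorem measurable_canon (n : ℕ) (i : Fin n) (k : ℕ) : Measurable (canon n i k) :=
  (measurable_pi_apply k).comp (measurable_pi_apply i)

theorem measurable_trunc (n : ℕ) : Measurable fun x : ℝ × Conf n => trunc x.1 x.2 :=
  measurable_pi_lambda _ fun i => measurable_pi_lambda _ fun k =>
    ((measurable_canon n i k).comp measurable_snd).min measurable_fst

theorem conf_measurable {Ω : Type*} [MeasurableSpace Ω] {n : ℕ} {T : Fin n → ℕ → Ω → ℝ}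
    (hT : ∀ i k, Measurable (T i k)) : Measurable (conf T) :=
  measurable_pi_lambda _ fun i => measurable_pi_lambda _ fun k => hT i k

theorem reqCount_trunc {n : ℕ} (i : Fin n) {t r : ℝ} (h : t ≤ r) (τ : Conf n) :
    reqCount (canon n) i t (trunc r τ) = reqCount (canon n) i t τ := by
  simp [reqCount, canon, trunc, h]

theorem measurable_reqCount (n : ℕ) (i : Fin n) :
    Measurable fun x : ℝ × Conf n => reqCount (canon n) i x.1 x.2 :=
  measurable_sInf_nat fun k => measurableSet_le measurable_fst
    ((measurable_canon n i k).comp measurable_snd)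

/-- Sets of times and configurations cut out by finitely many lower bounds. -/
def orthants (n : ℕ) : Set (Set (ℝ × Conf n)) :=
  {s | ∃ (F₀ : Finset ℝ) (F : Finset ((Fin n × ℕ) × ℝ)),
    s = {x | (∀ b ∈ F₀, b ≤ x.1) ∧ ∀ y ∈ F, y.2 ≤ x.2 y.1.1 y.1.2}}

theorem isPiSystem_orthants (n : ℕ) : IsPiSystem (orthants n) := by
  classical
  rintro _ ⟨F₀, F, rfl⟩ _ ⟨F₀', F', rfl⟩ -
  refine ⟨F₀ ∪ F₀', F ∪ F', ?_⟩
  ext x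
  simp only [mem_inter_iff, mem_ofPred_eq, Finset.mem_union]
  constructor
  · rintro ⟨⟨h1, h2⟩, h3, h4⟩
    exact ⟨fun b hb => hb.elim (h1 b) (h3 b), fun y hy => hy.elim (h2 y) (h4 y)⟩
  · rintro ⟨h1, h2⟩
    exact ⟨⟨fun b hb => h1 b (.inl hb), fun y hy => h2 y (.inl hy)⟩,
      fun b hb => h1 b (.inr hb), fun y hy => h2 y (.inr hy)⟩

theorem generateFrom_orthants (n : ℕ) :
    (inferInstance : MeasurableSpace (ℝ × Conf n)) = MeasurableSpace.generateFrom (orthants n) := by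
  apply le_antisymm
  · have h1 : Measurable[MeasurableSpace.generateFrom (orthants n)]
        (Prod.fst : ℝ × Conf n → ℝ) := by
      refine measurable_of_Ici fun b => ?_
      refine MeasurableSpace.measurableSet_generateFrom ⟨{b}, ∅, ?_⟩
      ext x; simp
    have h2 : Measurable[MeasurableSpace.generateFrom (orthants n)]
        (Prod.snd : ℝ × Conf n → Conf n) := by
      refine @measurable_pi_lambda _ _ _ (MeasurableSpace.generateFrom (orthants n)) _ _ fun i => ?_
      refine @measurable_pi_lambda _ _ _ (MeasurableSpace.generateFrom (orthants n)) _ _ fun k => ?_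
      refine measurable_of_Ici fun b => ?_
      refine MeasurableSpace.measurableSet_generateFrom ⟨∅, {((i, k), b)}, ?_⟩
      ext x; simp
    exact sup_le h1.comap_le h2.comap_le
  · refine MeasurableSpace.generateFrom_le ?_
    rintro _ ⟨F₀, F, rfl⟩
    have e : {x : ℝ × Conf n | (∀ b ∈ F₀, b ≤ x.1) ∧ ∀ y ∈ F, y.2 ≤ x.2 y.1.1 y.1.2} =
        (⋂ b ∈ F₀, {x | b ≤ x.1}) ∩ ⋂ y ∈ F, {x | y.2 ≤ x.2 y.1.1 y.1.2} := by
      ext x; simp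
    rw [e]
    exact (Finset.measurableSet_biInter _ fun b _ => measurableSet_le measurable_const
      measurable_fst).inter (Finset.measurableSet_biInter _ fun y _ =>
        measurableSet_le measurable_const ((measurable_canon n y.1.1 y.1.2).comp measurable_snd))

variable {Ω : Type*} {n : ℕ} [MeasurableSpace Ω] {P : Measure Ω} [IsProbabilityMeasure P]
  {T : Fin n → ℕ → Ω → ℝ}

/-- The compensator formula for the request of object `i` with index `c`. Both sides define measures
on times and truncated configurations. After restriction to times at or past some rational `t` at
which the request is pending, they agree on orthants by conditional independence. -/
theorem CondIndepRequests.lintegral_epoch (hreg : IsRegularRequests P T)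
    (hci : CondIndepRequests P T) (i : Fin n) (c : ℕ) {g : ℝ × Conf n → ENNReal}
    (hg : Measurable g) :
    ∫⁻ ω, g (T i c ω, trunc (T i c ω) (conf T ω)) ∂P =
      ∫⁻ ω, (∫⁻ r in Ioc (prevEpoch T i c ω) (T i c ω),
        ENNReal.ofReal (hreg.hazardFn i c (pastEpochs T i c ω, r)) *
          g (r, trunc r (conf T ω))) ∂P := by
  have hT := hreg.measurable i c
  have hpv := hreg.measurable_prevEpoch i c
  have hcf := conf_measurable hreg.measurable
  have hh := hreg.measurable_hazardFn i c
  have hpast := hreg.measurable_pastEpochs i c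
  have htr := measurable_trunc n
  let S : Set (Ω × ℝ) := {x | prevEpoch T i c x.1 < x.2 ∧ x.2 ≤ T i c x.1}
  have hS : MeasurableSet S :=
    (measurableSet_lt (hpv.comp measurable_fst) measurable_snd).inter
      (measurableSet_le measurable_snd (hT.comp measurable_fst))
  let f : Ω × ℝ → ENNReal := S.indicator
    fun x => ENNReal.ofReal (hreg.hazardFn i c (pastEpochs T i c x.1, x.2))
  have hf : Measurable f := Measurable.indicator (by fun_prop) hS
  let Y : Ω → ℝ × Conf n := fun ω => (T i c ω, trunc (T i c ω) (conf T ω))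
  have hY : Measurable Y := hT.prodMk (htr.comp (hT.prodMk hcf))
  let Z : Ω × ℝ → ℝ × Conf n := fun x => (x.2, trunc x.2 (conf T x.1))
  have hZ : Measurable Z :=
    measurable_snd.prodMk (htr.comp (measurable_snd.prodMk (hcf.comp measurable_fst)))
  let μ := P.map Y
  let ν := ((P.prod volume).withDensity f).map Z
  let D : ℚ → Set (ℝ × Conf n) := fun t =>
    {x | 0 < (t : ℝ) ∧ prevEpoch (canon n) i c x.2 < t ∧ (t : ℝ) ≤ x.1}
  have hpc : Measurable (prevEpoch (canon n) i c) := by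
    cases c with
    | zero => exact measurable_const
    | succ c => exact measurable_canon n i c
  have hD : ∀ t, MeasurableSet (D t) := fun t =>
    (MeasurableSet.const _).inter ((measurableSet_lt (hpc.comp measurable_snd)
      measurable_const).inter (measurableSet_le measurable_const measurable_fst))
  have hDtr : ∀ (t : ℚ) (r : ℝ) (ω : Ω), (r, trunc r (conf T ω)) ∈ D t ↔
      0 < (t : ℝ) ∧ prevEpoch T i c ω < t ∧ (t : ℝ) ≤ r := by
    intro t r ω
    change (0 < (t : ℝ) ∧ prevEpoch (canon n) i c (trunc r (conf T ω)) < t ∧ (t : ℝ) ≤ r) ↔ _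
    cases c with
    | zero => rfl
    | succ c =>
      change (_ ∧ min (T i c ω) r < t ∧ _) ↔ (_ ∧ T i c ω < t ∧ _)
      refine and_congr_right fun _ => and_congr_left fun h => ?_
      rw [min_lt_iff, or_iff_left (not_lt.2 h)]
  have hμuniv : μ univ = 1 := by
    rw [Measure.map_apply hY MeasurableSet.univ]; simp
  have hμfin : IsFiniteMeasure μ := ⟨by rw [hμuniv]; simp⟩
  have key : ∀ t : ℚ, μ.restrict (D t) = ν.restrict (D t) := by
    intro t
    by_cases ht : 0 < (t : ℝ)
    swap
    · have : D t = ∅ := by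
        ext x; exact ⟨fun h => absurd h.1 ht, fun h => h.elim⟩
      simp [this]
    have hort : ∀ s ∈ orthants n, (μ.restrict (D t)) s = (ν.restrict (D t)) s := by
      intro s hs
      have hsm : MeasurableSet s := by
        have h := MeasurableSpace.measurableSet_generateFrom hs
        rw [← generateFrom_orthants n] at h
        exact h
      obtain ⟨F₀, F, rfl⟩ := hs
      classical
      set L : Finset ℝ := insert (t : ℝ) (F₀ ∪ F.image Prod.snd) with hL
      have hLne : L.Nonempty := Finset.insert_nonempty _ _
      set u := L.max' hLne with hu
      have htu : (t : ℝ) ≤ u := L.le_max' _ (by simp [hL])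
      have hru : ∀ r : ℝ, u ≤ r ↔ (t : ℝ) ≤ r ∧ (∀ b ∈ F₀, b ≤ r) ∧ ∀ y ∈ F, y.2 ≤ r := by
        intro r
        rw [hu, Finset.max'_le_iff]
        simp only [hL, Finset.mem_insert, Finset.mem_union, Finset.mem_image]
        constructor
        · intro h
          exact ⟨h _ (.inl rfl), fun b hb => h b (.inr (.inl hb)),
            fun y hy => h y.2 (.inr (.inr ⟨y, hy, rfl⟩))⟩
        · rintro ⟨h1, h2, h3⟩ b (rfl | hb | ⟨y, hy, rfl⟩)
          exacts [h1, h2 b hb, h3 y hy]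
      let A : Set Ω := (⋂ y ∈ F, {ω | y.2 ≤ T y.1.1 y.1.2 ω}) ∩ {ω | prevEpoch T i c ω < t}
      have hA : MeasurableSet[history T u] A := by
        refine MeasurableSet.inter ?_
          (objHistory_le_history T i u _ (measurableSet_prevEpoch_lt T i c htu))
        refine Finset.measurableSet_biInter _ fun y hy => ?_
        exact objHistory_le_history T y.1.1 u _
          (measurableSet_le_objHistory T y.1.1 (((hru u).1 le_rfl).2.2 y hy) y.1.2)
      have hA' : ∀ ω, ω ∈ A ↔ (∀ y ∈ F, y.2 ≤ T y.1.1 y.1.2 ω) ∧ prevEpoch T i c ω < t := by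
        intro ω; simp [A]
      have hpos : 0 < u := ht.trans_le htu
      have hmain := (hci.nextIndep_history hreg i hpos hA).measure_eq_lintegral hreg hpos c le_rfl
      have hmem : ∀ r ω, ((r, trunc r (conf T ω)) ∈ {x : ℝ × Conf n | (∀ b ∈ F₀, b ≤ x.1) ∧
          ∀ y ∈ F, y.2 ≤ x.2 y.1.1 y.1.2} ∩ D t) ↔ ω ∈ A ∧ u ≤ r := by
        intro r ω
        rw [mem_inter_iff, hDtr, hru, hA']
        simp only [mem_ofPred_eq, trunc, conf, le_min_iff]
        constructor
        · rintro ⟨⟨h1, h2⟩, h3, h4, h5⟩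
          exact ⟨⟨fun y hy => (h2 y hy).1, h4⟩, h5, h1, fun y hy => (h2 y hy).2⟩
        · rintro ⟨⟨h1, h2⟩, h3, h4, h5⟩
          exact ⟨⟨h4, fun y hy => ⟨h1 y hy, h5 y hy⟩⟩, ht, h2, h3⟩
      have hsD := hsm.inter (hD t)
      rw [Measure.restrict_apply hsm, Measure.restrict_apply hsm, Measure.map_apply hY hsD,
        Measure.map_apply hZ hsD, withDensity_apply _ (hZ hsD), ← lintegral_indicator (hZ hsD),
        lintegral_prod _ (hf.indicator (hZ hsD)).aemeasurable]
      have e1 : Y ⁻¹' ({x : ℝ × Conf n | (∀ b ∈ F₀, b ≤ x.1) ∧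
          ∀ y ∈ F, y.2 ≤ x.2 y.1.1 y.1.2} ∩ D t) =
          A ∩ pending T i c u ∩ {ω | u ≤ T i c ω} := by
        ext ω
        rw [mem_preimage, hmem]
        have : ω ∈ A → prevEpoch T i c ω < u := fun h => ((hA' ω).1 h).2.trans_le htu
        simp only [pending, mem_inter_iff, mem_ofPred_eq]
        tauto
      have hAm : MeasurableSet (A ∩ pending T i c u) :=
        (hreg.history_le u _ hA).inter (hreg.objHistory_le i u _ (measurableSet_pending T i c u))
      rw [e1, hmain, ← lintegral_indicator hAm]
      refine lintegral_congr fun ω => ?_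
      have e2 : ∀ r, (Z ⁻¹' ({x : ℝ × Conf n | (∀ b ∈ F₀, b ≤ x.1) ∧
          ∀ y ∈ F, y.2 ≤ x.2 y.1.1 y.1.2} ∩ D t)).indicator f (ω, r) =
          A.indicator (fun ω => (Icc u (T i c ω)).indicator
            (fun r => ENNReal.ofReal (hreg.hazardFn i c (pastEpochs T i c ω, r))) r) ω := by
        intro r
        have e3 : (ω, r) ∈ Z ⁻¹' ({x : ℝ × Conf n | (∀ b ∈ F₀, b ≤ x.1) ∧
          ∀ y ∈ F, y.2 ≤ x.2 y.1.1 y.1.2} ∩ D t) ↔ ω ∈ A ∧ u ≤ r := hmem r ω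
        have e4 : (ω, r) ∈ S ↔ prevEpoch T i c ω < r ∧ r ≤ T i c ω := Iff.rfl
        have e5 : ω ∈ A → prevEpoch T i c ω < u := fun h => ((hA' ω).1 h).2.trans_le htu
        by_cases h1 : ω ∈ A
        · by_cases h2 : u ≤ r
          · have h3 : prevEpoch T i c ω < r := (e5 h1).trans_le h2
            by_cases h4 : r ≤ T i c ω
            · rw [indicator_of_mem (e3.2 ⟨h1, h2⟩), indicator_of_mem h1,
                indicator_of_mem (mem_Icc.2 ⟨h2, h4⟩)]
              exact indicator_of_mem (e4.2 ⟨h3, h4⟩) _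
            · rw [indicator_of_mem (e3.2 ⟨h1, h2⟩), indicator_of_mem h1,
                indicator_of_notMem (fun h => h4 h.2)]
              exact indicator_of_notMem (fun h => h4 h.2) _
          · rw [indicator_of_notMem (fun h => h2 (e3.1 h).2), indicator_of_mem h1,
              indicator_of_notMem (fun h => h2 h.1)]
        · rw [indicator_of_notMem (fun h => h1 (e3.1 h).1), indicator_of_notMem h1]
      simp only [e2]
      by_cases h1 : ω ∈ A
      · simp only [indicator_of_mem h1]
        rw [lintegral_indicator measurableSet_Icc]
        by_cases h2 : u ≤ T i c ω
        · rw [indicator_of_mem]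
          exact ⟨h1, ((hA' ω).1 h1).2.trans_le htu, h2⟩
        · rw [indicator_of_notMem fun h => h2 h.2.2, Icc_eq_empty h2]
          simp
      · simp only [indicator_of_notMem h1, lintegral_zero]
        rw [indicator_of_notMem fun h => h1 h.1]
    refine ext_of_generate_finite (orthants n) (generateFrom_orthants n) (isPiSystem_orthants n)
      hort (hort univ ⟨∅, ∅, by simp⟩)
  have hD_cover : ∀ ω, (∀ i, GoodSeq fun k => T i k ω) → ∀ r, prevEpoch T i c ω < r →
      (r, trunc r (conf T ω)) ∈ ⋃ t, D t := by
    intro ω hω r hr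
    have h0 : 0 ≤ prevEpoch T i c ω := by
      cases c with
      | zero => exact le_rfl
      | succ c => exact ((hω i).pos c).le
    obtain ⟨t, h1, h2⟩ := exists_rat_btwn hr
    exact mem_iUnion.2 ⟨t, (hDtr t r ω).2 ⟨h0.trans_lt h1, h1, h2.le⟩⟩
  have hDU : MeasurableSet (⋃ t, D t) := MeasurableSet.iUnion hD
  have hμν : μ = ν := by
    have h1 : μ.restrict (⋃ t, D t) = μ := by
      refine Measure.restrict_eq_self_of_ae_mem ?_
      refine (ae_map_iff hY.aemeasurable hDU).2 ?_
      filter_upwards [hreg.ae_good] with ω hω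
      exact hD_cover ω hω _ (prevEpoch_lt (hω i) c)
    have h2 : ν.restrict (⋃ t, D t) = ν := by
      refine Measure.restrict_eq_self_of_ae_mem ?_
      refine (ae_map_iff hZ.aemeasurable hDU).2 ((ae_withDensity_iff hf).2 ?_)
      filter_upwards [Measure.quasiMeasurePreserving_fst.ae hreg.ae_good] with x hx hfx
      refine hD_cover x.1 hx _ ?_
      by_contra hlt
      exact hfx (indicator_of_notMem (fun h => hlt h.1) _)
    rw [← h1, ← h2, Measure.restrict_iUnion_congr]
    exact key
  have e1 : ∫⁻ ω, g (T i c ω, trunc (T i c ω) (conf T ω)) ∂P = ∫⁻ x, g x ∂μ :=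
    (lintegral_map hg hY).symm
  have e2 := lintegral_withDensity_eq_lintegral_mul (P.prod volume) hf (hg.comp hZ)
  simp only [Function.comp_apply] at e2
  rw [e1, hμν, lintegral_map hg hZ, e2, lintegral_prod _ (hf.mul (hg.comp hZ)).aemeasurable]
  refine lintegral_congr fun ω => ?_
  rw [← lintegral_indicator measurableSet_Ioc]
  refine lintegral_congr fun r => ?_
  simp only [Pi.mul_apply, f, indicator, S, mem_ofPred_eq, mem_Ioc, Function.comp, Z]
  split_ifs <;> simp

/-- The hazard rate of object `i` as a function of the time and the configuration. -/
def IsRegularRequests.hazard (hreg : IsRegularRequests P T) (i : Fin n) (x : ℝ × Conf n) : ℝ :=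
  hreg.hazardFn i (reqCount (canon n) i x.1 x.2)
    (pastEpochs (canon n) i (reqCount (canon n) i x.1 x.2) x.2, x.1)

theorem IsRegularRequests.measurable_hazard (hreg : IsRegularRequests P T) (i : Fin n) :
    Measurable (hreg.hazard i) := by
  refine measurable_apply_nat (F := fun k (x : ℝ × Conf n) =>
    hreg.hazardFn i k (pastEpochs (canon n) i k x.2, x.1)) (fun k => ?_) (measurable_reqCount n i)
  refine (hreg.measurable_hazardFn i k).comp (Measurable.prodMk ?_ measurable_fst)
  exact measurable_pi_lambda _ fun j => (measurable_canon n i j).comp measurable_snd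

theorem IsRegularRequests.hazard_nonneg (hreg : IsRegularRequests P T) (i : Fin n)
    (x : ℝ × Conf n) : 0 ≤ hreg.hazard i x :=
  hreg.hazardFn_nonneg i _ _

/-- The hazard rate is predictable: it depends only on the history strictly before the time. -/
theorem IsRegularRequests.hazard_trunc (hreg : IsRegularRequests P T) (i : Fin n) (r : ℝ)
    (τ : Conf n) : hreg.hazard i (r, trunc r τ) = hreg.hazard i (r, τ) := by
  simp only [IsRegularRequests.hazard]
  rw [reqCount_trunc i le_rfl]
  congr 2
  ext j
  exact min_eq_left (lt_of_lt_reqCount (T := canon n) (ω := τ) j.2).le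

theorem IsRegularRequests.ae_hazard_eq (hreg : IsRegularRequests P T) :
    ∀ᵐ ω ∂P, ∀ i r, hazardRate P T i r ω = hreg.hazard i (r, conf T ω) := by
  have h : ∀ᵐ ω ∂P, ∀ i c, pastEpochs T i c ω ∈ hreg.goodPast i c :=
    ae_all_iff.2 fun i => ae_all_iff.2 fun c => hreg.ae_goodPast i c
  filter_upwards [h] with ω hω i r
  have h1 := hreg.hazardFn_eq i _ (hω i (reqCount T i r ω)) r
  rw [lastEpoch_pastEpochs] at h1
  exact h1.symm

/-- The compensator formula for all requests of object `i`. -/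
theorem CondIndepRequests.lintegral_tsum_epoch (hreg : IsRegularRequests P T)
    (hci : CondIndepRequests P T) (i : Fin n) {g : ℝ × Conf n → ENNReal} (hg : Measurable g) :
    ∫⁻ ω, ∑' c, g (T i c ω, trunc (T i c ω) (conf T ω)) ∂P =
      ∫⁻ ω, (∫⁻ r in Ioi 0, ENNReal.ofReal (hreg.hazard i (r, conf T ω)) *
          g (r, trunc r (conf T ω))) ∂P := by
  have htr := measurable_trunc n
  have hcf := conf_measurable hreg.measurable
  have hgm : ∀ c, AEMeasurable (fun ω => g (T i c ω, trunc (T i c ω) (conf T ω))) P := fun c =>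
    (hg.comp ((hreg.measurable i c).prodMk
      (htr.comp ((hreg.measurable i c).prodMk hcf)))).aemeasurable
  rw [lintegral_tsum hgm]
  have hm : ∀ c, AEMeasurable (fun ω => ∫⁻ r in Ioc (prevEpoch T i c ω) (T i c ω),
      ENNReal.ofReal (hreg.hazard i (r, conf T ω)) * g (r, trunc r (conf T ω))) P := by
    intro c
    have hS : MeasurableSet {x : Ω × ℝ | prevEpoch T i c x.1 < x.2 ∧ x.2 ≤ T i c x.1} :=
      (measurableSet_lt ((hreg.measurable_prevEpoch i c).comp measurable_fst) measurable_snd).inter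
        (measurableSet_le measurable_snd ((hreg.measurable i c).comp measurable_fst))
    have hsw : Measurable fun x : Ω × ℝ => (x.2, conf T x.1) :=
      measurable_snd.prodMk (hcf.comp measurable_fst)
    have h1 : Measurable fun x : Ω × ℝ => ENNReal.ofReal (hreg.hazard i (x.2, conf T x.1)) *
        g (x.2, trunc x.2 (conf T x.1)) :=
      ((hreg.measurable_hazard i).comp hsw).ennreal_ofReal.mul
        (hg.comp (measurable_snd.prodMk (htr.comp hsw)))
    have h2 := (h1.indicator hS).lintegral_prod_right' (ν := volume)
    refine h2.aemeasurable.congr (Eventually.of_forall fun ω => ?_)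
    have h3 := lintegral_indicator (μ := volume)
      (measurableSet_Ioc (a := prevEpoch T i c ω) (b := T i c ω))
      fun r => ENNReal.ofReal (hreg.hazard i (r, conf T ω)) * g (r, trunc r (conf T ω))
    refine Eq.trans (lintegral_congr fun r => ?_) h3
    simp only [indicator, mem_ofPred_eq, mem_Ioc]
  have e : ∀ c, ∫⁻ ω, g (T i c ω, trunc (T i c ω) (conf T ω)) ∂P =
      ∫⁻ ω, (∫⁻ r in Ioc (prevEpoch T i c ω) (T i c ω),
        ENNReal.ofReal (hreg.hazard i (r, conf T ω)) * g (r, trunc r (conf T ω))) ∂P := by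
    intro c
    rw [hci.lintegral_epoch hreg i c hg]
    refine lintegral_congr_ae ?_
    filter_upwards [hreg.ae_good] with ω hω
    refine setLIntegral_congr_fun measurableSet_Ioc fun r hr => ?_
    have h0 : 0 ≤ prevEpoch T i c ω := by
      cases c with
      | zero => exact le_rfl
      | succ c => exact ((hω i).pos c).le
    have h1 : reqCount T i r ω = c := (reqCount_eq_iff (hω i) (h0.trans_lt hr.1)).2 hr
    have h2 : hreg.hazard i (r, conf T ω) = hreg.hazardFn i (reqCount T i r ω)
      (pastEpochs T i (reqCount T i r ω) ω, r) := rfl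
    rw [h2, h1]
  simp_rw [e]
  rw [← lintegral_tsum hm]
  refine lintegral_congr_ae ?_
  filter_upwards [hreg.ae_good] with ω hω
  have hU : Ioi (0 : ℝ) = ⋃ c, Ioc (prevEpoch T i c ω) (T i c ω) := by
    ext r
    simp only [mem_Ioi, mem_iUnion, mem_Ioc]
    constructor
    · intro hr
      exact ⟨_, (reqCount_eq_iff (hω i) hr).1 rfl⟩
    · rintro ⟨c, h1, -⟩
      refine lt_of_le_of_lt ?_ h1
      cases c with
      | zero => exact le_rfl
      | succ c => exact ((hω i).pos c).le
  rw [hU, lintegral_iUnion (fun _ => measurableSet_Ioc)]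
  intro c d hcd
  rw [Function.onFun, Set.disjoint_left]
  intro r hc hd
  have hr : r ∈ Ioi (0 : ℝ) := by rw [hU]; exact mem_iUnion.2 ⟨c, hc⟩
  exact hcd (((reqCount_eq_iff (hω i) hr).2 hc).symm.trans ((reqCount_eq_iff (hω i) hr).2 hd))

end

section

/-! ### The superposition of the request processes -/

section Superposed

variable {n : ℕ} [NeZero n]

theorem argmin_eq_iff {a : Fin n → ℝ} {i : Fin n} :
    argmin a = i ↔ (∀ j, a i ≤ a j) ∧ ∀ l < i, ¬ ∀ j, a l ≤ a j := by
  have hmem := Finset.min'_mem _ (minimizers_nonempty a)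
  rw [Finset.mem_filter] at hmem
  constructor
  · rintro rfl
    refine ⟨hmem.2, fun l hl h => ?_⟩
    exact absurd (Finset.min'_le _ l (by simpa using h)) (not_le.2 hl)
  · rintro ⟨h1, h2⟩
    refine le_antisymm (Finset.min'_le _ i (by simpa using h1)) ?_
    by_contra hlt
    exact h2 _ (not_le.1 hlt) hmem.2

theorem argmin_le (a : Fin n → ℝ) (j : Fin n) : a (argmin a) ≤ a j :=
  (argmin_eq_iff.1 rfl).1 j

theorem measurable_argmin : Measurable (argmin : (Fin n → ℝ) → Fin n) := by
  refine measurable_to_countable' fun i => ?_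
  have hmin : ∀ i : Fin n, MeasurableSet {a : Fin n → ℝ | ∀ j, a i ≤ a j} := by
    intro i
    rw [show {a : Fin n → ℝ | ∀ j, a i ≤ a j} = ⋂ j, {a | a i ≤ a j} by ext; simp]
    exact MeasurableSet.iInter fun j =>
      measurableSet_le (measurable_pi_apply i) (measurable_pi_apply j)
  have h : (argmin : (Fin n → ℝ) → Fin n) ⁻¹' {i} =
      {a | ∀ j, a i ≤ a j} ∩ ⋂ l, ⋂ (_ : l < i), {a | ∀ j, a l ≤ a j}ᶜ := by
    ext a
    simp only [mem_preimage, mem_singleton_iff, argmin_eq_iff, mem_inter_iff, mem_ofPred_eq,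
      mem_iInter, mem_compl_iff]
  rw [h]
  exact (hmin i).inter (MeasurableSet.iInter fun l => MeasurableSet.iInter fun _ => (hmin l).compl)

/-- Truncation at a level above the minimum does not affect where the minimum is attained. -/
theorem argmin_min {a : Fin n → ℝ} {r : ℝ} (h : a (argmin a) < r) :
    (argmin fun j => min (a j) r) = argmin a := by
  have key : ∀ i, (∀ j, min (a i) r ≤ min (a j) r) ↔ ∀ j, a i ≤ a j := by
    intro i
    refine ⟨fun hi j => ?_, fun hi j => min_le_min_right r (hi j)⟩
    have h1 : a i < r := by
      have := (hi (argmin a)).trans_lt ((min_le_left _ _).trans_lt h)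
      rw [min_lt_iff] at this
      exact this.resolve_right (lt_irrefl r)
    have h2 := hi j
    rw [min_eq_left h1.le] at h2
    exact h2.trans (min_le_left _ _)
  have := argmin_eq_iff.1 (rfl : argmin a = argmin a)
  refine argmin_eq_iff.2 ⟨(key _).2 this.1, fun l hl => ?_⟩
  rw [key l]
  exact this.2 l hl

/-- Good configurations: all sequences of epochs are good, and no two objects are requested
simultaneously. -/
structure GoodConf (τ : Conf n) : Prop where
  good : ∀ i, GoodSeq (τ i)
  no_ties : ∀ i j c d, τ i c = τ j d → i = j

/-- The number of requests of all objects before time `r`. -/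
def totalCount (x : ℝ × Conf n) : ℕ := ∑ i, reqCount (canon n) i x.1 x.2

omit [NeZero n] in
theorem measurable_totalCount : Measurable (totalCount : ℝ × Conf n → ℕ) :=
  Finset.measurable_sum _ fun i _ => measurable_reqCount n i

omit [NeZero n] in
theorem totalCount_trunc (r : ℝ) (τ : Conf n) : totalCount (r, trunc r τ) = totalCount (r, τ) :=
  Finset.sum_congr rfl fun i _ => reqCount_trunc i le_rfl τ

theorem counts_conf {Ω : Type*} (T : Fin n → ℕ → Ω → ℝ) (k : ℕ) (ω : Ω) :
    counts T k ω = counts (canon n) k (conf T ω) := by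
  induction k with
  | zero => rfl
  | succ k ih => simp only [counts, ih]; rfl

theorem requested_conf {Ω : Type*} (T : Fin n → ℕ → Ω → ℝ) (k : ℕ) (ω : Ω) :
    requested T k ω = requested (canon n) k (conf T ω) := by
  unfold requested; rw [counts_conf T]; rfl

theorem epoch_conf {Ω : Type*} (T : Fin n → ℕ → Ω → ℝ) (k : ℕ) (ω : Ω) :
    epoch T k ω = epoch (canon n) k (conf T ω) := by
  unfold epoch; rw [counts_conf T, requested_conf T]; rfl

theorem record_conf {Ω : Type*} (T : Fin n → ℕ → Ω → ℝ) (k : ℕ) (ω : Ω) :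
    record T k ω = record (canon n) k (conf T ω) := by
  funext j
  exact Prod.ext (epoch_conf T j ω) (requested_conf T j ω)

theorem counts_succ (k : ℕ) (τ : Conf n) :
    counts (canon n) (k + 1) τ = Function.update (counts (canon n) k τ) (requested (canon n) k τ)
      (counts (canon n) k τ (requested (canon n) k τ) + 1) := rfl

theorem epoch_le (k : ℕ) (τ : Conf n) (j : Fin n) :
    epoch (canon n) k τ ≤ τ j (counts (canon n) k τ j) :=
  argmin_le (fun j => canon n j (counts (canon n) k τ j) τ) j

theorem measurable_counts (k : ℕ) : Measurable (counts (canon n) k) := by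
  induction k with
  | zero => exact measurable_const
  | succ k ih =>
    have hj : ∀ j, Measurable fun τ : Conf n => canon n j (counts (canon n) k τ j) τ := fun j =>
      measurable_apply_nat (measurable_canon n j)
      ((measurable_pi_apply j).comp ih)
    have hR : Measurable fun τ : Conf n => requested (canon n) k τ :=
      measurable_argmin.comp (measurable_pi_lambda _ hj)
    refine measurable_pi_lambda _ fun j => ?_
    have e : (fun τ : Conf n => counts (canon n) (k + 1) τ j) = fun τ =>
        if requested (canon n) k τ = j then counts (canon n) k τ j + 1
        else counts (canon n) k τ j := by
      ext τ
      rw [counts_succ]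
      by_cases h : requested (canon n) k τ = j
      · subst h; simp
      · rw [Function.update_of_ne (Ne.symm h), if_neg h]
    rw [e]
    have h1 : Measurable fun τ => counts (canon n) k τ j := (measurable_pi_apply j).comp ih
    exact Measurable.ite (hR (measurableSet_singleton j)) (h1.add_const 1) h1

theorem measurable_requested (k : ℕ) : Measurable (requested (canon n) k) :=
  measurable_argmin.comp (measurable_pi_lambda _ fun j =>
    measurable_apply_nat (measurable_canon n j)
      ((measurable_pi_apply j).comp (measurable_counts k)))

theorem measurable_epoch (k : ℕ) : Measurable (epoch (canon n) k) := by
  have h : Measurable fun x : (Fin n × ℕ) × Conf n => x.2 x.1.1 x.1.2 :=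
    measurable_from_prod_countable_right fun p => measurable_canon n p.1 p.2
  have h2 : Measurable fun τ : Conf n => counts (canon n) k τ (requested (canon n) k τ) := by
    have h3 : Measurable fun x : Fin n × (Fin n → ℕ) => x.2 x.1 :=
      measurable_from_prod_countable_right fun p => measurable_pi_apply p
    exact h3.comp ((measurable_requested k).prodMk (measurable_counts k))
  exact h.comp (((measurable_requested k).prodMk h2).prodMk measurable_id)

theorem measurable_record (k : ℕ) : Measurable (record (canon n) k) :=
  measurable_pi_lambda _ fun j => (measurable_epoch j).prodMk (measurable_requested j)

theorem sum_counts (k : ℕ) (τ : Conf n) : ∑ j, counts (canon n) k τ j = k := by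
  induction k with
  | zero => simp [counts]
  | succ k ih =>
    rw [counts_succ, Finset.sum_update_of_mem (Finset.mem_univ _)]
    rw [← Finset.add_sum_erase _ _ (Finset.mem_univ (requested (canon n) k τ)),
      Finset.erase_eq] at ih
    omega

/-- Requests before `r` are not affected by truncation of the epochs at `r`. -/
theorem record_trunc_aux {τ : Conf n} {r : ℝ} (k : ℕ)
    (h : ∀ j < k, epoch (canon n) j τ < r) :
    counts (canon n) k (trunc r τ) = counts (canon n) k τ ∧
      ∀ j < k, requested (canon n) j (trunc r τ) = requested (canon n) j τ ∧
        epoch (canon n) j (trunc r τ) = epoch (canon n) j τ := by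
  induction k with
  | zero => exact ⟨rfl, fun j hj => absurd hj (Nat.not_lt_zero j)⟩
  | succ k ih =>
    obtain ⟨h1, h2⟩ := ih fun j hj => h j (by omega)
    have hk := h k (Nat.lt_succ_self k)
    have hreq : requested (canon n) k (trunc r τ) = requested (canon n) k τ := by
      simp only [requested, h1]
      exact argmin_min (a := fun j => canon n j (counts (canon n) k τ j) τ) hk
    have hep : epoch (canon n) k (trunc r τ) = epoch (canon n) k τ := by
      simp only [epoch, h1, hreq]
      exact min_eq_left hk.le
    refine ⟨by rw [counts_succ, counts_succ, h1, hreq], fun j hj => ?_⟩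
    rcases Nat.lt_succ_iff_lt_or_eq.1 hj with hj | rfl
    · exact h2 j hj
    · exact ⟨hreq, hep⟩

namespace GoodConf

variable {τ : Conf n} (hτ : GoodConf τ)

include hτ

theorem epoch_lt_succ (k : ℕ) : epoch (canon n) k τ < epoch (canon n) (k + 1) τ := by
  set R := requested (canon n) k τ with hR
  set R' := requested (canon n) (k + 1) τ with hR'
  have h1 : epoch (canon n) (k + 1) τ = τ R' (counts (canon n) (k + 1) τ R') := rfl
  have h0 : epoch (canon n) k τ = τ R (counts (canon n) k τ R) := rfl
  by_cases h : R' = R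
  · rw [h1, counts_succ, h, Function.update_self, h0]
    exact (hτ.good R).2.1 (Nat.lt_succ_self _)
  · rw [h1, counts_succ, Function.update_of_ne h]
    refine lt_of_le_of_ne (epoch_le k τ R') fun he => h ?_
    exact (hτ.no_ties _ _ _ _ (h0.symm.trans he)).symm

theorem strictMono_epoch : StrictMono fun k => epoch (canon n) k τ :=
  strictMono_nat_of_lt_succ hτ.epoch_lt_succ

theorem lt_counts_iff (k : ℕ) (j : Fin n) (m : ℕ) :
    m < counts (canon n) k τ j ↔ τ j m < epoch (canon n) k τ := by
  constructor
  · induction k with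
    | zero => intro h; exact absurd h (Nat.not_lt_zero m)
    | succ k ih =>
      intro h
      have hlt := hτ.epoch_lt_succ k
      by_cases hj : j = requested (canon n) k τ
      · rw [counts_succ, hj, Function.update_self] at h
        rcases Nat.lt_succ_iff_lt_or_eq.1 h with h | h
        · rw [← hj] at h; exact (ih h).trans hlt
        · rw [h, hj]; exact hlt
      · rw [counts_succ, Function.update_of_ne hj] at h
        exact (ih h).trans hlt
  · intro h
    by_contra hc
    exact absurd ((epoch_le k τ j).trans ((hτ.good j).2.1.monotone (not_lt.1 hc))) (not_le.2 h)

theorem reqCount_epoch (k : ℕ) (j : Fin n) :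
    reqCount (canon n) j (epoch (canon n) k τ) τ = counts (canon n) k τ j := by
  refine eq_of_forall_lt_iff fun m => ?_
  rw [hτ.lt_counts_iff]
  exact lt_reqCount_iff (T := canon n) (ω := τ) (hτ.good j)

theorem totalCount_epoch (k : ℕ) : totalCount (epoch (canon n) k τ, τ) = k := by
  simp only [totalCount, hτ.reqCount_epoch, sum_counts]

omit [NeZero n] in
theorem totalCount_lt {r : ℝ} {i : Fin n} {c : ℕ} (h : τ i c < r) :
    totalCount (τ i c, τ) < totalCount (r, τ) := by
  have hmono : ∀ j, reqCount (canon n) j (τ i c) τ ≤ reqCount (canon n) j r τ := fun j => by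
    refine le_of_forall_lt fun m hm => ?_
    exact (lt_reqCount_iff (T := canon n) (ω := τ) (hτ.good j)).2
      ((lt_reqCount_iff (T := canon n) (ω := τ) (hτ.good j)).1 hm |>.trans h)
  refine Finset.sum_lt_sum (fun j _ => hmono j) ⟨i, Finset.mem_univ i, ?_⟩
  refine lt_of_le_of_lt ?_ ((lt_reqCount_iff (T := canon n) (ω := τ) (hτ.good i)).2 h)
  by_contra hc
  exact lt_irrefl _ ((lt_reqCount_iff (T := canon n) (ω := τ) (hτ.good i)).1 (not_le.1 hc))

/-- Every request is the one with index `k` overall, where `k` counts the requests before it. -/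
theorem eq_of_totalCount {i : Fin n} {c k : ℕ} (h : totalCount (τ i c, τ) = k) :
    requested (canon n) k τ = i ∧ counts (canon n) k τ i = c ∧ epoch (canon n) k τ = τ i c := by
  have heq : epoch (canon n) k τ = τ i c := by
    rcases lt_trichotomy (epoch (canon n) k τ) (τ i c) with hlt | heq | hlt
    · have := hτ.totalCount_lt (i := requested (canon n) k τ)
        (c := counts (canon n) k τ (requested (canon n) k τ)) hlt
      have h2 : totalCount (epoch (canon n) k τ, τ) < totalCount (τ i c, τ) := this
      rw [hτ.totalCount_epoch, h] at h2
      exact absurd h2 (lt_irrefl k)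
    · exact heq
    · have := hτ.totalCount_lt hlt
      rw [hτ.totalCount_epoch, h] at this
      exact absurd this (lt_irrefl k)
  have h1 : requested (canon n) k τ = i := hτ.no_ties _ _ _ _ heq
  refine ⟨h1, ?_, heq⟩
  have h2 : τ i (counts (canon n) k τ i) = τ i c := by
    rw [← heq, ← h1]; rfl
  exact (hτ.good i).2.1.injective h2

theorem record_trunc {r : ℝ} {k : ℕ} (h : r = epoch (canon n) k τ) :
    record (canon n) k (trunc r τ) = record (canon n) k τ := by
  have h2 := (record_trunc_aux (τ := τ) (r := r) k
    fun j hj => by rw [h]; exact hτ.strictMono_epoch hj).2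
  ext j
  · exact (h2 j j.2).2
  · rw [record, record, (h2 j j.2).1]

/-- Summation over all requests with index `k` overall. -/
theorem sum_tsum_totalCount (F : Fin n → ℕ → ENNReal) (k : ℕ) :
    ∑ i, ∑' c, (if totalCount (τ i c, τ) = k then F i c else 0) =
      F (requested (canon n) k τ) (counts (canon n) k τ (requested (canon n) k τ)) := by
  rw [Finset.sum_eq_single (requested (canon n) k τ), tsum_eq_single
    (counts (canon n) k τ (requested (canon n) k τ)), if_pos]
  · exact hτ.totalCount_epoch k
  · intro c hc
    exact if_neg fun h => hc ((hτ.eq_of_totalCount h).2.1).symm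
  · intro i _ hi
    refine ENNReal.tsum_eq_zero.2 fun c => if_neg fun h => hi (hτ.eq_of_totalCount h).1.symm
  · simp

/-- Summation over all requests, object by object or in the order of time. -/
theorem sum_tsum (F : Fin n → ℕ → ENNReal) :
    ∑ i, ∑' c, F i c =
      ∑' k, F (requested (canon n) k τ) (counts (canon n) k τ (requested (canon n) k τ)) := by
  simp_rw [← hτ.sum_tsum_totalCount F]
  have h : ∀ i c, F i c = ∑' k, if totalCount (τ i c, τ) = k then F i c else 0 := by
    intro i c
    rw [tsum_eq_single (totalCount (τ i c, τ)) fun k hk => if_neg hk.symm, if_pos rfl]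
  rw [Summable.tsum_finsetSum fun _ _ => ENNReal.summable]
  refine Finset.sum_congr rfl fun i _ => ?_
  rw [ENNReal.tsum_comm]
  exact tsum_congr fun c => h i c

end GoodConf

end Superposed

variable {Ω : Type*} {n : ℕ} [MeasurableSpace Ω] {P : Measure Ω} [IsProbabilityMeasure P]
  {T : Fin n → ℕ → Ω → ℝ}

theorem CondIndepRequests.ae_goodConf (hreg : IsRegularRequests P T)
    (hci : CondIndepRequests P T) : ∀ᵐ ω ∂P, GoodConf (conf T ω) := by
  filter_upwards [hreg.ae_good, hci.ae_no_ties hreg] with ω h1 h2 using ⟨h1, h2⟩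

/-- The compensator formula for the requests of all objects. -/
theorem CondIndepRequests.lintegral_sum_tsum_epoch (hreg : IsRegularRequests P T)
    (hci : CondIndepRequests P T) {g : Fin n → ℝ × Conf n → ENNReal}
    (hg : ∀ i, Measurable (g i)) :
    ∫⁻ ω, ∑ i, ∑' c, g i (T i c ω, trunc (T i c ω) (conf T ω)) ∂P =
      ∫⁻ ω, (∫⁻ r in Ioi 0, ∑ i, ENNReal.ofReal (hreg.hazard i (r, conf T ω)) *
          g i (r, trunc r (conf T ω))) ∂P := by
  have htr := measurable_trunc n
  have hcf := conf_measurable hreg.measurable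
  have h1 : ∀ i, Measurable fun ω => ∑' c, g i (T i c ω, trunc (T i c ω) (conf T ω)) := fun i =>
    Measurable.tsum fun c => (hg i).comp ((hreg.measurable i c).prodMk
      (htr.comp ((hreg.measurable i c).prodMk hcf)))
  have hsw : Measurable fun x : Ω × ℝ => (x.2, conf T x.1) :=
    measurable_snd.prodMk (hcf.comp measurable_fst)
  have h2 : ∀ i, Measurable fun x : Ω × ℝ => ENNReal.ofReal (hreg.hazard i (x.2, conf T x.1)) *
        g i (x.2, trunc x.2 (conf T x.1)) := fun i =>
    ((hreg.measurable_hazard i).comp hsw).ennreal_ofReal.mul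
        ((hg i).comp (measurable_snd.prodMk (htr.comp hsw)))
  have h3 : ∀ i ω, Measurable fun r => ENNReal.ofReal (hreg.hazard i (r, conf T ω)) *
        g i (r, trunc r (conf T ω)) := fun i ω =>
    have hr : Measurable fun r : ℝ => (r, conf T ω) := measurable_id.prodMk measurable_const
    ((hreg.measurable_hazard i).comp hr).ennreal_ofReal.mul
      ((hg i).comp (measurable_id.prodMk (htr.comp hr)))
  calc ∫⁻ ω, ∑ i, ∑' c, g i (T i c ω, trunc (T i c ω) (conf T ω)) ∂P
      = ∑ i, ∫⁻ ω, ∑' c, g i (T i c ω, trunc (T i c ω) (conf T ω)) ∂P :=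
        lintegral_finsetSum _ fun i _ => h1 i
    _ = ∑ i, ∫⁻ ω, (∫⁻ r in Ioi 0, ENNReal.ofReal (hreg.hazard i (r, conf T ω)) *
          g i (r, trunc r (conf T ω))) ∂P :=
        Finset.sum_congr rfl fun i _ => hci.lintegral_tsum_epoch hreg i (hg i)
    _ = ∫⁻ ω, ∑ i, (∫⁻ r in Ioi 0, ENNReal.ofReal (hreg.hazard i (r, conf T ω)) *
          g i (r, trunc r (conf T ω))) ∂P :=
        (lintegral_finsetSum _ fun i _ => (h2 i).lintegral_prod_right').symm
    _ = _ := lintegral_congr fun ω => (lintegral_finsetSum _ fun i _ => h3 i ω).symm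

end

section

/-! ### The fractional knapsack problem -/

section Knapsack

variable {n : ℕ} {s : Fin n → ℝ} {B : ℝ}

/-- The fraction of object `i` that greedy filling in the order `ρ` caches. -/
def greedyFrac (s : Fin n → ℝ) (B : ℝ) (ρ : Equiv.Perm (Fin n)) (i : Fin n) : ℝ :=
  max 0 (min 1 ((B - sizeBefore s ρ (ρ.symm i)) / s i))

theorem greedyFrac_nonneg (ρ : Equiv.Perm (Fin n)) (i : Fin n) : 0 ≤ greedyFrac s B ρ i :=
  le_max_left _ _

/-- The total size of the first `k` objects in the order `ρ`. -/
def cumSize (s : Fin n → ℝ) (ρ : Equiv.Perm (Fin n)) (k : ℕ) : ℝ :=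
  ∑ j : Fin n with j.val < k, s (ρ j)

theorem cumSize_val (ρ : Equiv.Perm (Fin n)) (m : Fin n) : cumSize s ρ m = sizeBefore s ρ m := by
  refine Finset.sum_congr ?_ fun _ _ => rfl
  ext j; simp

theorem cumSize_succ (ρ : Equiv.Perm (Fin n)) (m : Fin n) :
    cumSize s ρ (m + 1) = cumSize s ρ m + s (ρ m) := by
  have h : (Finset.univ.filter fun j : Fin n => j.val < m.val + 1) =
      insert m (Finset.univ.filter fun j : Fin n => j.val < m.val) := by
    ext j
    simp only [Finset.mem_filter, Finset.mem_univ, true_and, Finset.mem_insert, Fin.ext_iff]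
    omega
  rw [cumSize, h, Finset.sum_insert (by simp), add_comm]
  rfl

theorem cumSize_mono (hs : ∀ i, 0 < s i) (ρ : Equiv.Perm (Fin n)) : Monotone (cumSize s ρ) :=
  fun _ _ h => Finset.sum_le_sum_of_subset_of_nonneg
    (fun j hj => by simp only [Finset.mem_filter] at hj ⊢; exact ⟨hj.1, hj.2.trans_le h⟩)
    fun i _ _ => (hs _).le

/-- The capacity used by the first `m` objects is the minimum of `B` and their total size; the
increment of this in `m` is the capacity given to the next object. -/
theorem size_mul_greedyFrac (hs : ∀ i, 0 < s i) (ρ : Equiv.Perm (Fin n)) (m : Fin n) :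
    s (ρ m) * greedyFrac s B ρ (ρ m) =
      min B (cumSize s ρ (m + 1)) - min B (cumSize s ρ m) := by
  have h0 := hs (ρ m)
  rw [greedyFrac, ρ.symm_apply_apply, ← cumSize_val, cumSize_succ, mul_max_of_nonneg _ _ h0.le,
    mul_min_of_nonneg _ _ h0.le, mul_div_cancel₀ _ h0.ne', mul_zero, mul_one]
  rcases le_total B (cumSize s ρ m) with h | h
  · rw [min_eq_left h, min_eq_left (by linarith : B ≤ cumSize s ρ m + s (ρ m)), sub_self,
      max_eq_left ((min_le_right _ _).trans (by linarith))]
  · rw [min_eq_right h, max_eq_right (le_min h0.le (by linarith))]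
    rcases le_total B (cumSize s ρ m + s (ρ m)) with h' | h'
    · rw [min_eq_left h', min_eq_right (by linarith)]
    · rw [min_eq_right h', min_eq_left (by linarith)]; ring

theorem sum_size_mul_greedyFrac (hs : ∀ i, 0 < s i) (hB : 0 ≤ B) (ρ : Equiv.Perm (Fin n)) :
    ∑ i, s i * greedyFrac s B ρ i = min B (cumSize s ρ n) := by
  have h : ∑ m : Fin n, s (ρ m) * greedyFrac s B ρ (ρ m) =
      ∑ m : Fin n, (min B (cumSize s ρ (m + 1)) - min B (cumSize s ρ m)) :=
    Finset.sum_congr rfl fun m _ => size_mul_greedyFrac hs ρ m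
  rw [← Equiv.sum_comp ρ, h,
    Fin.sum_univ_eq_sum_range (fun k => min B (cumSize s ρ (k + 1)) - min B (cumSize s ρ k)) n,
    Finset.sum_range_sub fun k => min B (cumSize s ρ k)]
  have : cumSize s ρ 0 = 0 := by simp [cumSize]
  rw [this, min_eq_right hB, sub_zero]

/-- Greedy filling in decreasing order of the ratios of value to size solves the fractional knapsack
problem. -/
theorem sum_mul_le_sum_mul_greedyFrac (hs : ∀ i, 0 < s i) (hB : 0 ≤ B) {ρ : Equiv.Perm (Fin n)}
    {l : Fin n → ℝ} (hl : ∀ i, 0 ≤ l i) (hρ : Antitone fun j => l (ρ j) / s (ρ j))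
    {y : Fin n → ℝ} (hy0 : ∀ i, 0 ≤ y i) (hy1 : ∀ i, y i ≤ 1) (hyB : ∑ i, s i * y i ≤ B) :
    ∑ i, l i * y i ≤ ∑ i, l i * greedyFrac s B ρ i := by
  by_cases hall : ∀ m : Fin n, cumSize s ρ m + s (ρ m) ≤ B
  · refine Finset.sum_le_sum fun i _ => mul_le_mul_of_nonneg_left ?_ (hl i)
    have h1 : greedyFrac s B ρ i = 1 := by
      have := hall (ρ.symm i)
      rw [cumSize_val, ρ.apply_symm_apply] at this
      rw [greedyFrac, min_eq_left ((one_le_div (hs i)).2 (by linarith)), max_eq_right zero_le_one]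
    rw [h1]; exact hy1 i
  · push Not at hall
    obtain ⟨m, hm, hmin⟩ := WellFounded.has_min (wellFounded_lt (α := Fin n))
      {m : Fin n | B < cumSize s ρ m + s (ρ m)} hall
    have hm' : B < cumSize s ρ (m + 1) := by rw [cumSize_succ]; exact hm
    have htot : ∑ i, s i * greedyFrac s B ρ i = B := by
      rw [sum_size_mul_greedyFrac hs hB]
      exact min_eq_left (hm'.le.trans (cumSize_mono hs ρ m.2))
    -- the ratio of the first object that does not fit serves as the price of a unit of space
    set θ := l (ρ m) / s (ρ m) with hθ
    have hθ0 : 0 ≤ θ := div_nonneg (hl _) (hs _).le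
    have hterm : ∀ i, 0 ≤ (l i - θ * s i) * (greedyFrac s B ρ i - y i) := by
      intro i
      obtain ⟨j, rfl⟩ := ρ.surjective i
      have hsj := hs (ρ j)
      rcases lt_trichotomy j m with hjm | rfl | hjm
      · have h1 : greedyFrac s B ρ (ρ j) = 1 := by
          have h2 : ¬ B < cumSize s ρ j + s (ρ j) := fun h => hmin j h hjm
          rw [cumSize_val] at h2
          rw [greedyFrac, ρ.symm_apply_apply, min_eq_left ((one_le_div hsj).2 (by linarith)),
            max_eq_right zero_le_one]
        have h2 : θ ≤ l (ρ j) / s (ρ j) := hρ hjm.le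
        rw [le_div_iff₀ hsj] at h2
        rw [h1]
        exact mul_nonneg (by linarith) (by linarith [hy1 (ρ j)])
      · rw [hθ, div_mul_cancel₀ _ hsj.ne', sub_self, zero_mul]
      · have h1 : greedyFrac s B ρ (ρ j) = 0 := by
          have h2 : cumSize s ρ (m + 1) ≤ cumSize s ρ j := cumSize_mono hs ρ hjm
          rw [cumSize_val] at h2
          rw [greedyFrac, ρ.symm_apply_apply]
          exact max_eq_left ((min_le_right _ _).trans
            (div_nonpos_of_nonpos_of_nonneg (by linarith) hsj.le))
        have h2 : l (ρ j) / s (ρ j) ≤ θ := hρ hjm.le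
        rw [div_le_iff₀ hsj] at h2
        rw [h1]
        exact mul_nonneg_of_nonpos_of_nonpos (by linarith) (by linarith [hy0 (ρ j)])
    have hsum := Finset.sum_nonneg fun i (_ : i ∈ Finset.univ) => hterm i
    have hexp : ∑ i, (l i - θ * s i) * (greedyFrac s B ρ i - y i) =
        (∑ i, l i * greedyFrac s B ρ i - ∑ i, l i * y i) -
          θ * (∑ i, s i * greedyFrac s B ρ i - ∑ i, s i * y i) := by
      rw [← Finset.sum_sub_distrib, ← Finset.sum_sub_distrib, Finset.mul_sum,
        ← Finset.sum_sub_distrib]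
      exact Finset.sum_congr rfl fun i _ => by ring
    rw [hexp, htot] at hsum
    nlinarith [mul_nonneg hθ0 (sub_nonneg.2 hyB)]

theorem volume_greedyCached (hs : ∀ i, 0 < s i) (ρ : Equiv.Perm (Fin n)) (i : Fin n) :
    volume {u : unitInterval | GreedyCached s B ρ u i} = ENNReal.ofReal (greedyFrac s B ρ i) := by
  have hsi := hs i
  unfold GreedyCached greedyFrac
  simp only
  set w := sizeBefore s ρ (ρ.symm i)
  by_cases h1 : w + s i ≤ B
  · have : {u : unitInterval | w + s i ≤ B ∨ w ≤ B ∧ B < w + s i ∧ (u : ℝ) < (B - w) / s i} =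
        univ := by ext; simp [h1]
    rw [this, measure_univ, min_eq_left ((one_le_div hsi).2 (by linarith)),
      max_eq_right zero_le_one, ENNReal.ofReal_one]
  · by_cases h2 : w ≤ B
    · have hq1 : (B - w) / s i < 1 := (div_lt_one hsi).2 (by linarith)
      have hq0 : 0 ≤ (B - w) / s i := div_nonneg (by linarith) hsi.le
      have : {u : unitInterval | w + s i ≤ B ∨ w ≤ B ∧ B < w + s i ∧ (u : ℝ) < (B - w) / s i} =
          Iio ⟨(B - w) / s i, hq0, hq1.le⟩ := by
        ext u
        simp only [h1, h2, not_le.1 h1, false_or, true_and, mem_ofPred_eq, mem_Iio]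
        rfl
      rw [this, unitInterval.volume_Iio, min_eq_right hq1.le, max_eq_right hq0]
    · have : {u : unitInterval | w + s i ≤ B ∨ w ≤ B ∧ B < w + s i ∧ (u : ℝ) < (B - w) / s i} =
          ∅ := by ext; simp [h1, h2]
      rw [this, measure_empty, max_eq_left, ENNReal.ofReal_zero]
      exact (min_le_right _ _).trans (div_nonpos_of_nonpos_of_nonneg (by linarith) hsi.le)

/-- The probability that HR-VC caches object `i` when the ratios of hazard rate to size
are `r`. -/
def hrFrac (s : Fin n → ℝ) (B : ℝ) (ord : DecreasingOrder n) (r : Fin n → ℝ) (i : Fin n) :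
    ENNReal :=
  volume {x : unitInterval × unitInterval | GreedyCached s B (ord.perm x.1 r) x.2 i}

variable (ord : DecreasingOrder n)

theorem measurableSet_greedyCached (i : Fin n) :
    MeasurableSet {x : (Fin n → ℝ) × (unitInterval × unitInterval) |
      GreedyCached s B (ord.perm x.2.1 x.1) x.2.2 i} := by
  have h : {x : (Fin n → ℝ) × (unitInterval × unitInterval) |
      GreedyCached s B (ord.perm x.2.1 x.1) x.2.2 i} =
      ⋃ ρ : Equiv.Perm (Fin n), {x | ord.perm x.2.1 x.1 = ρ} ∩
        {x | GreedyCached s B ρ x.2.2 i} := by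
    ext x; simp
  rw [h]
  refine MeasurableSet.iUnion fun ρ => MeasurableSet.inter ?_ ?_
  · exact (measurable_snd.fst.prodMk measurable_fst) (ord.measurable ρ)
  · have hu : MeasurableSet {x : (Fin n → ℝ) × (unitInterval × unitInterval) |
        (x.2.2 : ℝ) < (B - sizeBefore s ρ (ρ.symm i)) / s i} :=
      measurableSet_lt (measurable_subtype_coe.comp measurable_snd.snd) measurable_const
    exact MeasurableSet.union (MeasurableSet.const _) ((MeasurableSet.const _).inter
      ((MeasurableSet.const _).inter hu))

theorem measurable_hrFrac (i : Fin n) : Measurable fun r => hrFrac s B ord r i :=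
  measurable_measure_prodMk_left (measurableSet_greedyCached ord i)

theorem hrFrac_le_one (r : Fin n → ℝ) (i : Fin n) : hrFrac s B ord r i ≤ 1 := prob_le_one

theorem hrFrac_eq (hs : ∀ i, 0 < s i) (r : Fin n → ℝ) (i : Fin n) :
    hrFrac s B ord r i =
      ∫⁻ v : unitInterval, ENNReal.ofReal (greedyFrac s B (ord.perm v r) i) := by
  have hm : MeasurableSet {x : unitInterval × unitInterval |
      GreedyCached s B (ord.perm x.1 r) x.2 i} :=
    measurable_prodMk_left (measurableSet_greedyCached ord i)
  rw [hrFrac, Measure.volume_eq_prod, Measure.prod_apply hm]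
  refine lintegral_congr fun v => ?_
  rw [← volume_greedyCached hs]
  rfl

theorem measurable_greedyFrac (r : Fin n → ℝ) (i : Fin n) :
    Measurable fun v => greedyFrac s B (ord.perm v r) i := by
  let _ : MeasurableSpace (Equiv.Perm (Fin n)) := ⊤
  have h : Measurable fun v => ord.perm v r := measurable_to_countable' fun ρ =>
    (measurable_id.prodMk measurable_const) (ord.measurable ρ)
  exact (measurable_from_top (f := fun ρ => greedyFrac s B ρ i)).comp h

theorem sum_size_mul_hrFrac_le (hs : ∀ i, 0 < s i) (hB : 0 ≤ B) (r : Fin n → ℝ) :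
    ∑ i, ENNReal.ofReal (s i) * hrFrac s B ord r i ≤ ENNReal.ofReal B := by
  simp_rw [hrFrac_eq ord hs]
  have hm : ∀ i, Measurable fun v => ENNReal.ofReal (greedyFrac s B (ord.perm v r) i) := fun i =>
    (measurable_greedyFrac ord r i).ennreal_ofReal
  simp_rw [← lintegral_const_mul _ (hm _)]
  rw [← lintegral_finsetSum _ fun i _ => (hm i).const_mul _]
  calc _ ≤ ∫⁻ _ : unitInterval, ENNReal.ofReal B := by
        refine lintegral_mono fun v => ?_
        simp_rw [← ENNReal.ofReal_mul (hs _).le]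
        rw [← ENNReal.ofReal_sum_of_nonneg fun i _ =>
          mul_nonneg (hs i).le (greedyFrac_nonneg _ _)]
        refine ENNReal.ofReal_le_ofReal ?_
        rw [sum_size_mul_greedyFrac hs hB]
        exact min_le_left _ _
    _ = _ := by simp

/-- HR-VC maximizes the total hazard rate of the cached objects, in the mean over its seeds. -/
theorem sum_mul_le_sum_mul_hrFrac (hs : ∀ i, 0 < s i) (hB : 0 ≤ B) {l : Fin n → ℝ}
    (hl : ∀ i, 0 ≤ l i) {y : Fin n → ENNReal} (hy1 : ∀ i, y i ≤ 1)
    (hyB : ∑ i, ENNReal.ofReal (s i) * y i ≤ ENNReal.ofReal B) :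
    ∑ i, ENNReal.ofReal (l i) * y i ≤
      ∑ i, ENNReal.ofReal (l i) * hrFrac s B ord (fun j => l j / s j) i := by
  simp_rw [hrFrac_eq ord hs]
  have hm : ∀ i, Measurable fun v =>
      ENNReal.ofReal (greedyFrac s B (ord.perm v fun j => l j / s j) i) := fun i =>
    (measurable_greedyFrac ord _ i).ennreal_ofReal
  simp_rw [← lintegral_const_mul _ (hm _)]
  rw [← lintegral_finsetSum _ fun i _ => (hm i).const_mul _]
  have hyr : ∀ i, y i = ENNReal.ofReal (y i).toReal := fun i =>
    (ENNReal.ofReal_toReal ((hy1 i).trans_lt ENNReal.one_lt_top).ne).symm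
  have hyB' : ∑ i, s i * (y i).toReal ≤ B := by
    rw [Finset.sum_congr rfl fun i _ => by rw [hyr i, ← ENNReal.ofReal_mul (hs i).le],
      ← ENNReal.ofReal_sum_of_nonneg fun i _ => mul_nonneg (hs i).le ENNReal.toReal_nonneg] at hyB
    exact (ENNReal.ofReal_le_ofReal_iff hB).1 hyB
  calc ∑ i, ENNReal.ofReal (l i) * y i
      = ∫⁻ _ : unitInterval, ∑ i, ENNReal.ofReal (l i) * y i := by simp
    _ ≤ _ := by
        refine lintegral_mono fun v => ?_
        have h := sum_mul_le_sum_mul_greedyFrac hs hB (ρ := ord.perm v fun j => l j / s j) hl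
          (ord.antitone v fun j => l j / s j) (y := fun i => (y i).toReal)
          (fun i => ENNReal.toReal_nonneg)
          (fun i => ENNReal.toReal_le_of_le_ofReal zero_le_one (by simpa using hy1 i)) hyB'
        simp only
        rw [Finset.sum_congr rfl fun i _ => by rw [hyr i, ← ENNReal.ofReal_mul (hl i)],
          ← ENNReal.ofReal_sum_of_nonneg fun i _ => mul_nonneg (hl i) ENNReal.toReal_nonneg]
        simp_rw [← ENNReal.ofReal_mul (hl _)]
        rw [← ENNReal.ofReal_sum_of_nonneg fun i _ =>
          mul_nonneg (hl i) (greedyFrac_nonneg _ _)]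
        exact ENNReal.ofReal_le_ofReal h

end Knapsack

end

section

/-! ### Optimality of HR-VC -/

theorem measurable_apply_fin {α β γ : Type*} [MeasurableSpace α] [MeasurableSpace β]
    [MeasurableSpace γ] {m : ℕ} {F : Fin m → β → γ} (hF : ∀ i, Measurable (F i)) {R : α → Fin m}
    (hR : Measurable R) {e : α → β} (he : Measurable e) : Measurable fun x => F (R x) (e x) :=
  (measurable_from_prod_countable_right (f := fun q : Fin m × β => F q.1 q.2) hF).comp
    (hR.prodMk he)

variable {Ω : Type*} {n : ℕ} [NeZero n] [MeasurableSpace Ω] {P : Measure Ω}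
  [IsProbabilityMeasure P] {T : Fin n → ℕ → Ω → ℝ} {s : Fin n → ℝ} {B : ℝ}

section Rule

omit [NeZero n]

/-- HR-VC as a predictable fractional policy: the probability of caching object `i`, as a function
of the time and the configuration. -/
def IsRegularRequests.hrvc (hreg : IsRegularRequests P T) (s : Fin n → ℝ) (B : ℝ)
    (ord : DecreasingOrder n) (i : Fin n) (x : ℝ × Conf n) : ENNReal :=
  hrFrac s B ord (fun j => hreg.hazard j x / s j) i

theorem IsRegularRequests.measurable_hrvc (hreg : IsRegularRequests P T) (s : Fin n → ℝ) (B : ℝ)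
    (ord : DecreasingOrder n) (i : Fin n) : Measurable (hreg.hrvc s B ord i) :=
  (measurable_hrFrac ord i).comp (measurable_pi_lambda _ fun j =>
    (hreg.measurable_hazard j).div_const _)

theorem IsRegularRequests.hrvc_trunc (hreg : IsRegularRequests P T) (s : Fin n → ℝ) (B : ℝ)
    (ord : DecreasingOrder n) (i : Fin n) (r : ℝ) (τ : Conf n) :
    hreg.hrvc s B ord i (r, trunc r τ) = hreg.hrvc s B ord i (r, τ) := by
  simp only [IsRegularRequests.hrvc, hreg.hazard_trunc]

/-- The expected number of hits, weighted by a predictable weight `w`, is largest under HR-VC among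
all predictable fractional policies `y`. -/
theorem CondIndepRequests.lintegral_policy_le_hrvc (hreg : IsRegularRequests P T)
    (hci : CondIndepRequests P T) (hs : ∀ i, 0 < s i) (hB : 0 ≤ B) (ord : DecreasingOrder n)
    {w : ℝ × Conf n → ENNReal} (hw : Measurable w) {y : Fin n → ℝ × Conf n → ENNReal}
    (hy : ∀ i, Measurable (y i)) (hy1 : ∀ i x, y i x ≤ 1)
    (hyB : ∀ x, ∑ i, ENNReal.ofReal (s i) * y i x ≤ ENNReal.ofReal B) :
    ∫⁻ ω, ∑ i, ∑' c, w (T i c ω, trunc (T i c ω) (conf T ω)) *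
        y i (T i c ω, trunc (T i c ω) (conf T ω)) ∂P ≤
      ∫⁻ ω, ∑ i, ∑' c, w (T i c ω, trunc (T i c ω) (conf T ω)) *
        hreg.hrvc s B ord i (T i c ω, trunc (T i c ω) (conf T ω)) ∂P := by
  rw [hci.lintegral_sum_tsum_epoch hreg (g := fun i x => w x * y i x) fun i => hw.mul (hy i),
    hci.lintegral_sum_tsum_epoch hreg (g := fun i x => w x * hreg.hrvc s B ord i x)
      fun i => hw.mul (hreg.measurable_hrvc s B ord i)]
  refine lintegral_mono fun ω => lintegral_mono fun r => ?_
  simp only [mul_left_comm _ (w _), ← Finset.mul_sum, hreg.hrvc_trunc]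
  refine mul_le_mul_right ?_ _
  exact sum_mul_le_sum_mul_hrFrac ord hs hB (fun i => hreg.hazard_nonneg i _)
    (fun i => hy1 i _) (hyB _)

end Rule

section Policy

variable (π : ICPolicy s B)

open Classical in
/-- The indicator that a policy caches object `i`, as a function of the time of the request
with index `k` and the configuration. -/
def policyInd (k : ℕ) (i : Fin n) (x : ℝ × Conf n) : ENNReal :=
  if i ∈ π.cache k x.1 (record (canon n) k x.2) then 1 else 0

/-- The indicator that exactly `k` requests are made before the given time. -/
def countInd (k : ℕ) (x : ℝ × Conf n) : ENNReal := if totalCount x = k then 1 else 0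

omit [NeZero n] in
theorem measurable_countInd (k : ℕ) : Measurable (countInd k : ℝ × Conf n → ENNReal) :=
  Measurable.ite (measurable_totalCount (measurableSet_singleton k)) measurable_const
    measurable_const

theorem measurableSet_mem_cache (k : ℕ) (i : Fin n) :
    MeasurableSet {x : ℝ × Conf n | i ∈ π.cache k x.1 (record (canon n) k x.2)} :=
  (measurable_fst.prodMk ((measurable_record k).comp measurable_snd)) (π.measurable k i)

theorem measurable_policyInd (k : ℕ) (i : Fin n) : Measurable (policyInd π k i) :=
  Measurable.ite (measurableSet_mem_cache π k i) measurable_const measurable_const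

theorem policyInd_le_one (k : ℕ) (i : Fin n) (x : ℝ × Conf n) : policyInd π k i x ≤ 1 := by
  unfold policyInd; split_ifs <;> simp

theorem sum_size_mul_policyInd_le (hs : ∀ i, 0 < s i) (k : ℕ) (x : ℝ × Conf n) :
    ∑ i, ENNReal.ofReal (s i) * policyInd π k i x ≤ ENNReal.ofReal B := by
  classical
  simp only [policyInd, mul_ite, mul_one, mul_zero]
  rw [← Finset.sum_filter, Finset.filter_mem_eq_inter, Finset.univ_inter,
    ← ENNReal.ofReal_sum_of_nonneg fun i _ => (hs i).le]
  exact ENNReal.ofReal_le_ofReal (π.capacity _ _ _)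

omit [MeasurableSpace Ω] in
theorem hit_nonneg (T : Fin n → ℕ → Ω → ℝ) (k : ℕ) (ω : Ω) : 0 ≤ hit T π k ω := by
  unfold hit; split_ifs <;> simp

omit [MeasurableSpace Ω] in
theorem hit_le_one (T : Fin n → ℕ → Ω → ℝ) (k : ℕ) (ω : Ω) : hit T π k ω ≤ 1 := by
  unfold hit; split_ifs <;> simp

omit [MeasurableSpace Ω] in
theorem ofReal_hit (T : Fin n → ℕ → Ω → ℝ) (k : ℕ) (ω : Ω) :
    ENNReal.ofReal (hit T π k ω) = policyInd π k (requested (canon n) k (conf T ω))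
      (epoch (canon n) k (conf T ω), conf T ω) := by
  unfold hit policyInd
  rw [requested_conf, epoch_conf, record_conf]
  split_ifs <;> simp

theorem measurable_hit (hT : ∀ i k, Measurable (T i k)) (k : ℕ) : Measurable (hit T π k) := by
  have hS : MeasurableSet {τ : Conf n | requested (canon n) k τ ∈
      π.cache k (epoch (canon n) k τ) (record (canon n) k τ)} := by
    have e : {τ : Conf n | requested (canon n) k τ ∈
        π.cache k (epoch (canon n) k τ) (record (canon n) k τ)} =
        ⋃ i, {τ | requested (canon n) k τ = i} ∩
          (fun τ => (epoch (canon n) k τ, τ)) ⁻¹'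
            {x : ℝ × Conf n | i ∈ π.cache k x.1 (record (canon n) k x.2)} := by
      ext τ; simp
    rw [e]
    exact MeasurableSet.iUnion fun i => (measurable_requested k (measurableSet_singleton i)).inter
      (((measurable_epoch k).prodMk measurable_id) (measurableSet_mem_cache π k i))
  have e : hit T π k = fun ω => (indicator {τ : Conf n | requested (canon n) k τ ∈
      π.cache k (epoch (canon n) k τ) (record (canon n) k τ)} (fun _ => (1 : ℝ))) (conf T ω) := by
    ext ω
    simp only [hit, requested_conf T, epoch_conf T, record_conf T, indicator, mem_ofPred_eq]
  rw [e]
  exact (measurable_const.indicator hS).comp (conf_measurable hT)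

theorem integrable_hit (hT : ∀ i k, Measurable (T i k)) (k : ℕ) : Integrable (hit T π k) P :=
  Integrable.of_bound (measurable_hit π hT k).aestronglyMeasurable 1
    (Eventually.of_forall fun ω => by
    rw [Real.norm_eq_abs, abs_of_nonneg (hit_nonneg π T k ω)]; exact hit_le_one π T k ω)

/-- The probability of a hit at the request with index `k`, written as a sum over all requests of
predictable terms. -/
theorem CondIndepRequests.lintegral_hit (hreg : IsRegularRequests P T)
    (hci : CondIndepRequests P T) (k : ℕ) :
    ∫⁻ ω, ENNReal.ofReal (hit T π k ω) ∂P =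
      ∫⁻ ω, ∑ i, ∑' c, countInd k (T i c ω, trunc (T i c ω) (conf T ω)) *
        policyInd π k i (T i c ω, trunc (T i c ω) (conf T ω)) ∂P := by
  refine lintegral_congr_ae ?_
  filter_upwards [hci.ae_goodConf hreg] with ω hω
  have h := hω.sum_tsum_totalCount (fun i c =>
    policyInd π k i (T i c ω, trunc (T i c ω) (conf T ω))) k
  rw [ofReal_hit]
  simp only [countInd, totalCount_trunc, ite_mul, one_mul, zero_mul]
  refine Eq.trans ?_ h.symm
  have he : T (requested (canon n) k (conf T ω))
      (counts (canon n) k (conf T ω) (requested (canon n) k (conf T ω))) ω =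
      epoch (canon n) k (conf T ω) := rfl
  rw [he]
  unfold policyInd
  simp only [hω.record_trunc rfl]

end Policy

section HRVC

variable (ord : DecreasingOrder n)

/-- The conditional probability, given the requests, that the request with index `k` is a hit
under HR-VC. -/
def IsRegularRequests.hrvcProb (hreg : IsRegularRequests P T) (s : Fin n → ℝ) (B : ℝ)
    (ord : DecreasingOrder n) (k : ℕ) (τ : Conf n) : ENNReal :=
  hreg.hrvc s B ord (requested (canon n) k τ) (epoch (canon n) k τ, τ)

theorem IsRegularRequests.hrvcProb_le_one (hreg : IsRegularRequests P T) (s : Fin n → ℝ) (B : ℝ)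
    (ord : DecreasingOrder n) (k : ℕ) (τ : Conf n) : hreg.hrvcProb s B ord k τ ≤ 1 :=
  hrFrac_le_one ord _ _

theorem IsRegularRequests.measurable_hrvcProb (hreg : IsRegularRequests P T) (s : Fin n → ℝ)
    (B : ℝ) (ord : DecreasingOrder n) (k : ℕ) : Measurable (hreg.hrvcProb s B ord k) := by
  exact measurable_apply_fin (hreg.measurable_hrvc s B ord) (measurable_requested k)
    ((measurable_epoch k).prodMk measurable_id)

theorem CondIndepRequests.lintegral_hrvcProb (hreg : IsRegularRequests P T)
    (hci : CondIndepRequests P T) (k : ℕ) :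
    ∫⁻ ω, hreg.hrvcProb s B ord k (conf T ω) ∂P =
      ∫⁻ ω, ∑ i, ∑' c, countInd k (T i c ω, trunc (T i c ω) (conf T ω)) *
        hreg.hrvc s B ord i (T i c ω, trunc (T i c ω) (conf T ω)) ∂P := by
  refine lintegral_congr_ae ?_
  filter_upwards [hci.ae_goodConf hreg] with ω hω
  have h := hω.sum_tsum_totalCount (fun i c =>
    hreg.hrvc s B ord i (T i c ω, trunc (T i c ω) (conf T ω))) k
  simp only [countInd, totalCount_trunc, ite_mul, one_mul, zero_mul]
  refine Eq.trans ?_ h.symm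
  rw [hreg.hrvc_trunc]
  rfl

/-- The set of outcomes and seeds for which the request with index `k` is a hit under HR-VC, written
with the measurable version of the hazard rates. -/
def IsRegularRequests.hrvcSet (hreg : IsRegularRequests P T) (s : Fin n → ℝ) (B : ℝ)
    (ord : DecreasingOrder n) (k : ℕ) : Set (Ω × Seeds) :=
  {z | GreedyCached s B (ord.perm (z.2 k).1 fun j =>
    hreg.hazard j (epoch (canon n) k (conf T z.1), conf T z.1) / s j) (z.2 k).2
      (requested (canon n) k (conf T z.1))}

theorem IsRegularRequests.measurableSet_hrvcSet (hreg : IsRegularRequests P T) (k : ℕ) :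
    MeasurableSet (hreg.hrvcSet s B ord k) := by
  have hcf := conf_measurable hreg.measurable
  have h1 : Measurable fun z : Ω × Seeds => ((fun j : Fin n =>
      hreg.hazard j (epoch (canon n) k (conf T z.1), conf T z.1) / s j), z.2 k) := by
    refine Measurable.prodMk (measurable_pi_lambda _ fun j => ?_)
      ((measurable_pi_apply k).comp measurable_snd)
    exact (((hreg.measurable_hazard j).comp (((measurable_epoch k).prodMk measurable_id).comp
      hcf)).comp measurable_fst).div_const _
  have e : hreg.hrvcSet s B ord k = ⋃ i, {z | requested (canon n) k (conf T z.1) = i} ∩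
      (fun z : Ω × Seeds => ((fun j : Fin n =>
        hreg.hazard j (epoch (canon n) k (conf T z.1), conf T z.1) / s j), z.2 k)) ⁻¹'
        {x | GreedyCached s B (ord.perm x.2.1 x.1) x.2.2 i} := by
    ext z; simp [IsRegularRequests.hrvcSet]
  rw [e]
  exact MeasurableSet.iUnion fun i =>
    (((measurable_requested k).comp (hcf.comp measurable_fst)) (measurableSet_singleton i)).inter
      (h1 (measurableSet_greedyCached ord i))

instance : IsProbabilityMeasure (withSeeds P) := by unfold withSeeds; infer_instance

/-- The hazard rates agree almost surely with their jointly measurable versions, and so do the hits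
of HR-VC. -/
theorem IsRegularRequests.hrvcHit_ae (hreg : IsRegularRequests P T) (k : ℕ) :
    hrvcHit P T s B ord k =ᵐ[withSeeds P] (hreg.hrvcSet s B ord k).indicator fun _ => 1 := by
  filter_upwards [Measure.quasiMeasurePreserving_fst.ae hreg.ae_hazard_eq] with z hz
  have e : (fun i => hazardRate P T i (epoch T k z.1) z.1 / s i) = fun j =>
      hreg.hazard j (epoch (canon n) k (conf T z.1), conf T z.1) / s j := by
    ext i; rw [hz, epoch_conf]
  simp only [hrvcHit, indicator, IsRegularRequests.hrvcSet, mem_ofPred_eq]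
  rw [e, requested_conf T]
  congr

theorem IsRegularRequests.integrable_hrvcHit (hreg : IsRegularRequests P T) (k : ℕ) :
    Integrable (hrvcHit P T s B ord k) (withSeeds P) :=
  ((integrable_const (1 : ℝ)).indicator (hreg.measurableSet_hrvcSet ord k)).congr
    (hreg.hrvcHit_ae ord k).symm

theorem IsRegularRequests.integral_hrvcHit (hreg : IsRegularRequests P T) (k : ℕ) :
    ∫ z, hrvcHit P T s B ord k z ∂(withSeeds P) =
      (∫⁻ ω, hreg.hrvcProb s B ord k (conf T ω) ∂P).toReal := by
  have hm := hreg.measurableSet_hrvcSet (s := s) (B := B) ord k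
  rw [integral_congr_ae (hreg.hrvcHit_ae ord k), integral_indicator_const _ hm, smul_eq_mul,
    mul_one, measureReal_def]
  congr 1
  rw [withSeeds, Measure.prod_apply hm]
  refine lintegral_congr fun ω => ?_
  have hA : MeasurableSet {x : unitInterval × unitInterval |
      GreedyCached s B (ord.perm x.1 fun j =>
        hreg.hazard j (epoch (canon n) k (conf T ω), conf T ω) / s j) x.2
        (requested (canon n) k (conf T ω))} :=
    measurable_prodMk_left (measurableSet_greedyCached ord _)
  exact (measurePreserving_eval_infinitePi
    (fun _ : ℕ => (volume : Measure (unitInterval × unitInterval))) k).measure_preimage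
      hA.nullMeasurableSet

theorem integral_hit_le_hrvcHit (hreg : IsRegularRequests P T) (hci : CondIndepRequests P T)
    (hs : ∀ i, 0 < s i) (hB : 0 ≤ B) (π : ICPolicy s B) (k : ℕ) :
    ∫ ω, hit T π k ω ∂P ≤ ∫ z, hrvcHit P T s B ord k z ∂(withSeeds P) := by
  rw [hreg.integral_hrvcHit, integral_eq_lintegral_of_nonneg_ae
    (Eventually.of_forall (hit_nonneg π T k))
    (measurable_hit π hreg.measurable k).aestronglyMeasurable]
  refine ENNReal.toReal_mono ?_ ?_
  · refine ne_top_of_le_ne_top (b := 1) (by simp) ?_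
    refine (lintegral_mono fun ω => hreg.hrvcProb_le_one s B ord k _).trans ?_
    simp
  · rw [hci.lintegral_hit π hreg k, hci.lintegral_hrvcProb ord hreg k]
    exact hci.lintegral_policy_le_hrvc hreg hs hB ord (measurable_countInd k)
      (fun i => measurable_policyInd π k i) (policyInd_le_one π k)
      (sum_size_mul_policyInd_le π hs k)

theorem integral_numHits (hT : ∀ i k, Measurable (T i k)) (π : ICPolicy s B) (K : ℕ) :
    ∫ ω, numHits T π K ω ∂P = ∑ k ∈ Finset.range K, ∫ ω, hit T π k ω ∂P :=
  integral_finsetSum _ fun k _ => integrable_hit π hT k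

theorem integral_hrvcNumHits (hreg : IsRegularRequests P T) (K : ℕ) :
    ∫ z, hrvcNumHits P T s B ord K z ∂(withSeeds P) =
      ∑ k ∈ Finset.range K, ∫ z, hrvcHit P T s B ord k z ∂(withSeeds P) :=
  integral_finsetSum _ fun k _ => hreg.integrable_hrvcHit ord k

theorem IsRegularRequests.integral_hrvcHit_le_one (hreg : IsRegularRequests P T) (k : ℕ) :
    ∫ z, hrvcHit P T s B ord k z ∂(withSeeds P) ≤ 1 := by
  rw [hreg.integral_hrvcHit]
  refine ENNReal.toReal_le_of_le_ofReal zero_le_one ?_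
  refine (lintegral_mono fun ω => hreg.hrvcProb_le_one s B ord k _).trans ?_
  simp

theorem integral_numHits_le (hreg : IsRegularRequests P T) (hci : CondIndepRequests P T)
    (hs : ∀ i, 0 < s i) (hB : 0 ≤ B) (π : ICPolicy s B) (K : ℕ) :
    ∫ ω, numHits T π K ω ∂P ≤ ∫ z, hrvcNumHits P T s B ord K z ∂(withSeeds P) := by
  rw [integral_numHits hreg.measurable, integral_hrvcNumHits ord hreg]
  exact Finset.sum_le_sum fun k _ => integral_hit_le_hrvcHit ord hreg hci hs hB π k

/-- By dominated convergence, the hit probability is the limit of the expected fraction of hits. -/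
theorem HasHitProbability.tendsto_integral (hT : ∀ i k, Measurable (T i k)) {π : ICPolicy s B}
    {h : ℝ} (hh : HasHitProbability P T π h) :
    Tendsto (fun K : ℕ => (∫ ω, numHits T π K ω ∂P) / K) atTop (𝓝 h) := by
  have hm : ∀ K, Measurable (numHits T π K) := fun K =>
    Finset.measurable_sum _ fun k _ => measurable_hit π hT k
  have h1 : Tendsto (fun K : ℕ => ∫ ω, numHits T π K ω / K ∂P) atTop (𝓝 (∫ _, h ∂P)) := by
    refine tendsto_integral_of_dominated_convergence (fun _ => 1)
      (fun K => ((hm K).div_const _).aestronglyMeasurable) (integrable_const _)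
      (fun K => Eventually.of_forall fun ω => ?_) hh
    have h0 : 0 ≤ numHits T π K ω := Finset.sum_nonneg fun k _ => hit_nonneg π T k ω
    rw [Real.norm_eq_abs, abs_of_nonneg (div_nonneg h0 (Nat.cast_nonneg K))]
    refine div_le_one_of_le₀ ?_ (Nat.cast_nonneg K)
    refine (Finset.sum_le_sum fun k _ => hit_le_one π T k ω).trans ?_
    simp
  simp only [integral_const, probReal_univ, smul_eq_mul, one_mul] at h1
  simpa only [integral_div] using h1

theorem le_liminf_hrvcNumHits (hreg : IsRegularRequests P T) (hci : CondIndepRequests P T)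
    (hs : ∀ i, 0 < s i) (hB : 0 ≤ B) {π : ICPolicy s B} {h : ℝ}
    (hh : HasHitProbability P T π h) :
    h ≤ liminf (fun K : ℕ => (∫ z, hrvcNumHits P T s B ord K z ∂(withSeeds P)) / K) atTop := by
  have h1 := hh.tendsto_integral hreg.measurable
  rw [← h1.liminf_eq]
  refine liminf_le_liminf (Eventually.of_forall fun K => ?_) h1.isBoundedUnder_ge ?_
  · exact div_le_div_of_nonneg_right
      (integral_numHits_le ord hreg hci hs hB π K) (Nat.cast_nonneg K)
  · refine IsBoundedUnder.isCoboundedUnder_ge ⟨1, ?_⟩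
    rw [eventually_map]
    refine Eventually.of_forall fun K => div_le_one_of_le₀ ?_ (Nat.cast_nonneg K)
    rw [integral_hrvcNumHits ord hreg]
    refine (Finset.sum_le_sum fun k _ => hreg.integral_hrvcHit_le_one ord k).trans ?_
    simp

end HRVC

end

section

/-! ### Independent objects -/

/-- Conditional probabilities of events from independent sigma-algebras, given sub-sigma-algebras,
multiply. -/
theorem condExp_iInter_indicator_of_iIndep {Ω ι : Type*} [Fintype ι] {mΩ : MeasurableSpace Ω}
    {P : Measure Ω} [IsProbabilityMeasure P] {m F : ι → MeasurableSpace Ω} (hmF : ∀ i, m i ≤ F i)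
    (hF : ∀ i, F i ≤ mΩ) (hind : iIndep F P) {E : ι → Set Ω}
    (hE : ∀ i, MeasurableSet[F i] (E i)) :
    P⟦⋂ i, E i | ⨆ i, m i⟧ =ᵐ[P] fun ω => ∏ i, (P⟦E i | m i⟧) ω := by
  classical
  have hm : ∀ i, m i ≤ mΩ := fun i => (hmF i).trans (hF i)
  have hEm : ∀ i, MeasurableSet (E i) := fun i => hF i _ (hE i)
  have hsup : ⨆ i, m i ≤ mΩ := iSup_le hm
  have hEI : MeasurableSet (⋂ i, E i) := MeasurableSet.iInter hEm
  have hint : Integrable ((⋂ i, E i).indicator fun _ => (1 : ℝ)) P :=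
    (integrable_const 1).indicator hEI
  have hmeas : ∀ i, StronglyMeasurable[m i] (P⟦E i | m i⟧) := fun i => stronglyMeasurable_condExp
  have hmeas' : StronglyMeasurable[⨆ i, m i] fun ω => ∏ i, (P⟦E i | m i⟧) ω :=
    Finset.stronglyMeasurable_fun_prod _ fun i _ => (hmeas i).mono (le_iSup m i)
  have hb : ∀ i, ∀ᵐ ω ∂P, |(P⟦E i | m i⟧) ω| ≤ 1 := fun i => by
    refine ae_bdd_abs_condExp_of_ae_bdd_abs (R := 1) (Eventually.of_forall fun ω => ?_)
    by_cases h : ω ∈ E i <;> simp [h]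
  have hgint : Integrable (fun ω => ∏ i, (P⟦E i | m i⟧) ω) P := by
    refine Integrable.of_bound (hmeas'.mono hsup).aestronglyMeasurable 1 ?_
    filter_upwards [ae_all_iff.2 hb] with ω hω
    rw [Real.norm_eq_abs, Finset.abs_prod]
    exact Finset.prod_le_one (fun i _ => abs_nonneg _) fun i _ => hω i
  -- the two set integrals agree on the intersections of events, one from each `m i`
  have key : ∀ A : ι → Set Ω, (∀ i, MeasurableSet[m i] (A i)) →
      ∫ ω in ⋂ i, A i, ∏ i, (P⟦E i | m i⟧) ω ∂P =
        ∫ ω in ⋂ i, A i, (⋂ i, E i).indicator (fun _ => (1 : ℝ)) ω ∂P := by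
    intro A hA
    have hAm : ∀ i, MeasurableSet (A i) := fun i => hm i _ (hA i)
    rw [← integral_indicator (MeasurableSet.iInter hAm)]
    have e1 : (⋂ i, A i).indicator (fun ω => ∏ i, (P⟦E i | m i⟧) ω) =
        fun ω => ∏ i, (A i).indicator (P⟦E i | m i⟧) ω := by
      ext ω
      by_cases h : ∀ i, ω ∈ A i
      · rw [indicator_of_mem (mem_iInter.2 h)]
        exact Finset.prod_congr rfl fun i _ => (indicator_of_mem (h i) _).symm
      · rw [indicator_of_notMem (fun h' => h (mem_iInter.1 h'))]
        push Not at h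
        obtain ⟨i, hi⟩ := h
        exact (Finset.prod_eq_zero (Finset.mem_univ i) (indicator_of_notMem hi _)).symm
    have hfun : iIndepFun (fun i => (A i).indicator (P⟦E i | m i⟧)) P := by
      rw [iIndepFun_iff_iIndep]
      refine iIndep_of_iIndep_of_le hind fun i => ?_
      refine Measurable.comap_le ?_
      exact ((hmeas i).mono (hmF i)).measurable.indicator (hmF i _ (hA i))
    rw [e1, hfun.integral_fun_prod_eq_prod_integral fun i =>
      (((hmeas i).mono (hm i)).indicator (hAm i)).aestronglyMeasurable]
    have e2 : ∀ i, ∫ ω, (A i).indicator (P⟦E i | m i⟧) ω ∂P = P.real (A i ∩ E i) := fun i => by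
      rw [integral_indicator (hAm i), setIntegral_condExp (hm i)
        ((integrable_const 1).indicator (hEm i)) (hA i), setIntegral_indicator (hEm i)]
      simp
    simp only [e2]
    rw [setIntegral_indicator hEI, setIntegral_const, smul_eq_mul, mul_one, ← iInter_inter_distrib]
    simp only [measureReal_def]
    rw [hind.meas_iInter fun i => (hmF i _ (hA i)).inter (hE i), ENNReal.toReal_prod]
  have hpi := isPiSystem_piiUnionInter (fun i => {s : Set Ω | MeasurableSet[m i] s})
    (fun i => @MeasurableSpace.isPiSystem_measurableSet Ω (m i)) univ
  have hgen : ⨆ i, m i =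
      MeasurableSpace.generateFrom
        (piiUnionInter (fun i => {s : Set Ω | MeasurableSet[m i] s}) univ) := by
    have h := generateFrom_piiUnionInter_measurableSet m univ
    simp only [mem_univ, iSup_pos] at h
    exact h.symm
  have htot := key (fun _ => univ) fun i => MeasurableSet.univ
  simp only [iInter_univ, setIntegral_univ] at htot
  refine (ae_eq_condExp_of_forall_setIntegral_eq hsup hint (fun s _ _ => hgint.integrableOn)
    (fun s hs _ => ?_) hmeas'.aestronglyMeasurable).symm
  induction s, hs using MeasurableSpace.induction_on_inter hgen hpi with
  | empty => simp
  | basic s hs =>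
    obtain ⟨t, -, f, hf, rfl⟩ := hs
    have e : ⋂ i ∈ t, f i = ⋂ i, if i ∈ t then f i else univ := by
      ext ω
      simp only [mem_iInter]
      refine forall_congr' fun i => ?_
      by_cases h : i ∈ t <;> simp [h]
    rw [e]
    refine key _ fun i => ?_
    split_ifs with h
    · exact hf i h
    · exact MeasurableSet.univ
  | compl s hs ih =>
    have h1 := integral_add_compl (hsup s hs) hgint
    have h2 := integral_add_compl (hsup s hs) hint
    have := ih (measure_lt_top _ _)
    linarith
  | iUnion f hd hfm ih =>
    rw [integral_iUnion (fun i => hsup _ (hfm i)) hd hgint.integrableOn,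
      integral_iUnion (fun i => hsup _ (hfm i)) hd hint.integrableOn]
    exact tsum_congr fun i => ih i (measure_lt_top _ _)

variable {Ω : Type*} {n : ℕ} [MeasurableSpace Ω] {P : Measure Ω} [IsProbabilityMeasure P]

/-- Independent request processes are conditionally independent given the history. -/
theorem condIndepRequests_of_iIndepFun {T : Fin n → ℕ → Ω → ℝ} (hT : ∀ i k, Measurable (T i k))
    (hind : iIndepFun (fun i ω k => T i k ω) P) : CondIndepRequests P T := by
  intro t _ r _
  have h := condExp_iInter_indicator_of_iIndep (P := P) (m := fun i => objHistory T i t)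
    (F := fun i => MeasurableSpace.comap (fun ω k => T i k ω) inferInstance)
    (E := fun i => {ω | r i ≤ nextRequest T i t ω}) ?_ ?_ hind.iIndep ?_
  · rw [ofPred_forall]
    exact h
  · intro i
    rw [objHistory_eq_comap]
    rintro _ ⟨A, hA, rfl⟩
    refine ⟨(fun x k => min (x k) t) ⁻¹' A, ?_, rfl⟩
    exact (measurable_pi_lambda _ fun k => (measurable_pi_apply k).min measurable_const) hA
  · intro i
    exact (measurable_pi_lambda _ fun k => hT i k).comap_le
  · intro i
    refine ⟨{x | r i ≤ x (sInf {k | t ≤ x k})}, ?_, rfl⟩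
    refine measurableSet_le measurable_const ?_
    exact measurable_apply_nat (F := fun k (x : ℕ → ℝ) => x k) (fun k => measurable_pi_apply k)
      (measurable_sInf_nat fun k => measurableSet_le measurable_const (measurable_pi_apply k))

theorem IsStationaryErgodic.condIndep {T : Fin n → ℤ → Ω → ℝ} (hst : IsStationaryErgodic P T) :
    CondIndepRequests P (positivePart T) := by
  refine condIndepRequests_of_iIndepFun (fun i k => hst.measurable i _) ?_
  exact hst.indep.comp (fun _ (x : ℤ → ℝ) (k : ℕ) => x (k + 1)) fun _ =>
    measurable_pi_lambda _ fun k => measurable_pi_apply _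

end

section

/-! ### Shifts of time -/

/-- The supremum of a set of integers without greatest element is `0`. -/
theorem int_sSup_eq_iff {S : Set ℤ} {m : ℤ} :
    sSup S = m ↔ IsGreatest S m ∨ (m = 0 ∧ ∀ k, ¬ IsGreatest S k) := by
  by_cases h : S.Nonempty ∧ BddAbove S
  · have hg : IsGreatest S (sSup S) := ⟨Int.csSup_mem h.1 h.2, fun k hk => le_csSup h.2 hk⟩
    constructor
    · rintro rfl; exact Or.inl hg
    · rintro (h' | h')
      · exact hg.unique h'
      · exact absurd hg (h'.2 _)
  · have h0 : sSup S = 0 := by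
      rcases not_and_or.1 h with h | h
      · rw [not_nonempty_iff_eq_empty.1 h, Int.csSup_empty]
      · exact Int.csSup_of_not_bddAbove h
    have hn : ∀ k, ¬ IsGreatest S k := fun k hk => h ⟨⟨k, hk.1⟩, ⟨k, hk.2⟩⟩
    rw [h0]
    constructor
    · rintro rfl; exact Or.inr ⟨rfl, hn⟩
    · rintro (h' | h')
      · exact absurd h' (hn m)
      · exact h'.1.symm

theorem measurable_timeShift (t : ℝ) : Measurable (timeShift t) := by
  have hg : ∀ m : ℤ, MeasurableSet {x : ℤ → ℝ | IsGreatest {j : ℤ | x j ≤ t} m} := by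
    intro m
    have e : {x : ℤ → ℝ | IsGreatest {j : ℤ | x j ≤ t} m} =
        {x | x m ≤ t} ∩ ⋂ j, ⋂ (_ : m < j), {x | x j ≤ t}ᶜ := by
      ext x
      simp only [mem_inter_iff, mem_iInter, mem_compl_iff, IsGreatest, upperBounds, mem_ofPred_eq]
      refine and_congr_right fun _ => forall_congr' fun j => ?_
      rw [← not_le, not_imp_not]
    have hle : ∀ j : ℤ, MeasurableSet {x : ℤ → ℝ | x j ≤ t} := fun j =>
      measurableSet_le (measurable_pi_apply j) measurable_const
    rw [e]
    exact (hle m).inter (MeasurableSet.iInter fun j => MeasurableSet.iInter fun _ => (hle j).compl)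
  have hs : Measurable fun x : ℤ → ℝ => sSup {j : ℤ | x j ≤ t} := by
    refine measurable_to_countable' fun m => ?_
    have e : (fun x : ℤ → ℝ => sSup {j : ℤ | x j ≤ t}) ⁻¹' {m} =
        {x | IsGreatest {j : ℤ | x j ≤ t} m} ∪
          ({_x | m = 0} ∩ ⋂ k, {x | IsGreatest {j : ℤ | x j ≤ t} k}ᶜ) := by
      ext x
      simp [int_sSup_eq_iff]
    rw [e]
    exact (hg m).union ((MeasurableSet.const _).inter (MeasurableSet.iInter fun k => (hg k).compl))
  refine measurable_pi_lambda _ fun k => Measurable.sub_const ?_ t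
  have h : Measurable fun q : ℤ × (ℤ → ℝ) => q.2 (k + q.1) :=
    measurable_from_prod_countable_right fun j => measurable_pi_apply (k + j)
  exact h.comp (hs.prodMk measurable_id)

/-- The sequence of points after time `t`, seen from time `t`. -/
def shiftSeq (t : ℝ) (y : ℕ → ℝ) : ℕ → ℝ := fun k => y (k + sInf {c | t < y c}) - t

theorem measurable_shiftSeq (t : ℝ) : Measurable (shiftSeq t) := by
  have hs : Measurable fun y : ℕ → ℝ => sInf {c | t < y c} :=
    measurable_sInf_nat fun c => measurableSet_lt measurable_const (measurable_pi_apply c)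
  exact measurable_pi_lambda _ fun k => (measurable_apply_nat (F := fun m (y : ℕ → ℝ) => y (k + m))
    (fun m => measurable_pi_apply _) hs).sub_const t

theorem shiftSeq_min {t r : ℝ} (h : t < r) (y : ℕ → ℝ) :
    shiftSeq t (fun k => min (y k) r) = fun k => min (shiftSeq t y k) (r - t) := by
  ext k
  simp only [shiftSeq, lt_min_iff, h, and_true, min_sub_sub_right]

/-- A configuration of points, good in the sense that it is strictly increasing and locally finite,
and that `x 0` is the last point in `(-∞, 0]`. -/
structure GoodPath (x : ℤ → ℝ) : Prop where
  zero_nonpos : x 0 ≤ 0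
  one_pos : 0 < x 1
  strictMono : StrictMono x
  tendsto_atTop : Tendsto x atTop atTop

theorem GoodPath.goodSeq {x : ℤ → ℝ} (hx : GoodPath x) : GoodSeq fun k : ℕ => x (k + 1) := by
  refine ⟨by simpa using hx.one_pos,
    fun a b hab => hx.strictMono (by exact_mod_cast Nat.succ_lt_succ hab), ?_⟩
  exact hx.tendsto_atTop.comp (tendsto_atTop_add_const_right _ _ tendsto_natCast_atTop_atTop)

theorem GoodSeq.sInf_spec {y : ℕ → ℝ} (hy : GoodSeq y) (t : ℝ) (c : ℕ) :
    t < y c ↔ sInf {c | t < y c} ≤ c := by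
  constructor
  · exact fun h => Nat.sInf_le h
  · intro h
    have hne : {c | t < y c}.Nonempty := (hy.2.2.eventually_gt_atTop t).exists
    exact lt_of_lt_of_le (Nat.sInf_mem hne) (hy.2.1.monotone h)

/-- Shifting a two-sided configuration forward shifts its sequence of positive points. -/
theorem GoodPath.timeShift_succ {x : ℤ → ℝ} (hx : GoodPath x) {t : ℝ} (ht : 0 ≤ t) :
    (fun k : ℕ => timeShift t x (k + 1)) = shiftSeq t fun k : ℕ => x (k + 1) := by
  have key : sSup {j : ℤ | x j ≤ t} = (sInf {c : ℕ | t < x (c + 1)} : ℕ) := by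
    refine int_sSup_eq_iff.2 (Or.inl ⟨?_, fun j hj => ?_⟩)
    · change x _ ≤ t
      rcases Nat.eq_zero_or_pos (sInf {c : ℕ | t < x (c + 1)}) with h | h
      · rw [h]; exact hx.zero_nonpos.trans ht
      · obtain ⟨m, hm⟩ := Nat.exists_eq_succ_of_ne_zero h.ne'
        have : ¬ t < x ((m : ℤ) + 1) := fun hlt => by
          have := (hx.goodSeq.sInf_spec t m).1 hlt
          omega
        rw [hm]
        exact_mod_cast not_lt.1 this
    · by_contra hlt
      rw [not_le] at hlt
      have h1 := (hx.goodSeq.sInf_spec t _).2 le_rfl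
      have h2 := h1.trans_le (hx.strictMono.monotone (show
        ((sInf {c : ℕ | t < x (c + 1)} : ℕ) : ℤ) + 1 ≤ j by omega))
      exact absurd hj (not_le.2 h2)
  ext k
  simp only [timeShift, shiftSeq, key]
  push_cast
  congr 2
  ring

/-- A sum over the points after time `t` is a sum over the points of the shifted sequence. -/
theorem GoodSeq.tsum_shiftSeq {y : ℕ → ℝ} (hy : GoodSeq y) (t : ℝ) (g : ℝ → ENNReal) :
    ∑' c, (Ioi t).indicator g (y c) = ∑' k, g (shiftSeq t y k + t) := by
  rw [← (add_left_injective (sInf {c | t < y c})).tsum_eq]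
  · refine tsum_congr fun k => ?_
    rw [indicator_of_mem, shiftSeq, sub_add_cancel]
    exact (hy.sInf_spec t _).2 (Nat.le_add_left _ _)
  · intro c hc
    rw [Function.mem_support] at hc
    have h1 : t < y c := by
      by_contra h
      exact hc (indicator_of_notMem (fun h' => h h') _)
    exact ⟨c - sInf {c | t < y c}, Nat.sub_add_cancel ((hy.sInf_spec t c).1 h1)⟩

section Conf

variable {n : ℕ}

/-- The requests after time `t`, seen from time `t`. -/
def shiftConf (t : ℝ) (τ : Conf n) : Conf n := fun i => shiftSeq t (τ i)

theorem measurable_shiftConf (t : ℝ) : Measurable (shiftConf t : Conf n → Conf n) :=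
  measurable_pi_lambda _ fun i => (measurable_shiftSeq t).comp (measurable_pi_apply i)

theorem shiftConf_trunc {t r : ℝ} (h : t < r) (τ : Conf n) :
    shiftConf t (trunc r τ) = trunc (r - t) (shiftConf t τ) :=
  funext fun i => shiftSeq_min h (τ i)

end Conf

section Stationary

variable {Ω : Type*} {n : ℕ} [MeasurableSpace Ω] {P : Measure Ω} [IsProbabilityMeasure P]
  {T : Fin n → ℤ → Ω → ℝ}

theorem IsStationaryErgodic.measurable_path (hst : IsStationaryErgodic P T) (i : Fin n) :
    Measurable fun ω k => T i k ω :=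
  measurable_pi_lambda _ fun k => hst.measurable i k

theorem IsStationaryErgodic.ae_goodPath (hst : IsStationaryErgodic P T) :
    ∀ᵐ ω ∂P, ∀ i, GoodPath fun k => T i k ω :=
  ae_all_iff.2 fun i => by
    filter_upwards [hst.points i] with ω hω using ⟨hω.1, hω.2.1, hω.2.2.1, hω.2.2.2.1⟩

theorem IsStationaryErgodic.measurePreserving_timeShift (hst : IsStationaryErgodic P T) (i : Fin n)
    (t : ℝ) : MeasurePreserving (timeShift t) (P.map fun ω k => T i k ω)
      (P.map fun ω k => T i k ω) := by
  refine ⟨measurable_timeShift t, ?_⟩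
  rw [Measure.map_map (measurable_timeShift t) (hst.measurable_path i)]
  exact hst.stationary i t

/-- By independence, the superposed requests are stationary: the requests after time `t`, seen from
time `t`, have the same joint law as the requests after time `0`. -/
theorem IsStationaryErgodic.lintegral_shiftConf (hst : IsStationaryErgodic P T) {t : ℝ}
    (ht : 0 ≤ t) {G : Conf n → ENNReal} (hG : Measurable G) :
    ∫⁻ ω, G (shiftConf t (conf (positivePart T) ω)) ∂P =
      ∫⁻ ω, G (conf (positivePart T) ω) ∂P := by
  have hpath : Measurable fun ω i k => T i k ω := measurable_pi_lambda _ hst.measurable_path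
  have hlaw : P.map (fun ω i k => T i k ω) = Measure.pi fun i => P.map fun ω k => T i k ω :=
    (iIndepFun_iff_map_fun_eq_pi_map fun i => (hst.measurable_path i).aemeasurable).1 hst.indep
  have : ∀ i, IsProbabilityMeasure (P.map fun ω k => T i k ω) := fun i =>
    Measure.isProbabilityMeasure_map (hst.measurable_path i).aemeasurable
  have hpres : MeasurePreserving (fun (x : Fin n → ℤ → ℝ) i => timeShift t (x i))
      (P.map fun ω i k => T i k ω) (P.map fun ω i k => T i k ω) := by
    rw [hlaw]
    exact measurePreserving_pi _ _ fun i => hst.measurePreserving_timeShift i t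
  let pos : (Fin n → ℤ → ℝ) → Conf n := fun x i k => x i (k + 1)
  have hpos : Measurable pos := measurable_pi_lambda _ fun i => measurable_pi_lambda _ fun k =>
    (measurable_pi_apply ((k : ℤ) + 1)).comp (measurable_pi_apply i)
  have h1 := hpres.lintegral_comp (hG.comp hpos)
  rw [lintegral_map (f := fun x => (G ∘ pos) fun i => timeShift t (x i))
    ((hG.comp hpos).comp hpres.measurable) hpath, lintegral_map (hG.comp hpos) hpath] at h1
  refine Eq.trans ?_ h1
  refine lintegral_congr_ae ?_
  filter_upwards [hst.ae_goodPath] with ω hω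
  simp only [Function.comp_apply]
  congr 1
  funext i
  exact ((hω i).timeShift_succ ht).symm

end Stationary

end

section

/-! ### Superadditivity of the expected number of hits -/

variable {Ω : Type*} {n : ℕ} [MeasurableSpace Ω] {P : Measure Ω}
  [IsProbabilityMeasure P] {s : Fin n → ℝ} {B : ℝ} (ord : DecreasingOrder n)

section OneSided

variable {T : Fin n → ℕ → Ω → ℝ}

/-- The number of HR-VC hits in `(0, m]` in a given configuration, averaged over the
randomization. -/
def IsRegularRequests.hrvcHitsUpTo (hreg : IsRegularRequests P T) (s : Fin n → ℝ) (B : ℝ)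
    (ord : DecreasingOrder n) (m : ℝ) (τ : Conf n) : ENNReal :=
  ∑ i, ∑' c, (Iic m).indicator 1 (τ i c) * hreg.hrvc s B ord i (τ i c, trunc (τ i c) τ)

theorem IsRegularRequests.measurable_hrvcHitsUpTo (hreg : IsRegularRequests P T) (m : ℝ) :
    Measurable (hreg.hrvcHitsUpTo s B ord m) := by
  refine Finset.measurable_sum _ fun i _ => Measurable.tsum fun c => ?_
  have hc : Measurable fun τ : Conf n => τ i c := measurable_canon n i c
  refine Measurable.mul ?_ ?_
  · exact (measurable_one.indicator measurableSet_Iic).comp hc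
  · exact (hreg.measurable_hrvc s B ord i).comp
      (hc.prodMk ((measurable_trunc n).comp (hc.prodMk measurable_id)))

end OneSided

variable {T : Fin n → ℤ → Ω → ℝ}

/-- HR-VC does at least as well on `(0, m + l]` as the rule that follows HR-VC up to time `m` and
then restarts it, forgetting the requests made so far. -/
theorem IsStationaryErgodic.hrvcHitsUpTo_superadditive (hst : IsStationaryErgodic P T)
    (hs : ∀ i, 0 < s i) (hB : 0 ≤ B) {m l : ℝ} (hm : 0 ≤ m) (hl : 0 ≤ l) :
    ∫⁻ ω, hst.regular.hrvcHitsUpTo s B ord m (conf (positivePart T) ω) ∂P +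
        ∫⁻ ω, hst.regular.hrvcHitsUpTo s B ord l (conf (positivePart T) ω) ∂P ≤
      ∫⁻ ω, hst.regular.hrvcHitsUpTo s B ord (m + l) (conf (positivePart T) ω) ∂P := by
  have hmeas := fun m => hst.regular.measurable_hrvcHitsUpTo (s := s) (B := B) ord m
  have hcf : Measurable (conf (positivePart T)) := conf_measurable hst.regular.measurable
  rw [← hst.lintegral_shiftConf hm (hmeas l), ← lintegral_add_left
    (f := fun ω => hst.regular.hrvcHitsUpTo s B ord m (conf (positivePart T) ω))
    ((hmeas m).comp hcf)]
  classical
  let y : Fin n → ℝ × Conf n → ENNReal := fun i x =>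
    if x.1 ≤ m then hst.regular.hrvc s B ord i x
    else hst.regular.hrvc s B ord i (x.1 - m, shiftConf m x.2)
  have hy : ∀ i, Measurable (y i) := fun i =>
    Measurable.ite (measurableSet_le measurable_fst measurable_const)
      (hst.regular.measurable_hrvc s B ord i)
      ((hst.regular.measurable_hrvc s B ord i).comp ((measurable_fst.sub_const m).prodMk
        ((measurable_shiftConf m).comp measurable_snd)))
  have hw : Measurable fun x : ℝ × Conf n => (Iic (m + l)).indicator (1 : ℝ → ENNReal) x.1 :=
    (measurable_one.indicator measurableSet_Iic).comp measurable_fst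
  have hle := hst.condIndep.lintegral_policy_le_hrvc hst.regular hs hB ord hw hy
    (fun i x => by
      dsimp only [y]; split_ifs
      · exact hrFrac_le_one ord _ _
      · exact hrFrac_le_one ord _ _)
    (fun x => by
      dsimp only [y]; split_ifs
      · exact sum_size_mul_hrFrac_le ord hs hB _
      · exact sum_size_mul_hrFrac_le ord hs hB _)
  refine le_trans (lintegral_mono_ae ?_) hle
  filter_upwards [hst.regular.ae_good] with ω hω
  refine le_of_eq ?_
  set τ := conf (positivePart T) ω with hτ
  have hterm : ∀ i, ∑' c, (Iic m).indicator 1 (τ i c) *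
        hst.regular.hrvc s B ord i (τ i c, trunc (τ i c) τ) +
      ∑' c, (Iic l).indicator 1 (shiftConf m τ i c) * hst.regular.hrvc s B ord i
        (shiftConf m τ i c, trunc (shiftConf m τ i c) (shiftConf m τ)) =
      ∑' c, (Iic (m + l)).indicator 1 (τ i c) * y i (τ i c, trunc (τ i c) τ) := by
    intro i
    have hg := (hω i).tsum_shiftSeq m fun r => (Iic (m + l)).indicator 1 r *
      hst.regular.hrvc s B ord i (r - m, trunc (r - m) (shiftConf m τ))
    simp only [add_sub_cancel_right] at hg
    have hI : ∀ r : ℝ, (Iic (m + l)).indicator (1 : ℝ → ENNReal) (r + m) = (Iic l).indicator 1 r :=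
      fun r => by
        by_cases h : r ≤ l
        · rw [indicator_of_mem (show r ∈ Iic l from h),
            indicator_of_mem (show r + m ∈ Iic (m + l) from by simp only [mem_Iic]; linarith)]
          rfl
        · rw [indicator_of_notMem (show r ∉ Iic l from h), indicator_of_notMem]
          simp only [mem_Iic]; push Not at h ⊢; linarith
    simp only [hI] at hg
    refine (congrArg _ hg.symm).trans ?_
    rw [← ENNReal.tsum_add]
    refine tsum_congr fun c => ?_
    change (Iic m).indicator 1 (τ i c) * _ + (Ioi m).indicator _ (τ i c) = _
    by_cases h : τ i c ≤ m
    · rw [indicator_of_notMem (show τ i c ∉ Ioi m from not_lt.2 h), add_zero,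
        indicator_of_mem (show τ i c ∈ Iic m from h)]
      rw [indicator_of_mem (show τ i c ∈ Iic (m + l) from h.trans (by linarith))]
      simp only [y, if_pos h]
    · rw [indicator_of_notMem (show τ i c ∉ Iic m from h), zero_mul, zero_add,
        indicator_of_mem (show τ i c ∈ Ioi m from not_le.1 h)]
      simp only [y, if_neg h, shiftConf_trunc (not_le.1 h)]
  change ∑ i, _ + ∑ i, _ = _
  rw [← Finset.sum_add_distrib]
  exact Finset.sum_congr rfl fun i _ => hterm i

end

section

/-! ### A mean ergodic theorem -/

section MeanErgodic

variable {X : Type*} [MeasurableSpace X] {ν : Measure X} {U : X → X}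

/-- Birkhoff averages of a square integrable function converge in `L²`. -/
theorem exists_tendsto_eLpNorm_two_birkhoffAverage (hU : MeasurePreserving U ν ν)
    {g : X → ℝ} (hg : MemLp g 2 ν) :
    ∃ l : X → ℝ, MemLp l 2 ν ∧
      Tendsto (fun m => eLpNorm (birkhoffAverage ℝ U g m - l) 2 ν) atTop (𝓝 0) := by
  let S : Lp ℝ 2 ν →ₗᵢ[ℝ] Lp ℝ 2 ν := Lp.compMeasurePreservingₗᵢ ℝ U hU
  obtain ⟨L, h⟩ : ∃ L, Tendsto
      (birkhoffAverage ℝ S.toContinuousLinearMap id · (hg.toLp g)) atTop (𝓝 L) :=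
    ⟨_, S.toContinuousLinearMap.tendsto_birkhoffAverage_orthogonalProjection
      S.norm_toContinuousLinearMap_le (hg.toLp g)⟩
  refine ⟨L, Lp.memLp L, ?_⟩
  have h2 := (Lp.tendsto_Lp_iff_tendsto_eLpNorm' _ _).1 h
  refine h2.congr fun m => eLpNorm_congr_ae (EventuallyEq.sub ?_ EventuallyEq.rfl)
  have hit : ∀ j, (S.toContinuousLinearMap)^[j] (hg.toLp g) =ᵐ[ν] g ∘ U^[j] := by
    intro j
    have e : (S.toContinuousLinearMap)^[j] (hg.toLp g) =
        Lp.compMeasurePreserving U^[j] (hU.iterate j) (hg.toLp g) := by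
      rw [← Lp.compMeasurePreserving_iterate]; rfl
    rw [e, Lp.toLp_compMeasurePreserving]
    exact MemLp.coeFn_toLp _
  have hsum : ∀ m, (birkhoffSum (S.toContinuousLinearMap) id m (hg.toLp g) : Lp ℝ 2 ν) =ᵐ[ν]
      birkhoffSum U g m := by
    intro m
    induction m with
    | zero => simpa using Lp.coeFn_zero ℝ 2 ν
    | succ m ih =>
      rw [birkhoffSum_succ]
      filter_upwards [Lp.coeFn_add (birkhoffSum (S.toContinuousLinearMap) id m (hg.toLp g))
        (id ((S.toContinuousLinearMap)^[m] (hg.toLp g))), ih, hit m] with x h1 h2 h3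
      rw [h1, Pi.add_apply, h2, birkhoffSum_succ, id, h3]
      rfl
  filter_upwards [Lp.coeFn_smul ((m : ℝ)⁻¹)
    (birkhoffSum (S.toContinuousLinearMap) id m (hg.toLp g)), hsum m] with x h1 h2
  rw [birkhoffAverage, h1, Pi.smul_apply, h2]
  rfl

theorem eLpNorm_one_birkhoffAverage_le (hU : MeasurePreserving U ν ν) {f : X → ℝ}
    (hf : AEStronglyMeasurable f ν) (m : ℕ) :
    eLpNorm (birkhoffAverage ℝ U f m) 1 ν ≤ eLpNorm f 1 ν := by
  have hj : ∀ j, AEStronglyMeasurable (f ∘ U^[j]) ν := fun j =>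
    hf.comp_measurePreserving (hU.iterate j)
  have e : birkhoffAverage ℝ U f m = (m : ℝ)⁻¹ • ∑ j ∈ Finset.range m, f ∘ U^[j] := by
    ext x; simp [birkhoffAverage, birkhoffSum]
  rw [e, eLpNorm_const_smul]
  have h1 : eLpNorm (∑ j ∈ Finset.range m, f ∘ U^[j]) 1 ν ≤ m * eLpNorm f 1 ν := by
    refine (eLpNorm_sum_le (fun j _ => hj j) le_rfl).trans ?_
    simp [eLpNorm_comp_measurePreserving hf (hU.iterate _)]
  refine (mul_le_mul_right h1 _).trans ?_
  rcases Nat.eq_zero_or_pos m with rfl | hm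
  · simp
  · rw [← mul_assoc, enorm_inv (by positivity)]
    rw [show ‖(m : ℝ)‖ₑ = m by simp, ENNReal.inv_mul_cancel (by simp [hm.ne']) (by simp), one_mul]

/-- Birkhoff averages of an integrable function converge in `L¹`. -/
theorem exists_tendsto_eLpNorm_one_birkhoffAverage [IsProbabilityMeasure ν]
    (hU : MeasurePreserving U ν ν) {f : X → ℝ} (hf : MemLp f 1 ν) :
    ∃ l : X → ℝ, Measurable l ∧ MemLp l 1 ν ∧
      Tendsto (fun m => eLpNorm (birkhoffAverage ℝ U f m - l) 1 ν) atTop (𝓝 0) := by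
  have hav : ∀ g : X → ℝ, MemLp g 1 ν → ∀ m, MemLp (birkhoffAverage ℝ U g m) 1 ν := by
    intro g hg m
    have e : birkhoffAverage ℝ U g m = (m : ℝ)⁻¹ • ∑ j ∈ Finset.range m, g ∘ U^[j] := by
      ext x; simp [birkhoffAverage, birkhoffSum]
    rw [e]
    exact (memLp_finsetSum' _ fun j _ => hg.comp_measurePreserving (hU.iterate j)).const_smul _
  let F : ℕ → Lp ℝ 1 ν := fun m => (hav f hf m).toLp _
  have hF : CauchySeq F := by
    rw [EMetric.cauchySeq_iff]
    intro ε hε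
    have hε' : ε / 2 / 2 ≠ 0 := by simp [hε.ne']
    -- approximation by a bounded function, for which the averages converge
    obtain ⟨g, hg, -⟩ := hf.exists_simpleFunc_eLpNorm_sub_lt ENNReal.one_ne_top hε'
    have hg1 : MemLp g 1 ν := g.memLp_of_isFiniteMeasure 1 ν
    obtain ⟨l, hl, hlim⟩ :=
      exists_tendsto_eLpNorm_two_birkhoffAverage hU (g.memLp_of_isFiniteMeasure 2 ν)
    have hl1 : MemLp l 1 ν := hl.mono_exponent (by norm_num)
    obtain ⟨N, hN⟩ := eventually_atTop.1 (hlim.eventually_lt_const (pos_iff_ne_zero.2 hε'))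
    have hN1 : ∀ m ≥ N, eLpNorm (birkhoffAverage ℝ U g m - l) 1 ν < ε / 2 / 2 := fun m hm =>
      (eLpNorm_le_eLpNorm_of_exponent_le (by norm_num)
        ((hav g hg1 m).sub hl1).aestronglyMeasurable).trans_lt (hN m hm)
    have hfg : ∀ m, eLpNorm (birkhoffAverage ℝ U f m - birkhoffAverage ℝ U g m) 1 ν <
        ε / 2 / 2 := by
      intro m
      have e : birkhoffAverage ℝ U f m - birkhoffAverage ℝ U g m =
          birkhoffAverage ℝ U (f - ⇑g) m := by
        rw [birkhoffAverage_sub]; rfl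
      rw [e]
      exact (eLpNorm_one_birkhoffAverage_le hU (hf.sub hg1).aestronglyMeasurable m).trans_lt hg
    refine ⟨N, fun a ha b hb => ?_⟩
    simp only [F]
    rw [Lp.edist_toLp_toLp]
    have e : birkhoffAverage ℝ U f a - birkhoffAverage ℝ U f b =
        ((birkhoffAverage ℝ U f a - birkhoffAverage ℝ U g a) +
          (birkhoffAverage ℝ U g a - l)) - ((birkhoffAverage ℝ U f b - birkhoffAverage ℝ U g b) +
          (birkhoffAverage ℝ U g b - l)) := by abel
    have hm1 : ∀ m, MemLp (birkhoffAverage ℝ U f m - birkhoffAverage ℝ U g m) 1 ν := fun m =>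
      (hav f hf m).sub (hav g hg1 m)
    have hm2 : ∀ m, MemLp (birkhoffAverage ℝ U g m - l) 1 ν := fun m => (hav g hg1 m).sub hl1
    have hb2 : ∀ m ≥ N, eLpNorm ((birkhoffAverage ℝ U f m - birkhoffAverage ℝ U g m) +
          (birkhoffAverage ℝ U g m - l)) 1 ν < ε / 2 := fun m hm => by
      refine (eLpNorm_add_le (hm1 m).aestronglyMeasurable (hm2 m).aestronglyMeasurable
        le_rfl).trans_lt ?_
      exact (ENNReal.add_lt_add (hfg m) (hN1 m hm)).trans_le (ENNReal.add_halves _).le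
    rw [e]
    refine (eLpNorm_sub_le ((hm1 a).add (hm2 a)).aestronglyMeasurable
      ((hm1 b).add (hm2 b)).aestronglyMeasurable le_rfl).trans_lt ?_
    exact (ENNReal.add_lt_add (hb2 a ha) (hb2 b hb)).trans_le (ENNReal.add_halves _).le
  obtain ⟨L, hL⟩ := cauchySeq_tendsto_of_complete hF
  refine ⟨L, (Lp.stronglyMeasurable L).measurable, Lp.memLp L, ?_⟩
  refine ((Lp.tendsto_Lp_iff_tendsto_eLpNorm' _ _).1 hL).congr fun m => ?_
  exact eLpNorm_congr_ae ((MemLp.coeFn_toLp (hav f hf m)).sub EventuallyEq.rfl)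

end MeanErgodic

end

section

/-! ### The number of points of a stationary ergodic process -/

/-- The number of points of a two-sided configuration in `(a, b]`. -/
def pointCount (a b : ℝ) (x : ℤ → ℝ) : ENNReal := ∑' k, (Ioc a b).indicator 1 (x k)

theorem measurable_pointCount (a b : ℝ) : Measurable (pointCount a b) :=
  Measurable.tsum fun k => (measurable_one.indicator measurableSet_Ioc).comp (measurable_pi_apply k)

/-- A shift in time only relabels the points, by a bijection of `ℤ`. -/
theorem pointCount_timeShift (a b t : ℝ) (x : ℤ → ℝ) :
    pointCount a b (timeShift t x) = pointCount (a + t) (b + t) x := by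
  unfold pointCount
  rw [← (Equiv.addRight (sSup {j : ℤ | x j ≤ t})).tsum_eq
    fun k => (Ioc (a + t) (b + t)).indicator 1 (x k)]
  refine tsum_congr fun k => ?_
  simp only [timeShift, indicator, mem_Ioc, Equiv.coe_addRight, lt_sub_iff_add_lt,
    sub_le_iff_le_add, Pi.one_apply]

theorem pointCount_add {a b c : ℝ} (hab : a ≤ b) (hbc : b ≤ c) (x : ℤ → ℝ) :
    pointCount a b x + pointCount b c x = pointCount a c x := by
  unfold pointCount
  rw [← ENNReal.tsum_add]
  refine tsum_congr fun k => ?_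
  rw [← Ioc_union_Ioc_eq_Ioc hab hbc, indicator_union_of_disjoint (Ioc_disjoint_Ioc_of_le le_rfl)]

theorem pointCount_mono {a b c d : ℝ} (hca : c ≤ a) (hbd : b ≤ d) (x : ℤ → ℝ) :
    pointCount a b x ≤ pointCount c d x :=
  ENNReal.tsum_le_tsum fun _ =>
    indicator_le_indicator_of_subset (Ioc_subset_Ioc hca hbd) (fun _ => zero_le) _

theorem pointCount_le_of_subset {a b a' b' c d c' d' : ℝ}
    (h : Ioc a b ⊆ Ioc a' b' ∪ (Ioc c d ∪ Ioc c' d')) (x : ℤ → ℝ) :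
    pointCount a b x ≤ pointCount a' b' x + (pointCount c d x + pointCount c' d' x) := by
  unfold pointCount
  rw [← ENNReal.tsum_add, ← ENNReal.tsum_add]
  refine ENNReal.tsum_le_tsum fun k => ?_
  by_cases hk : x k ∈ Ioc a b
  · rw [indicator_of_mem hk]
    rcases h hk with h | h | h <;> rw [indicator_of_mem h]
    · exact le_self_add
    · exact le_self_add.trans le_add_self
    · exact le_add_self.trans le_add_self
  · rw [indicator_of_notMem hk]; exact zero_le

/-- Moving the window `(0, m]` by `t` changes the count by at most the points near its ends. -/
theorem pointCount_shift_le (m t : ℝ) (x : ℤ → ℝ) :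
    pointCount (0 + t) (m + t) x ≤ pointCount 0 m x +
      (pointCount (-|t|) |t| x + pointCount (m - |t|) (m + |t|) x) ∧
    pointCount 0 m x ≤ pointCount (0 + t) (m + t) x +
      (pointCount (-|t|) |t| x + pointCount (m - |t|) (m + |t|) x) := by
  have h1 := le_abs_self t
  have h2 := neg_abs_le t
  constructor <;> refine pointCount_le_of_subset (fun p hp => ?_) x <;>
    simp only [mem_union, mem_Ioc] at hp ⊢ <;> by_contra hc <;> push Not at hc <;>
    obtain ⟨c1, c2, c3⟩ := hc
  · by_cases h0 : 0 < p
    · have := c1 h0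
      have := c3 (by linarith)
      linarith [hp.2]
    · have := c2 (by linarith [hp.1])
      linarith
  · by_cases h0 : 0 + t < p
    · have := c1 h0
      have := c3 (by linarith)
      linarith [hp.2]
    · have := c2 (by linarith [hp.1])
      linarith

theorem pointCount_iterate (a b : ℝ) (j : ℕ) (x : ℤ → ℝ) :
    pointCount a b ((timeShift 1)^[j] x) = pointCount (a + j) (b + j) x := by
  induction j generalizing a b with
  | zero => simp
  | succ j ih =>
    rw [Function.iterate_succ_apply', pointCount_timeShift, ih]
    push_cast
    congr 1 <;> ring

theorem sum_pointCount (m : ℕ) (x : ℤ → ℝ) :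
    ∑ j ∈ Finset.range m, pointCount 0 1 ((timeShift 1)^[j] x) = pointCount 0 m x := by
  induction m with
  | zero => simp [pointCount]
  | succ m ih =>
    rw [Finset.sum_range_succ, ih, pointCount_iterate]
    push_cast
    rw [zero_add, add_comm (1 : ℝ)]
    exact pointCount_add (Nat.cast_nonneg m) (by linarith) x

theorem enorm_toReal_sub_toReal_le {a b e : ENNReal} (hb : b ≠ ⊤) (h1 : a ≤ b + e)
    (h2 : b ≤ a + e) : ‖a.toReal - b.toReal‖ₑ ≤ e := by
  rcases eq_or_ne e ⊤ with rfl | he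
  · exact le_top
  have ha : a ≠ ⊤ := ne_top_of_le_ne_top (ENNReal.add_ne_top.2 ⟨hb, he⟩) h1
  rw [Real.enorm_eq_ofReal_abs]
  refine ENNReal.ofReal_le_of_le_toReal (abs_sub_le_iff.2 ⟨?_, ?_⟩)
  · rw [sub_le_iff_le_add', ← ENNReal.toReal_add hb he]
    exact ENNReal.toReal_mono (ENNReal.add_ne_top.2 ⟨hb, he⟩) h1
  · rw [sub_le_iff_le_add', ← ENNReal.toReal_add ha he]
    exact ENNReal.toReal_mono (ENNReal.add_ne_top.2 ⟨ha, he⟩) h2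

section Stationary

variable {ν : Measure (ℤ → ℝ)} (hθ : ∀ t, MeasurePreserving (timeShift t) ν ν)

include hθ

theorem lintegral_pointCount_add_right (a b t : ℝ) :
    ∫⁻ x, pointCount (a + t) (b + t) x ∂ν = ∫⁻ x, pointCount a b x ∂ν := by
  simp only [← pointCount_timeShift]
  exact (hθ t).lintegral_comp (measurable_pointCount a b)

theorem lintegral_pointCount_natCast (m : ℕ) :
    ∫⁻ x, pointCount 0 m x ∂ν = m * ∫⁻ x, pointCount 0 1 x ∂ν := by
  simp only [← sum_pointCount]
  have hj : ∀ j, Measurable fun x => pointCount 0 1 ((timeShift 1)^[j] x) := fun j =>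
    (measurable_pointCount 0 1).comp ((hθ 1).measurable.iterate j)
  rw [lintegral_finsetSum _ fun j _ => hj j]
  simp only [((hθ 1).iterate _).lintegral_comp (measurable_pointCount 0 1), Finset.sum_const,
    Finset.card_range, nsmul_eq_mul]

theorem lintegral_pointCount_ne_top (hfin : ∫⁻ x, pointCount 0 1 x ∂ν ≠ ⊤) (a b : ℝ) :
    ∫⁻ x, pointCount a b x ∂ν ≠ ⊤ := by
  have h := lintegral_pointCount_add_right hθ 0 (b - a) a
  rw [zero_add, sub_add_cancel] at h
  rw [h]
  refine ne_top_of_le_ne_top (b := ∫⁻ x, pointCount 0 ⌈b - a⌉₊ x ∂ν) ?_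
    (lintegral_mono fun x => pointCount_mono le_rfl (Nat.le_ceil _) x)
  rw [lintegral_pointCount_natCast hθ]
  exact ENNReal.mul_ne_top (by simp) hfin

theorem ae_pointCount_ne_top (hfin : ∫⁻ x, pointCount 0 1 x ∂ν ≠ ⊤) (a b : ℝ) :
    ∀ᵐ x ∂ν, pointCount a b x ≠ ⊤ := by
  filter_upwards [ae_lt_top (measurable_pointCount a b) (lintegral_pointCount_ne_top hθ hfin a b)]
    with x hx using hx.ne

theorem birkhoffAverage_pointCount (hfin : ∫⁻ x, pointCount 0 1 x ∂ν ≠ ⊤) (m : ℕ) :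
    birkhoffAverage ℝ (timeShift 1) (fun x => (pointCount 0 1 x).toReal) m =ᵐ[ν]
      fun x => (m : ℝ)⁻¹ * (pointCount 0 m x).toReal := by
  filter_upwards [ae_all_iff.2 fun j : ℕ => ae_pointCount_ne_top hθ hfin (0 + j) (1 + j)] with x hx
  rw [birkhoffAverage, birkhoffSum, smul_eq_mul, ← sum_pointCount, ENNReal.toReal_sum]
  intro j _
  rw [pointCount_iterate]
  exact hx j

/-- The mean of the count over a window is asymptotically invariant under every shift. -/
theorem tendsto_eLpNorm_shift_sub (hfin : ∫⁻ x, pointCount 0 1 x ∂ν ≠ ⊤) (t : ℝ) :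
    Tendsto (fun m : ℕ => eLpNorm (fun x => (m : ℝ)⁻¹ * (pointCount 0 m (timeShift t x)).toReal -
      (m : ℝ)⁻¹ * (pointCount 0 m x).toReal) 1 ν) atTop (𝓝 0) := by
  set C : ENNReal := 2 * ∫⁻ x, pointCount (-|t|) |t| x ∂ν with hC
  have hCtop : C ≠ ⊤ := ENNReal.mul_ne_top (by simp) (lintegral_pointCount_ne_top hθ hfin _ _)
  have hlim : Tendsto (fun m : ℕ => C * (m : ENNReal)⁻¹) atTop (𝓝 0) := by
    have := ENNReal.Tendsto.const_mul (a := C) ENNReal.tendsto_inv_nat_nhds_zero (Or.inr hCtop)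
    rwa [mul_zero] at this
  refine tendsto_of_tendsto_of_tendsto_of_le_of_le' tendsto_const_nhds hlim
    (Eventually.of_forall fun _ => zero_le) ?_
  filter_upwards [eventually_gt_atTop 0] with m hm
  rw [eLpNorm_one_eq_lintegral_enorm]
  calc ∫⁻ x, ‖(m : ℝ)⁻¹ * (pointCount 0 m (timeShift t x)).toReal -
          (m : ℝ)⁻¹ * (pointCount 0 m x).toReal‖ₑ ∂ν
      ≤ ∫⁻ x, (m : ENNReal)⁻¹ *
          (pointCount (-|t|) |t| x + pointCount (m - |t|) (m + |t|) x) ∂ν := by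
        refine lintegral_mono_ae ?_
        filter_upwards [ae_pointCount_ne_top hθ hfin 0 m] with x hx
        rw [← mul_sub, enorm_mul, enorm_inv (by positivity), Real.enorm_natCast]
        refine mul_le_mul_right ?_ _
        rw [pointCount_timeShift]
        exact enorm_toReal_sub_toReal_le hx (pointCount_shift_le m t x).1
          (pointCount_shift_le m t x).2
    _ = C * (m : ENNReal)⁻¹ := by
        have h := lintegral_pointCount_add_right hθ (-|t|) |t| m
        have hm2 : Measurable fun x =>
            pointCount (-|t|) |t| x + pointCount (m - |t|) (m + |t|) x :=
          (measurable_pointCount _ _).add (measurable_pointCount _ _)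
        rw [lintegral_const_mul _ hm2, lintegral_add_left (measurable_pointCount _ _), mul_comm]
        rw [show (m : ℝ) - |t| = -|t| + m by ring, show (m : ℝ) + |t| = |t| + m by ring, h, hC,
          two_mul]

/-- The ergodic theorem for the number of points: the mean number of points per unit of time
converges in `L¹` to the intensity. -/
theorem tendsto_lintegral_pointCount [IsProbabilityMeasure ν]
    (hfin : ∫⁻ x, pointCount 0 1 x ∂ν ≠ ⊤)
    (herg : ∀ A : Set (ℤ → ℝ), MeasurableSet A → (∀ t, timeShift t ⁻¹' A =ᵐ[ν] A) →
      ν A = 0 ∨ ν A = 1) :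
    Tendsto (fun m : ℕ => ∫⁻ x, ‖(m : ℝ)⁻¹ * (pointCount 0 m x).toReal -
      (∫⁻ x, pointCount 0 1 x ∂ν).toReal‖ₑ ∂ν) atTop (𝓝 0) := by
  set f : (ℤ → ℝ) → ℝ := fun x => (pointCount 0 1 x).toReal with hf
  have hfint : Integrable f ν :=
    integrable_toReal_of_lintegral_ne_top (measurable_pointCount 0 1).aemeasurable hfin
  have hfm : MemLp f 1 ν := memLp_one_iff_integrable.2 hfint
  obtain ⟨l, hlm, hl1, hlim⟩ := exists_tendsto_eLpNorm_one_birkhoffAverage (hθ 1) hfm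
  set A : ℕ → (ℤ → ℝ) → ℝ := fun m x => (m : ℝ)⁻¹ * (pointCount 0 m x).toReal with hA
  have hAm : ∀ m, Measurable (A m) := fun m =>
    (measurable_pointCount 0 m).ennreal_toReal.const_mul _
  have hlimA : Tendsto (fun m => eLpNorm (A m - l) 1 ν) atTop (𝓝 0) :=
    hlim.congr fun m => eLpNorm_congr_ae
      ((birkhoffAverage_pointCount hθ hfin m).sub EventuallyEq.rfl)
  have hinv : ∀ t, l ∘ timeShift t =ᵐ[ν] l := by
    intro t
    have hlt : Measurable (l ∘ timeShift t) := hlm.comp (hθ t).measurable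
    have h0 : eLpNorm (l ∘ timeShift t - l) 1 ν = 0 := by
      refine le_antisymm ?_ (zero_le)
      have hsum := (hlimA.add (tendsto_eLpNorm_shift_sub hθ hfin t)).add hlimA
      simp only [add_zero] at hsum
      refine ge_of_tendsto' hsum fun m => ?_
      have e : l ∘ timeShift t - l = (-((A m - l) ∘ timeShift t) +
          (A m ∘ timeShift t - A m)) + (A m - l) := by
        ext x
        simp only [Pi.sub_apply, Pi.add_apply, Pi.neg_apply, Function.comp_apply]
        ring
      have m1 : AEStronglyMeasurable (-((A m - l) ∘ timeShift t)) ν :=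
        (((hAm m).sub hlm).comp (hθ t).measurable).neg.aestronglyMeasurable
      have m2 : AEStronglyMeasurable (A m ∘ timeShift t - A m) ν :=
        (((hAm m).comp (hθ t).measurable).sub (hAm m)).aestronglyMeasurable
      rw [e]
      refine (eLpNorm_add_le (m1.add m2) ((hAm m).sub hlm).aestronglyMeasurable le_rfl).trans ?_
      refine add_le_add
        ((eLpNorm_add_le m1 m2 le_rfl).trans (add_le_add (le_of_eq ?_) le_rfl)) le_rfl
      rw [eLpNorm_neg, eLpNorm_comp_measurePreserving ((hAm m).sub hlm).aestronglyMeasurable (hθ t)]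
    have h1 := (eLpNorm_eq_zero_iff (hlt.sub hlm).aestronglyMeasurable one_ne_zero).1 h0
    filter_upwards [h1] with x hx
    exact sub_eq_zero.1 hx
  obtain ⟨c, hc⟩ : ∃ c, l =ᵐ[ν] fun _ => c := by
    refine exists_eventuallyEq_const_of_forall_separating MeasurableSet fun V hV => ?_
    have := herg (l ⁻¹' V) (hlm hV) fun t => by
      filter_upwards [hinv t] with x hx
      apply propext
      change l (timeShift t x) ∈ V ↔ l x ∈ V
      rw [← hx]; rfl
    rcases this with h | h
    · right
      filter_upwards [measure_eq_zero_iff_ae_notMem.1 h] with x hx using hx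
    · left
      exact (mem_ae_iff_prob_eq_one (hlm hV)).2 h
  have hlimc : Tendsto (fun m => ∫⁻ x, ‖A m x - c‖ₑ ∂ν) atTop (𝓝 0) :=
    hlimA.congr fun m => by
      rw [eLpNorm_one_eq_lintegral_enorm]
      refine lintegral_congr_ae ?_
      filter_upwards [hc] with x hx
      rw [Pi.sub_apply, hx]
  -- the constant is the intensity, as is seen by taking expectations
  have hAint : ∀ m, Integrable (A m) ν := fun m =>
    (integrable_toReal_of_lintegral_ne_top (measurable_pointCount 0 m).aemeasurable
      (lintegral_pointCount_ne_top hθ hfin 0 m)).const_mul _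
  have hAval : ∀ m : ℕ, 0 < m → ∫ x, A m x ∂ν = (∫⁻ x, pointCount 0 1 x ∂ν).toReal := by
    intro m hm
    have hm0 : (m : ℝ) ≠ 0 := by positivity
    rw [integral_const_mul, integral_toReal (measurable_pointCount 0 m).aemeasurable
      (by filter_upwards [ae_pointCount_ne_top hθ hfin 0 m] with x hx using hx.lt_top),
      lintegral_pointCount_natCast hθ, ENNReal.toReal_mul, ENNReal.toReal_natCast,
      inv_mul_cancel_left₀ hm0]
  have hcv : Tendsto (fun m => ∫ x, A m x ∂ν) atTop (𝓝 (∫ _, c ∂ν)) :=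
    tendsto_integral_of_L1 _ aestronglyMeasurable_const (Eventually.of_forall hAint) hlimc
  have hcv2 : Tendsto (fun m => ∫ x, A m x ∂ν) atTop (𝓝 (∫⁻ x, pointCount 0 1 x ∂ν).toReal) :=
    tendsto_const_nhds.congr' (by
      filter_upwards [eventually_gt_atTop 0] with m hm using (hAval m hm).symm)
  have hce := tendsto_nhds_unique hcv hcv2
  rw [integral_const, probReal_univ, one_smul] at hce
  rw [← hce]
  exact hlimc

end Stationary

end

section

/-! ### The limit of the mean number of hits -/

/-- Counting up to time `m` and counting the first `K` terms differ by at most the discrepancy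
between `K` and the number of terms up to time `m`. -/
theorem sum_range_le_tsum_indicator {e : ℕ → ℝ} (he : StrictMono e) {W : ℕ → ENNReal}
    (hW : ∀ k, W k ≤ 1) (K : ℕ) (m : ℝ) :
    ∑ k ∈ Finset.range K, W k ≤ ∑' k, (Iic m).indicator 1 (e k) * W k +
      (K - ∑' k, (Iic m).indicator (1 : ℝ → ENNReal) (e k)) := by
  by_cases h : ∀ k < K, e k ≤ m
  · refine le_trans ?_ le_self_add
    refine le_trans (le_of_eq ?_) (ENNReal.sum_le_tsum (Finset.range K))
    refine Finset.sum_congr rfl fun k hk => ?_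
    rw [indicator_of_mem (show e k ∈ Iic m from h k (Finset.mem_range.1 hk)), Pi.one_apply, one_mul]
  · push Not at h
    obtain ⟨j, hj, hjm⟩ := h
    have hbig : ∀ k ∉ Finset.range K, e k ∉ Iic m := fun k hk hkm => by
      have : e j ≤ e k := he.monotone (hj.le.trans (not_lt.1 fun h => hk (Finset.mem_range.2 h)))
      exact absurd (hjm.trans_le this) (not_lt.2 hkm)
    rw [tsum_eq_sum (s := Finset.range K) fun k hk => by
      rw [indicator_of_notMem (hbig k hk), zero_mul],
      tsum_eq_sum (s := Finset.range K) fun k hk => indicator_of_notMem (hbig k hk) _]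
    have hfin : ∑ k ∈ Finset.range K, (Iic m).indicator (1 : ℝ → ENNReal) (e k) ≠ ⊤ :=
      ENNReal.sum_ne_top.2 fun k _ => by by_cases h : e k ∈ Iic m <;> simp [h]
    rw [← ENNReal.add_le_add_iff_right hfin, add_assoc, tsub_add_cancel_of_le]
    · rw [show (K : ENNReal) = ∑ k ∈ Finset.range K, 1 by simp, ← Finset.sum_add_distrib,
        ← Finset.sum_add_distrib]
      refine Finset.sum_le_sum fun k _ => ?_
      by_cases h : e k ∈ Iic m
      · simp [h]
      · simpa [h] using hW k
    · rw [show (K : ENNReal) = ∑ k ∈ Finset.range K, 1 by simp]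
      refine Finset.sum_le_sum fun k _ => ?_
      by_cases h : e k ∈ Iic m <;> simp [h]

theorem tsum_indicator_le_sum_range {e : ℕ → ℝ} {W : ℕ → ENNReal}
    (he : StrictMono e) (hW : ∀ k, W k ≤ 1) (K : ℕ) (m : ℝ) :
    ∑' k, (Iic m).indicator 1 (e k) * W k ≤ ∑ k ∈ Finset.range K, W k +
      (∑' k, (Iic m).indicator (1 : ℝ → ENNReal) (e k) - K) := by
  by_cases h : ∀ k < K, e k ≤ m
  · have hs : ∀ F : ℕ → ENNReal, ∑' k, F k = ∑ k ∈ Finset.range K, F k + ∑' k, F (k + K) :=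
      fun F => (ENNReal.summable.sum_add_tsum_nat_add' (f := F) (k := K)).symm
    have h1 : ∑ k ∈ Finset.range K, (Iic m).indicator (1 : ℝ → ENNReal) (e k) = K := by
      rw [Finset.sum_congr rfl fun k hk =>
        indicator_of_mem (show e k ∈ Iic m from h k (Finset.mem_range.1 hk)) _]
      simp
    rw [hs, hs fun k => (Iic m).indicator (1 : ℝ → ENNReal) (e k), h1,
      ENNReal.add_sub_cancel_left (by simp)]
    refine add_le_add (Finset.sum_le_sum fun k _ => ?_) (ENNReal.tsum_le_tsum fun k => ?_)
    · by_cases h : e k ∈ Iic m <;> simp [h]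
    · exact (mul_le_mul_right (hW _) _).trans (mul_one _).le
  · push Not at h
    obtain ⟨j, hj, hjm⟩ := h
    have hbig : ∀ k ∉ Finset.range K, e k ∉ Iic m := fun k hk hkm => by
      have : e j ≤ e k := he.monotone (hj.le.trans (not_lt.1 fun h => hk (Finset.mem_range.2 h)))
      exact absurd (hjm.trans_le this) (not_lt.2 hkm)
    rw [tsum_eq_sum (s := Finset.range K) fun k hk => by
      rw [indicator_of_notMem (hbig k hk), zero_mul]]
    refine le_trans (Finset.sum_le_sum fun k _ => ?_) le_self_add
    by_cases h : e k ∈ Iic m <;> simp [h]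

theorem natCast_tsub_le_enorm {N : ENNReal} (hN : N ≠ ⊤) (K : ℕ) :
    K - N ≤ ‖(K : ℝ) - N.toReal‖ₑ ∧ N - K ≤ ‖(K : ℝ) - N.toReal‖ₑ := by
  lift N to NNReal using hN
  rw [Real.enorm_eq_ofReal_abs, tsub_le_iff_right, tsub_le_iff_right, ENNReal.coe_toReal,
    ← ENNReal.ofReal_coe_nnreal, ← ENNReal.ofReal_natCast, ← ENNReal.ofReal_add (abs_nonneg _)
    (NNReal.coe_nonneg _), ← ENNReal.ofReal_add (abs_nonneg _) (Nat.cast_nonneg _)]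
  constructor <;> refine ENNReal.ofReal_le_ofReal ?_
  · linarith [le_abs_self ((K : ℝ) - N)]
  · linarith [neg_abs_le ((K : ℝ) - N)]

theorem GoodPath.tsum_indicator_Iic {x : ℤ → ℝ} (hx : GoodPath x) (m : ℝ) :
    ∑' c : ℕ, (Iic m).indicator (1 : ℝ → ENNReal) (x (c + 1)) = pointCount 0 m x := by
  have hinj : Function.Injective fun c : ℕ => (c : ℤ) + 1 := fun a b h => by simpa using h
  unfold pointCount
  rw [← hinj.tsum_eq]
  · refine tsum_congr fun c => ?_
    have := hx.goodSeq.pos c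
    simp only [indicator, mem_Iic, mem_Ioc, this, true_and]
  · intro k hk
    have h1 : 0 < x k := by
      by_contra h
      exact hk (indicator_of_notMem (fun h' => h h'.1) _)
    have h2 : 0 < k := hx.strictMono.lt_iff_lt.1 (hx.zero_nonpos.trans_lt h1)
    exact ⟨(k - 1).toNat, by simp; omega⟩

section

variable {Ω : Type*} {n : ℕ} [NeZero n] [MeasurableSpace Ω] {P : Measure Ω}
  [IsProbabilityMeasure P] {s : Fin n → ℝ} {B : ℝ} (ord : DecreasingOrder n)

theorem GoodConf.sum_tsum_indicator {τ : Conf n} (hτ : GoodConf τ) (m : ℝ) :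
    ∑ i, ∑' c, (Iic m).indicator (1 : ℝ → ENNReal) (τ i c) =
      ∑' k, (Iic m).indicator 1 (epoch (canon n) k τ) :=
  hτ.sum_tsum fun i c => (Iic m).indicator (1 : ℝ → ENNReal) (τ i c)

theorem GoodConf.hrvcHitsUpTo_eq {T : Fin n → ℕ → Ω → ℝ} (hreg : IsRegularRequests P T)
    {τ : Conf n} (hτ : GoodConf τ) (m : ℝ) :
    hreg.hrvcHitsUpTo s B ord m τ =
      ∑' k, (Iic m).indicator 1 (epoch (canon n) k τ) * hreg.hrvcProb s B ord k τ := by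
  refine (hτ.sum_tsum _).trans (tsum_congr fun k => ?_)
  rw [hreg.hrvc_trunc]
  rfl

variable {T : Fin n → ℤ → Ω → ℝ}

omit [NeZero n]

theorem IsStationaryErgodic.lintegral_pointCount_zero_one_ne_top (hst : IsStationaryErgodic P T)
    (i : Fin n) : ∫⁻ x, pointCount 0 1 x ∂(P.map fun ω k => T i k ω) ≠ ⊤ := by
  rw [lintegral_map (measurable_pointCount 0 1) (hst.measurable_path i)]
  unfold pointCount
  have hk : ∀ k, Measurable fun ω => (Ioc (0 : ℝ) 1).indicator (1 : ℝ → ENNReal) (T i k ω) :=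
    fun k => (measurable_one.indicator measurableSet_Ioc).comp (hst.measurable i k)
  rw [lintegral_tsum fun k => (hk k).aemeasurable]
  convert hst.finite_intensity i using 3 with k
  exact lintegral_indicator_one (hst.measurable i k measurableSet_Ioc)

/-- The intensity of the requests for object `i`. -/
def intensity (P : Measure Ω) (T : Fin n → ℤ → Ω → ℝ) (i : Fin n) : ℝ :=
  (∫⁻ x, pointCount 0 1 x ∂(P.map fun ω k => T i k ω)).toReal

theorem IsStationaryErgodic.intensity_pos (hst : IsStationaryErgodic P T) (i : Fin n) :
    0 < intensity P T i := by
  refine ENNReal.toReal_pos (fun h0 => ?_) (hst.lintegral_pointCount_zero_one_ne_top i)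
  have h : ∀ᵐ ω ∂P, ∀ m : ℕ, pointCount 0 m (fun k => T i k ω) = 0 := ae_all_iff.2 fun m => by
    have := lintegral_pointCount_natCast (hst.measurePreserving_timeShift i) m
    rw [h0, mul_zero, lintegral_map (measurable_pointCount 0 m) (hst.measurable_path i)] at this
    exact (lintegral_eq_zero_iff ((measurable_pointCount 0 m).comp (hst.measurable_path i))).1 this
  have hF : ∀ᵐ ω ∂P, False := by
    filter_upwards [h, hst.ae_goodPath] with ω h1 h2
    obtain ⟨m, hm⟩ := exists_nat_ge (T i 1 ω)
    have := ENNReal.tsum_eq_zero.1 (h1 m) 1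
    rw [indicator_of_mem (show T i 1 ω ∈ Ioc (0 : ℝ) m from ⟨(h2 i).one_pos, hm⟩)] at this
    exact one_ne_zero this
  exact (eventually_const.1 hF)

theorem IsStationaryErgodic.tendsto_count (hst : IsStationaryErgodic P T) (i : Fin n) :
    Tendsto (fun m : ℕ => ∫⁻ ω, ‖(m : ℝ)⁻¹ * (pointCount 0 m fun k => T i k ω).toReal -
      intensity P T i‖ₑ ∂P) atTop (𝓝 0) := by
  have : IsProbabilityMeasure (P.map fun ω k => T i k ω) :=
    Measure.isProbabilityMeasure_map (hst.measurable_path i).aemeasurable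
  have h := tendsto_lintegral_pointCount (hst.measurePreserving_timeShift i)
    (hst.lintegral_pointCount_zero_one_ne_top i) fun A hA hinv => by
      rw [Measure.map_apply (hst.measurable_path i) hA]
      exact hst.ergodic i A hA hinv
  refine h.congr fun m => ?_
  rw [lintegral_map _ (hst.measurable_path i)]
  · rfl
  · exact (((measurable_pointCount 0 m).ennreal_toReal.const_mul _).sub_const _).enorm

end

end

section

section

variable {Ω : Type*} {n : ℕ} [NeZero n] [MeasurableSpace Ω] {P : Measure Ω}
  [IsProbabilityMeasure P] {s : Fin n → ℝ} {B : ℝ} (ord : DecreasingOrder n)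
  {T : Fin n → ℤ → Ω → ℝ}

omit [NeZero n] in
theorem IsStationaryErgodic.ae_pointCount_ne_top (hst : IsStationaryErgodic P T) (m : ℝ) :
    ∀ᵐ ω ∂P, ∀ i, pointCount 0 m (fun k => T i k ω) ≠ ⊤ :=
  ae_all_iff.2 fun i => ae_of_ae_map (hst.measurable_path i).aemeasurable
    (Caching.ae_pointCount_ne_top (hst.measurePreserving_timeShift i)
      (hst.lintegral_pointCount_zero_one_ne_top i) 0 m)

omit [NeZero n] in
/-- The discrepancy between `K` and the number of requests in `(0, m]`, in terms of the total
intensity and the errors in the ergodic theorem. -/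
theorem IsStationaryErgodic.lintegral_discrepancy_le (hst : IsStationaryErgodic P T) {m : ℕ}
    (hm : 0 < m) (K : ℕ) :
    ∫⁻ ω, ‖(K : ℝ) - (∑ i, pointCount 0 m fun k => T i k ω).toReal‖ₑ ∂P ≤
      ‖(K : ℝ) - m * ∑ i, intensity P T i‖ₑ + m * ∑ i, ∫⁻ ω, ‖(m : ℝ)⁻¹ *
        (pointCount 0 m fun k => T i k ω).toReal - intensity P T i‖ₑ ∂P := by
  have hmeas : ∀ i, Measurable fun ω => ‖(m : ℝ)⁻¹ *
        (pointCount 0 m fun k => T i k ω).toReal - intensity P T i‖ₑ := fun i =>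
    ((((measurable_pointCount 0 m).comp (hst.measurable_path i)).ennreal_toReal.const_mul
      _).sub_const _).enorm
  have hm0 : (m : ℝ) ≠ 0 := by positivity
  rw [← lintegral_finsetSum _ fun i _ => hmeas i,
    ← lintegral_const_mul _ (Finset.measurable_sum _ fun i _ => hmeas i)]
  have hc : ‖(K : ℝ) - m * ∑ i, intensity P T i‖ₑ =
      ∫⁻ _, ‖(K : ℝ) - m * ∑ i, intensity P T i‖ₑ ∂P := by simp
  rw [hc, ← lintegral_add_left measurable_const]
  refine lintegral_mono_ae ?_
  filter_upwards [hst.ae_pointCount_ne_top m] with ω hω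
  have e : (K : ℝ) - (∑ i, pointCount 0 m fun k => T i k ω).toReal =
      ((K : ℝ) - m * ∑ i, intensity P T i) - m * ∑ i, ((m : ℝ)⁻¹ *
        (pointCount 0 m fun k => T i k ω).toReal - intensity P T i) := by
    rw [ENNReal.toReal_sum fun i _ => hω i, Finset.sum_sub_distrib, ← Finset.mul_sum, mul_sub,
      mul_inv_cancel_left₀ hm0]
    ring
  rw [e]
  refine (enorm_sub_le).trans (add_le_add le_rfl ?_)
  rw [enorm_mul, Real.enorm_natCast]
  exact mul_le_mul_right (enorm_sum_le _ _) _

/-- The expected numbers of HR-VC hits among the first `K` requests and in `(0, m]` are close when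
`K` is close to the number of requests in `(0, m]`. -/
theorem IsStationaryErgodic.hrvc_discrepancy (hst : IsStationaryErgodic P T) (m : ℝ) (K : ℕ) :
    ∑ k ∈ Finset.range K, ∫⁻ ω, hst.regular.hrvcProb s B ord k (conf (positivePart T) ω) ∂P ≤
        ∫⁻ ω, hst.regular.hrvcHitsUpTo s B ord m (conf (positivePart T) ω) ∂P +
          ∫⁻ ω, ‖(K : ℝ) - (∑ i, pointCount 0 m fun k => T i k ω).toReal‖ₑ ∂P ∧
      ∫⁻ ω, hst.regular.hrvcHitsUpTo s B ord m (conf (positivePart T) ω) ∂P ≤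
        ∑ k ∈ Finset.range K, ∫⁻ ω, hst.regular.hrvcProb s B ord k (conf (positivePart T) ω) ∂P +
          ∫⁻ ω, ‖(K : ℝ) - (∑ i, pointCount 0 m fun k => T i k ω).toReal‖ₑ ∂P := by
  have hcf : Measurable (conf (positivePart T)) := conf_measurable hst.regular.measurable
  have hpm : ∀ k, Measurable fun ω =>
      hst.regular.hrvcProb s B ord k (conf (positivePart T) ω) := fun k =>
    (hst.regular.measurable_hrvcProb s B ord k).comp hcf
  have hum : Measurable fun ω =>
      hst.regular.hrvcHitsUpTo s B ord m (conf (positivePart T) ω) :=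
    (hst.regular.measurable_hrvcHitsUpTo ord m).comp hcf
  have hcount : ∀ᵐ ω ∂P, ∑' k, (Iic m).indicator (1 : ℝ → ENNReal)
      (epoch (canon n) k (conf (positivePart T) ω)) = ∑ i, pointCount 0 m fun k => T i k ω := by
    filter_upwards [hst.condIndep.ae_goodConf hst.regular, hst.ae_goodPath] with ω h1 h2
    rw [← h1.sum_tsum_indicator]
    exact Finset.sum_congr rfl fun i _ => (h2 i).tsum_indicator_Iic m
  rw [← lintegral_finsetSum _ fun k _ => hpm k, ← lintegral_add_left hum,
    ← lintegral_add_left (Finset.measurable_sum _ fun k _ => hpm k)]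
  constructor <;> refine lintegral_mono_ae ?_ <;>
    filter_upwards [hcount, hst.condIndep.ae_goodConf hst.regular, hst.ae_pointCount_ne_top m]
      with ω h1 h2 h3 <;>
    rw [h2.hrvcHitsUpTo_eq ord hst.regular]
  · refine (sum_range_le_tsum_indicator h2.strictMono_epoch
      (fun k => hst.regular.hrvcProb_le_one s B ord k _) K m).trans (add_le_add le_rfl ?_)
    rw [h1]
    exact (natCast_tsub_le_enorm (ENNReal.sum_ne_top.2 fun i _ => h3 i) K).1
  · refine (tsum_indicator_le_sum_range h2.strictMono_epoch
      (fun k => hst.regular.hrvcProb_le_one s B ord k _) K m).trans (add_le_add le_rfl ?_)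
    rw [h1]
    exact (natCast_tsub_le_enorm (ENNReal.sum_ne_top.2 fun i _ => h3 i) K).2

omit [NeZero n]

/-- The expected number of hits is at most the expected number of requests. -/
theorem IsStationaryErgodic.lintegral_hrvcHitsUpTo_le (hst : IsStationaryErgodic P T) (m : ℕ) :
    ∫⁻ ω, hst.regular.hrvcHitsUpTo s B ord m (conf (positivePart T) ω) ∂P ≤
      ENNReal.ofReal (m * ∑ i, intensity P T i) := by
  have hmeas : ∀ i, Measurable fun ω => pointCount 0 m fun k => T i k ω := fun i =>
    (measurable_pointCount 0 m).comp (hst.measurable_path i)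
  have hval : ∀ i, ∫⁻ ω, pointCount 0 m (fun k => T i k ω) ∂P =
      m * ENNReal.ofReal (intensity P T i) := fun i => by
    have := lintegral_pointCount_natCast (hst.measurePreserving_timeShift i) m
    rw [lintegral_map (measurable_pointCount 0 m) (hst.measurable_path i)] at this
    rw [this, intensity, ENNReal.ofReal_toReal (hst.lintegral_pointCount_zero_one_ne_top i)]
  rw [ENNReal.ofReal_mul (Nat.cast_nonneg m), ENNReal.ofReal_natCast,
    ENNReal.ofReal_sum_of_nonneg fun i _ => (hst.intensity_pos i).le, Finset.mul_sum]
  simp only [← hval]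
  rw [← lintegral_finsetSum _ fun i _ => hmeas i]
  refine lintegral_mono_ae ?_
  filter_upwards [hst.ae_goodPath] with ω hω
  refine Finset.sum_le_sum fun i _ => ?_
  rw [← (hω i).tsum_indicator_Iic]
  refine ENNReal.tsum_le_tsum fun c => ?_
  exact (mul_le_mul_right (hrFrac_le_one ord _ _) _).trans (mul_one _).le

/-- By Fekete's lemma, the mean number of HR-VC hits per unit of time converges. -/
theorem IsStationaryErgodic.exists_tendsto_hrvcHitsUpTo (hst : IsStationaryErgodic P T)
    (hs : ∀ i, 0 < s i) (hB : 0 ≤ B) :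
    ∃ v : ℝ, Tendsto (fun m : ℕ =>
      (∫⁻ ω, hst.regular.hrvcHitsUpTo s B ord m (conf (positivePart T) ω) ∂P).toReal / m)
      atTop (𝓝 v) := by
  set V : ℕ → ENNReal := fun m =>
    ∫⁻ ω, hst.regular.hrvcHitsUpTo s B ord m (conf (positivePart T) ω) ∂P with hV
  have hle : ∀ m, V m ≤ ENNReal.ofReal (m * ∑ i, intensity P T i) :=
    hst.lintegral_hrvcHitsUpTo_le ord
  have htop : ∀ m, V m ≠ ⊤ := fun m => ne_top_of_le_ne_top ENNReal.ofReal_ne_top (hle m)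
  have hL : 0 ≤ ∑ i, intensity P T i := Finset.sum_nonneg fun i _ => (hst.intensity_pos i).le
  have hsub : Subadditive fun m => -(V m).toReal := by
    intro m l
    have h := hst.hrvcHitsUpTo_superadditive ord hs hB (Nat.cast_nonneg m) (Nat.cast_nonneg l)
    rw [← Nat.cast_add] at h
    have h2 := ENNReal.toReal_mono (htop (m + l)) h
    rw [ENNReal.toReal_add (htop m) (htop l)] at h2
    simp only [hV]
    linarith
  have hbdd : BddBelow (range fun m : ℕ => -(V m).toReal / m) := by
    refine ⟨-∑ i, intensity P T i, ?_⟩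
    rintro _ ⟨m, rfl⟩
    dsimp only
    rw [neg_div, neg_le_neg_iff]
    refine div_le_of_le_mul₀ (Nat.cast_nonneg m) hL ?_
    rw [mul_comm]
    exact ENNReal.toReal_le_of_le_ofReal (mul_nonneg (Nat.cast_nonneg m) hL) (hle m)
  refine ⟨-hsub.lim, (hsub.tendsto_lim hbdd).neg.congr fun m => ?_⟩
  rw [neg_div, neg_neg]

end

section

variable {Ω : Type*} {n : ℕ} [NeZero n] [MeasurableSpace Ω] {P : Measure Ω}
  [IsProbabilityMeasure P] {s : Fin n → ℝ} {B : ℝ} (ord : DecreasingOrder n)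
  {T : Fin n → ℤ → Ω → ℝ}

/-- The mean number of HR-VC hits per request converges. -/
theorem IsStationaryErgodic.exists_tendsto_hrvc (hst : IsStationaryErgodic P T)
    (hs : ∀ i, 0 < s i) (hB : 0 ≤ B) :
    ∃ h : ℝ, Tendsto (fun K : ℕ => (∑ k ∈ Finset.range K,
      ∫ z, hrvcHit P (positivePart T) s B ord k z ∂(withSeeds P)) / K) atTop (𝓝 h) := by
  obtain ⟨v, hv⟩ := hst.exists_tendsto_hrvcHitsUpTo ord hs hB
  set V : ℕ → ENNReal := fun m =>
    ∫⁻ ω, hst.regular.hrvcHitsUpTo s B ord m (conf (positivePart T) ω) ∂P with hV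
  set w : ℕ → ENNReal := fun K => ∑ k ∈ Finset.range K,
    ∫⁻ ω, hst.regular.hrvcProb s B ord k (conf (positivePart T) ω) ∂P with hw
  set L := ∑ i, intensity P T i with hL
  have hLpos : 0 < L := Finset.sum_pos (fun i _ => hst.intensity_pos i)
    ⟨0, Finset.mem_univ _⟩
  have hVtop : ∀ m, V m ≠ ⊤ := fun m =>
    ne_top_of_le_ne_top ENNReal.ofReal_ne_top (hst.lintegral_hrvcHitsUpTo_le ord m)
  -- about `K` requests are made up to time `M K`
  set M : ℕ → ℕ := fun K => ⌊L⁻¹ * (K : ℝ)⌋₊ with hM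
  have hMtop : Tendsto M atTop atTop := tendsto_nat_floor_mul_atTop _ (inv_pos.2 hLpos)
  have hMdiv : Tendsto (fun K : ℕ => (M K : ℝ) / K) atTop (𝓝 L⁻¹) :=
    (tendsto_nat_floor_mul_div_atTop (inv_pos.2 hLpos).le).comp tendsto_natCast_atTop_atTop
  have hVK : Tendsto (fun K : ℕ => (V (M K)).toReal / K) atTop (𝓝 (v * L⁻¹)) := by
    refine ((hv.comp hMtop).mul hMdiv).congr' ?_
    filter_upwards [hMtop.eventually_gt_atTop 0] with K hK
    have : (M K : ℝ) ≠ 0 := by positivity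
    simp only [Function.comp_apply]
    field_simp
    rfl
  set δ : ℕ → ENNReal := fun m => ∑ i, ∫⁻ ω, ‖(m : ℝ)⁻¹ *
        (pointCount 0 m fun k => T i k ω).toReal - intensity P T i‖ₑ ∂P with hδ
  have hδ0 : Tendsto δ atTop (𝓝 0) := by
    have := tendsto_finsetSum (Finset.univ : Finset (Fin n)) fun i _ => hst.tendsto_count i
    simpa using this
  have hbound : ∀ᶠ K : ℕ in atTop, ‖(w K).toReal / K - (V (M K)).toReal / K‖ₑ ≤
      ENNReal.ofReal L * (K : ENNReal)⁻¹ + ENNReal.ofReal L⁻¹ * δ (M K) := by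
    filter_upwards [hMtop.eventually_gt_atTop 0, eventually_gt_atTop 0] with K hMK hK
    have hKpos : (0 : ℝ) < K := by positivity
    obtain ⟨h1, h2⟩ := hst.hrvc_discrepancy (s := s) (B := B) ord (M K) K
    have h3 := (enorm_toReal_sub_toReal_le (hVtop (M K)) h1 h2).trans
      (hst.lintegral_discrepancy_le hMK K)
    have hfl : (M K : ℝ) ≤ L⁻¹ * K := Nat.floor_le (by positivity)
    have hfl2 : L⁻¹ * K < M K + 1 := Nat.lt_floor_add_one _
    have hKL : |(K : ℝ) - M K * L| ≤ L := by
      have e : (K : ℝ) = L⁻¹ * K * L := by field_simp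
      rw [abs_le]
      constructor
      · nlinarith
      · nlinarith
    rw [← sub_div, div_eq_inv_mul, enorm_mul, enorm_inv hKpos.ne', Real.enorm_natCast]
    refine (mul_le_mul_right h3 _).trans ?_
    rw [mul_add, ← mul_assoc]
    refine add_le_add ?_ (mul_le_mul_left ?_ _)
    · rw [mul_comm, Real.enorm_eq_ofReal_abs]
      exact mul_le_mul_left (ENNReal.ofReal_le_ofReal hKL) _
    · rw [← ENNReal.ofReal_natCast, ← ENNReal.ofReal_natCast, ← ENNReal.ofReal_inv_of_pos hKpos,
        ← ENNReal.ofReal_mul (by positivity)]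
      refine ENNReal.ofReal_le_ofReal ?_
      rw [inv_mul_le_iff₀ hKpos]
      linarith
  have hlim : Tendsto (fun K : ℕ => ENNReal.ofReal L * (K : ENNReal)⁻¹ +
      ENNReal.ofReal L⁻¹ * δ (M K)) atTop (𝓝 0) := by
    have h1 := ENNReal.Tendsto.const_mul (a := ENNReal.ofReal L)
      ENNReal.tendsto_inv_nat_nhds_zero (Or.inr ENNReal.ofReal_ne_top)
    have h2 := ENNReal.Tendsto.const_mul (a := ENNReal.ofReal L⁻¹) (hδ0.comp hMtop)
      (Or.inr ENNReal.ofReal_ne_top)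
    simpa using h1.add h2
  have hdiff : Tendsto (fun K : ℕ => (w K).toReal / K - (V (M K)).toReal / K) atTop (𝓝 0) :=
    tendsto_zero_iff_enorm_tendsto_zero.2 (tendsto_of_tendsto_of_tendsto_of_le_of_le'
      tendsto_const_nhds hlim (Eventually.of_forall fun _ => zero_le) hbound)
  refine ⟨v * L⁻¹, ?_⟩
  have hsum := hdiff.add hVK
  rw [zero_add] at hsum
  refine hsum.congr fun K => ?_
  rw [sub_add_cancel]
  simp only [hst.regular.integral_hrvcHit]
  rw [hw, ENNReal.toReal_sum]
  intro k _
  refine ne_top_of_le_ne_top ENNReal.one_ne_top ?_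
  refine (lintegral_mono fun ω => hst.regular.hrvcProb_le_one s B ord k _).trans ?_
  simp

end

end

end Caching

end

theorem mainTheorem3 {n : ℕ} [NeZero n] {Ω : Type*} [MeasurableSpace Ω] (P : Measure Ω)
    [IsProbabilityMeasure P] (s : Fin n → ℝ) (hs : ∀ i, 0 < s i) (B : ℝ) (hB : 0 ≤ B)
    (ord : Caching.DecreasingOrder n) :
    (∀ T : Fin n → ℕ → Ω → ℝ,
      Caching.IsRegularRequests P T → Caching.CondIndepRequests P T →
      ∀ π : Caching.ICPolicy s B,
        (∀ K : ℕ, ∫ ω, Caching.numHits T π K ω ∂P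
          ≤ ∫ z, Caching.hrvcNumHits P T s B ord K z ∂(Caching.withSeeds P)) ∧
        (∀ h : ℝ, Caching.HasHitProbability P T π h →
          Tendsto (fun K : ℕ => (∫ ω, Caching.numHits T π K ω ∂P) / K) atTop (𝓝 h) ∧
          h ≤ liminf (fun K : ℕ =>
            (∫ z, Caching.hrvcNumHits P T s B ord K z ∂(Caching.withSeeds P)) / K) atTop)) ∧
    (∀ T : Fin n → ℤ → Ω → ℝ, Caching.IsStationaryErgodic P T →
      ∃ hHR : ℝ,
        Tendsto (fun K : ℕ => (1 / (K : ℝ)) * ∑ k ∈ Finset.range K,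
          ∫ z, Caching.hrvcHit P (Caching.positivePart T) s B ord k z ∂(Caching.withSeeds P))
          atTop (𝓝 hHR) ∧
        Tendsto (fun K : ℕ =>
          (∫ z, Caching.hrvcNumHits P (Caching.positivePart T) s B ord K z
            ∂(Caching.withSeeds P)) / K) atTop (𝓝 hHR) ∧
        ∀ (π : Caching.ICPolicy s B) (hπ : ℝ),
          Caching.HasHitProbability P (Caching.positivePart T) π hπ →
          Tendsto (fun K : ℕ => (∫ ω, Caching.numHits (Caching.positivePart T) π K ω ∂P) / K)
            atTop (𝓝 hπ) ∧
          hπ ≤ hHR) := by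
  refine ⟨fun T hreg hci π => ⟨fun K => Caching.integral_numHits_le ord hreg hci hs hB π K,
    fun h hh => ⟨hh.tendsto_integral hreg.measurable,
      Caching.le_liminf_hrvcNumHits ord hreg hci hs hB hh⟩⟩, fun T hst => ?_⟩
  obtain ⟨hHR, hlim⟩ := hst.exists_tendsto_hrvc ord hs hB
  have hnum : Tendsto (fun K : ℕ =>
      (∫ z, Caching.hrvcNumHits P (Caching.positivePart T) s B ord K z
        ∂(Caching.withSeeds P)) / K) atTop (𝓝 hHR) :=
    hlim.congr fun K => by rw [Caching.integral_hrvcNumHits ord hst.regular]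
  refine ⟨hHR, hlim.congr fun K => by rw [one_div, inv_mul_eq_div], hnum, fun π hπ hh => ?_⟩
  have hconv := hh.tendsto_integral hst.regular.measurable
  exact ⟨hconv, le_of_tendsto_of_tendsto' hconv hnum fun K => div_le_div_of_nonneg_right
    (Caching.integral_numHits_le ord hst.regular hst.condIndep hs hB π K) (Nat.cast_nonneg K)⟩
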